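/- **Conventions.** Let $k\ge 3$ and $1\le \ell<k/2$ be integers. A $k$-uniform hypergraph $\mathcal H=(V,E)$ consists of a finite vertex set $V$ and a set $E$ of $k$-element subsets of $V$. For $S\subseteq V$ let $d(S)$ be the number of edges containing $S$, and let $\delta_s(\mathcal H)$ be the minimum of $d(S)$ over all $s$-element sets $S\subseteq V$. For $X\subseteq V$ write $X^{(i)}$ for the set of $i$-element subsets of $X$. For $L\subseteq V$, disjoint $X,Y\subseteq V$ and $|L|+i+j=k$, let $d(L,X^{(i)}Y^{(j)})$ be the number of edges of the form $L\cup I\cup J$ with $I\in X^{(i)}$, $J\in Y^{(j)}$; $Y^{(j)}$ is omitted when $j=0$, and $d(v,\cdot)=d(\{v\},\cdot)$. A non-empty $\ell$-path $\mathcal Q$ in $\mathcal H$ is given by a sequence of $t(k-\ell)+\ell$ distinct vertices, for some $t\ge 1$, such that for each $0\le j<t$ the $k$ consecutive vertices in positions $j(k-\ell)+1,\dots,j(k-\ell)+k$ form an edge of $\mathcal H$ (so consecutive edges share exactly $\ell$ vertices). Its ends are the set of its first $\ell$ vertices and the set of its last $\ell$ vertices. $\mathcal H$ on $n$ vertices is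 $(\ell,\xi)$-extremal if there is a partition $V=A\,\dot\cup\, B$ with $|A|=\left\lceil \frac{n}{2(k-\ell)}-1\right\rceil$, $|B|=\left\lfloor\frac{2(k-\ell)-1}{2(k-\ell)}n+1\right\rfloor$ such that at most $\xi\binom nk$ edges are contained in $B$. For $n$ a (large) multiple of $k-\ell$, let $\mathcal X_{k,\ell}(n)$ be the following $k$-uniform hypergraph on an $n$-element set $V=A\,\dot\cup\, B$. If $n$ is an odd multiple of $k-\ell$, then $|A|=\left\lfloor\frac{n}{2(k-\ell)}\right\rfloor$ and the edges are all $k$-sets meeting $A$. If $n$ is an even multiple of $k-\ell$, then $|A|=\frac{n}{2(k-\ell)}-1$ and the edges are all $k$-sets meeting $A$ together with all $k$-subsets of $B$ that contain a fixed $(\ell+1)$-element subset of $B$. **Lemma.** For every real $\rho>0$ and all integers $k\ge 3$ and $1\le\ell<k/2$ there exists $\xi>0$ such that the following holds for all sufficiently large $n$ divisible by $k-\ell$. Suppose that $\mathcal H=(V,E)$ is an $(\ell,\xi)$-extremal $k$-uniform hypergraph on $n$ vertices with $$\delta_{k-2}(\mathcal H)>\delta_{k-2}(\mathcal X_{k,\ell}(n)).$$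 Then there exist a non-empty $\ell$-path $\mathcal Q$ in $\mathcal H$ with ends $L_0$ and $L_1$ and a partition $A_*\,\dot\cup\, B_*=(V\setminus V(\mathcal Q))\cup L_0\cup L_1$ with $L_0,L_1\subseteq B_*$ such that (i) $|B_*|=(2k-2\ell-1)|A_*|+\ell$; (ii) $d(v,B_*^{(k-1)})\ge(1-\rho)\binom{|B_*|}{k-1}$ for every $v\in A_*$; (iii) $d(v,A_*^{(1)}B_*^{(k-2)})\ge(1-\rho)|A_*|\binom{|B_*|}{k-2}$ for every $v\in B_*$; (iv) $d(L_0,A_*^{(1)}B_*^{(k-\ell-1)})\ge(1-\rho)|A_*|\binom{|B_*|}{k-\ell-1}$ and $d(L_1,A_*^{(1)}B_*^{(k-\ell-1)})\ge(1-\rho)|A_*|\binom{|B_*|}{k-\ell-1}$. -/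

import Mathlib

open Finset

/-- A `k`-uniform hypergraph with (finite) vertex set `V`: a set of `k`-element subsets of `V`. -/
structure UniformHypergraph (V : Type*) (k : ℕ) where
  edges : Finset (Finset V)
  card_of_mem_edges : ∀ e ∈ edges, e.card = k

namespace UniformHypergraph

variable {V : Type*} [DecidableEq V] {k : ℕ}

/-- `d(S)`: the number of edges containing `S`. -/
def degree (H : UniformHypergraph V k) (S : Finset V) : ℕ :=
  (H.edges.filter (fun e => S ⊆ e)).card

/-- `δ_s(H)`: the minimum of `d(S)` over all `s`-element sets `S` of vertices
(such sets exist as soon as there are at least `s` vertices). -/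
noncomputable def minDegree (H : UniformHypergraph V k) (s : ℕ) : ℕ :=
  sInf {d : ℕ | ∃ S : Finset V, S.card = s ∧ H.degree S = d}

/-- `d(L, X^(i) Y^(j))`: the number of edges of the form `L ∪ I ∪ J` with `I` an `i`-element subset
of `X` and `J` a `j`-element subset of `Y`. It is used with `X`, `Y` disjoint and
`|L| + i + j = k`, in which case `L`, `I`, `J` are automatically pairwise disjoint. -/
def degreeInto (H : UniformHypergraph V k) (L X : Finset V) (i : ℕ) (Y : Finset V) (j : ℕ) : ℕ :=
  (H.edges.filter
    (fun e => ∃ I ∈ X.powersetCard i, ∃ J ∈ Y.powersetCard j, e = L ∪ I ∪ J)).card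

/-- `e(B)`: the number of edges contained in `B`. -/
def edgesWithin (H : UniformHypergraph V k) (B : Finset V) : ℕ :=
  (H.edges.filter (fun e => e ⊆ B)).card

/-- `H` is `(ℓ, ξ)`-extremal: its vertex set has a partition `A ∪ B` with
`|A| = ⌈n / (2(k-ℓ)) - 1⌉`, `|B| = ⌊(2(k-ℓ)-1) n / (2(k-ℓ)) + 1⌋` and `e(B) ≤ ξ * n.choose k`,
where `n` is the number of vertices. -/
def IsExtremal [Fintype V] (H : UniformHypergraph V k) (ℓ : ℕ) (ξ : ℝ) : Prop :=
  ∃ A B : Finset V, Disjoint A B ∧ A ∪ B = univ ∧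
    (A.card : ℤ) = ⌈(Fintype.card V : ℝ) / (2 * ((k : ℝ) - ℓ)) - 1⌉ ∧
    (B.card : ℤ) =
      ⌊(2 * ((k : ℝ) - ℓ) - 1) / (2 * ((k : ℝ) - ℓ)) * (Fintype.card V : ℝ) + 1⌋ ∧
    (H.edgesWithin B : ℝ) ≤ ξ * ((Fintype.card V).choose k : ℝ)

/-- The vertex sequence `p` is that of an `ℓ`-path of `H` with at least one edge: the `t ≥ 1` edges
of the path are the blocks of `k` consecutive vertices of `p` that start at the positions
`0, k-ℓ, 2(k-ℓ), …, (t-1)(k-ℓ)`. So consecutive edges share exactly `ℓ` vertices, and as `p` has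
`t(k-ℓ) + ℓ = (t-1)(k-ℓ) + k` vertices, each of its vertices lies in an edge. -/
structure IsNonemptyPath (H : UniformHypergraph V k) (ℓ : ℕ) (p : List V) : Prop where
  nodup : p.Nodup
  exists_edges : ∃ t : ℕ, 1 ≤ t ∧ p.length = t * (k - ℓ) + ℓ ∧
    ∀ j < t, ((p.drop (j * (k - ℓ))).take k).toFinset ∈ H.edges

end UniformHypergraph

/-- The first end of an `ℓ`-path with vertex sequence `p`: the set of its first `ℓ` vertices. -/
def firstEnd {V : Type*} [DecidableEq V] (ℓ : ℕ) (p : List V) : Finset V :=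
  (p.take ℓ).toFinset

/-- The last end of an `ℓ`-path with vertex sequence `p`: the set of its last `ℓ` vertices. -/
def lastEnd {V : Type*} [DecidableEq V] (ℓ : ℕ) (p : List V) : Finset V :=
  (p.drop (p.length - ℓ)).toFinset

/-- The size of the set `A` in the hypergraph `X_{k,ℓ}(n)`, for `n` a multiple of `k - ℓ`:
`n / (2(k-ℓ)) - 1` if `n` is an even multiple, and `⌊n / (2(k-ℓ))⌋` if it is an odd one. -/
def extremalExampleSize (k ℓ n : ℕ) : ℕ :=
  if Even (n / (k - ℓ)) then n / (2 * (k - ℓ)) - 1 else n / (2 * (k - ℓ))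

/-- The hypergraph `X_{k,ℓ}(n)`, on the vertex set `{0, …, n-1}`, for `n` a multiple of `k - ℓ`.
With `a = extremalExampleSize k ℓ n` and `A = {0, …, a-1}`, its edges are all `k`-sets that meet
`A`, and, if `n` is an even multiple of `k - ℓ`, also all `k`-sets that contain the `ℓ + 1`
fixed vertices `a, a+1, …, a+ℓ` outside `A`. -/
def extremalExample (k ℓ n : ℕ) : UniformHypergraph (Fin n) k where
  edges := (univ.powersetCard k).filter (fun e =>
    (∃ v ∈ e, (v : ℕ) < extremalExampleSize k ℓ n) ∨
      (Even (n / (k - ℓ)) ∧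
        ∀ v : Fin n, extremalExampleSize k ℓ n ≤ v → (v : ℕ) ≤ extremalExampleSize k ℓ n + ℓ →
          v ∈ e))
  card_of_mem_edges := by
    intro e he
    exact (mem_powersetCard.mp (mem_filter.mp he).1).2

/-!
The vertices are classified by their degree into the sparse part of the extremal partition: those
of `A` form edges with nearly all `(k - 1)`-subsets of it, those of `B` with hardly any, and
the remaining ones with many. Comparing the minimum degree with that of the extremal example shows
that nearly all sets with one vertex in `A` and `k - 1` in `B` at a classified vertex are edges
(`card_nonEdges_le`, `exists_classification`). Therefore the degree conditions hold for every
path that is short compared to `n`, contains the unclassified vertices, and has typical ends, and it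
remains to choose the path so that the sizes balance.

Let `X` be the vertex set of the path, `t` its number of edges and `n = m (k - ℓ)`. The condition on
the sizes amounts to `2 |X \ B| + m = t + 2 |V \ B|`. An edge with a private vertex outside `B` increases
`2 |X \ B| - t` by one (`IsTypicalPath.exists_prolong`), so it suffices to find a short path for which
the left side is at most the right one. Typical `ℓ`-sets are joined by two edges sharing their only
vertex outside `B`, which does not change `2 |X \ B| - t`. Hence unclassified vertices are absorbed
for free, each as the common vertex of two edges (`IsTypicalPath.exists_absorb_vertices`), and each
edge inside `B` lowers `2 |X \ B| - t` by one. The ends of such an edge need not be typical, but from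
every `ℓ`-subset of `B` at most two edges lead to a typical one, with a vertex outside `B` in at most
every second edge (`IsReservoir.exists_path_to_typical`).

Let `n - b` be the size of the smaller part of the extremal example. If `|B| < b`, then no edges
inside `B` are needed. If `|B| = b + q`, then `2q + 1` edges inside `B` are needed, and `2q + 2` if
`m` is even. For `q ≥ 1` the degree condition yields many edges inside `B`, but every vertex of `B`
has small degree there, so there is a matching (`exists_matching_of_lt_card`). For `q = 0` the degree
condition yields only that every `(k - 2)`-subset of `B` lies in an edge inside `B`, and in two
if `ℓ = 1` and `m` is even. This gives one edge, and for even `m` two edges that are disjoint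
or share exactly `ℓ` vertices, and can therefore both be put on a path. Two such edges are found with
the kernels of large sunflowers (`exists_disjoint_or_card_inter_eq_of_two_le`), and for `ℓ = 1` by
comparing the edges at disjoint `(k - 2)`-sets (`exists_disjoint_or_card_inter_eq_one`).
-/

/-! ### Codegrees in set systems -/

namespace LoosePath

variable {V : Type*} [DecidableEq V]

/-- The number of members of the set system `F` that contain `Y`. -/
def codegree (F : Finset (Finset V)) (Y : Finset V) : ℕ :=
  #{e ∈ F | Y ⊆ e}

lemma codegree_empty (F : Finset (Finset V)) : codegree F ∅ = #F := by
  simp [codegree]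

/-- Double counting: every `r`-set has at most `2 ^ r` subsets. -/
lemma sum_codegree_le {F : Finset (Finset V)} {r : ℕ} (hF : ∀ e ∈ F, #e = r)
    (S : Finset (Finset V)) (L : Finset V) :
    ∑ Y ∈ S, codegree F (L ∪ Y) ≤ 2 ^ r * codegree F L := by
  have h1 : ∑ Y ∈ S, codegree F (L ∪ Y) =
      ∑ Y ∈ S, #(bipartiteAbove (fun (Y e : Finset V) => L ∪ Y ⊆ e) {e ∈ F | L ⊆ e} Y) := by
    refine sum_congr rfl fun Y _ => ?_
    rw [codegree, bipartiteAbove, filter_filter]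
    congr 1
    ext e
    simp only [mem_filter, union_subset_iff]
    tauto
  rw [h1, sum_card_bipartiteAbove_eq_sum_card_bipartiteBelow, mul_comm, codegree, ← smul_eq_mul]
  refine sum_le_card_nsmul _ _ _ fun e he => ?_
  rw [mem_filter] at he
  calc _ ≤ #e.powerset := card_le_card fun Y hY => by
          rw [bipartiteBelow, mem_filter] at hY
          exact mem_powerset.2 (subset_union_right.trans hY.2)
    _ = 2 ^ r := by rw [card_powerset, hF e he.1]

/-- Markov's inequality for codegrees. -/
lemma card_filter_lt_codegree_mul_le {F : Finset (Finset V)} {r : ℕ} (hF : ∀ e ∈ F, #e = r)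
    (S : Finset (Finset V)) (L : Finset V) (t : ℝ) :
    (#{Y ∈ S | t < codegree F (L ∪ Y)} : ℝ) * t ≤ 2 ^ r * codegree F L := by
  have h1 := sum_codegree_le hF {Y ∈ S | t < codegree F (L ∪ Y)} L
  have h2 : (#{Y ∈ S | t < codegree F (L ∪ Y)} : ℝ) * t ≤
      ∑ Y ∈ S with t < codegree F (L ∪ Y), (codegree F (L ∪ Y) : ℝ) := by
    rw [← nsmul_eq_mul]
    exact card_nsmul_le_sum _ _ _ fun Y hY => (mem_filter.1 hY).2.le
  exact h2.trans (by exact_mod_cast h1)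

/-- The sets `M` whose union with a disjoint set `Y` lies in `N` number at most the codegree
of `Y` in `N`. -/
lemma card_filter_union_mem_le (F N : Finset (Finset V)) (Y : Finset V) :
    #{M ∈ F | Disjoint Y M ∧ Y ∪ M ∈ N} ≤ codegree N Y := by
  refine card_le_card_of_injOn (fun M => Y ∪ M) (fun M hM => ?_) fun M hM M' hM' h => ?_
  · have hM := mem_filter.1 hM
    exact mem_filter.2 ⟨hM.2.2, subset_union_left⟩
  · have hM := (mem_filter.1 hM).2.1
    have hM' := (mem_filter.1 hM').2.1
    rw [← union_sdiff_cancel_left hM, ← union_sdiff_cancel_left hM']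
    exact congrArg (· \ Y) h

variable [Fintype V]

lemma codegree_le_pow {F : Finset (Finset V)} {r : ℕ} (hF : ∀ e ∈ F, #e = r) (Y : Finset V) :
    codegree F Y ≤ Fintype.card V ^ (r - #Y) := by
  have h : codegree F Y ≤ #(powersetCard (r - #Y) (univ : Finset V)) := by
    refine card_le_card_of_injOn (fun e => e \ Y) (fun e he => ?_) fun e he f hf hef => ?_
    · have he := mem_filter.1 he
      exact mem_powersetCard.2 ⟨subset_univ _, by rw [card_sdiff_of_subset he.2, hF e he.1]⟩
    · have he := (mem_filter.1 he).2
      have hf := (mem_filter.1 hf).2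
      rw [← sdiff_union_of_subset he, ← sdiff_union_of_subset hf]
      exact congrArg (· ∪ Y) hef
  rw [card_powersetCard, card_univ] at h
  exact h.trans (Nat.choose_le_pow _ _)

/-- Few `r`-sets that contain `L` contain a member of a small system of `j`-sets outside `L`. -/
lemma card_filter_exists_subset_le {F S : Finset (Finset V)} {r j : ℕ} (hF : ∀ e ∈ F, #e = r)
    (hS : ∀ Y ∈ S, #Y = j) (L : Finset V) :
    #{e ∈ F | L ⊆ e ∧ ∃ Y ∈ S, Y ⊆ e \ L} ≤ #S * Fintype.card V ^ (r - #L - j) := by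
  have h : ({e ∈ F | L ⊆ e ∧ ∃ Y ∈ S, Y ⊆ e \ L} : Finset (Finset V)) ⊆
      {Y ∈ S | Disjoint L Y}.biUnion fun Y => {e ∈ F | L ∪ Y ⊆ e} := by
    intro e he
    simp only [mem_filter, mem_biUnion] at he ⊢
    obtain ⟨he, hL, Y, hY, hYe⟩ := he
    exact ⟨Y, ⟨hY, disjoint_of_subset_right hYe disjoint_sdiff⟩, he,
      union_subset hL (hYe.trans sdiff_subset)⟩
  refine (card_le_card h).trans ((card_biUnion_le_card_mul _ _ _ fun Y hY => ?_).trans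
    (Nat.mul_le_mul_right _ (card_le_card (filter_subset _ _))))
  have hY := mem_filter.1 hY
  have := codegree_le_pow hF (L ∪ Y)
  rwa [card_union_of_disjoint hY.2, hS Y hY.1, Nat.sub_add_eq] at this

/-- Few members of a system of `r`-sets that contain `L` meet a small set `W` outside `L`. -/
lemma card_filter_not_disjoint_le {F : Finset (Finset V)} {r : ℕ} (hF : ∀ e ∈ F, #e = r)
    (L W : Finset V) :
    #{e ∈ F | L ⊆ e ∧ ¬ Disjoint (e \ L) W} ≤ #W * Fintype.card V ^ (r - #L - 1) := by
  have h : ({e ∈ F | L ⊆ e ∧ ¬ Disjoint (e \ L) W} : Finset (Finset V)) ⊆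
      (W \ L).biUnion fun w => {e ∈ F | insert w L ⊆ e} := by
    intro e he
    simp only [mem_filter, mem_biUnion, not_disjoint_iff, mem_sdiff] at he ⊢
    obtain ⟨he, hL, w, ⟨hwe, hwL⟩, hw⟩ := he
    exact ⟨w, ⟨hw, hwL⟩, he, insert_subset hwe hL⟩
  refine (card_le_card h).trans ((card_biUnion_le_card_mul _ _ _ fun w hw => ?_).trans
    (Nat.mul_le_mul_right _ (card_le_card sdiff_subset)))
  have := codegree_le_pow hF (insert w L)
  rwa [card_insert_of_notMem (mem_sdiff.1 hw).2, Nat.sub_add_eq] at this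

/-- If the sets of a system that contain `L` are dense, then one of them avoids, outside `L`,
a small set of vertices and does not belong to a sparse set of bad members. -/
lemma exists_superset_disjoint {F : Finset (Finset V)} {r : ℕ} {L : Finset V} (hr : #L < r)
    (hF : ∀ e ∈ F, #e = r ∧ L ⊆ e) {κ : ℝ} (hκ : 0 < κ) (hn : 0 < Fintype.card V)
    (hcard : κ * (Fintype.card V : ℝ) ^ (r - #L) ≤ #F) (bad : Finset V → Prop) [DecidablePred bad]
    (hbad : (#{e ∈ F | bad e} : ℝ) ≤ κ / 2 * (Fintype.card V : ℝ) ^ (r - #L)) {W : Finset V}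
    (hW : (#W : ℝ) ≤ κ / 4 * Fintype.card V) :
    ∃ e ∈ F, ¬ bad e ∧ Disjoint (e \ L) W := by
  by_contra! hcon
  have hsub : F ⊆ {e ∈ F | bad e} ∪ {e ∈ F | L ⊆ e ∧ ¬ Disjoint (e \ L) W} := by
    intro e he
    by_cases hb : bad e
    · exact mem_union_left _ (mem_filter.2 ⟨he, hb⟩)
    · exact mem_union_right _ (mem_filter.2 ⟨he, (hF e he).2, hcon e he hb⟩)
  have h1 := (card_le_card hsub).trans (card_union_le _ _)
  have h2 := card_filter_not_disjoint_le (fun e he => (hF e he).1) L W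
  have hn' : (0 : ℝ) < Fintype.card V := by exact_mod_cast hn
  have h3 : (#F : ℝ) ≤ #{e ∈ F | bad e} + #W * (Fintype.card V : ℝ) ^ (r - #L - 1) := by
    exact_mod_cast h1.trans (Nat.add_le_add_left h2 _)
  have h4 : (#W : ℝ) * (Fintype.card V : ℝ) ^ (r - #L - 1) ≤
      κ / 4 * (Fintype.card V : ℝ) ^ (r - #L) := by
    calc (#W : ℝ) * (Fintype.card V : ℝ) ^ (r - #L - 1)
        ≤ κ / 4 * Fintype.card V * (Fintype.card V : ℝ) ^ (r - #L - 1) := by gcongr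
      _ = κ / 4 * (Fintype.card V : ℝ) ^ (r - #L) := by
        rw [mul_assoc, ← pow_succ', Nat.sub_add_cancel (by omega)]
  have h5 : 0 < κ * (Fintype.card V : ℝ) ^ (r - #L) := by positivity
  linarith

/-- A dense set system has a member that avoids a small set of vertices and
a sparse set of bad members. -/
lemma exists_mem_disjoint {F : Finset (Finset V)} {r : ℕ} (hr : 1 ≤ r) (hF : ∀ e ∈ F, #e = r)
    {κ : ℝ} (hκ : 0 < κ) (hn : 0 < Fintype.card V)
    (hcard : κ * (Fintype.card V : ℝ) ^ r ≤ #F) (bad : Finset V → Prop) [DecidablePred bad]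
    (hbad : (#{e ∈ F | bad e} : ℝ) ≤ κ / 2 * (Fintype.card V : ℝ) ^ r) {W : Finset V}
    (hW : (#W : ℝ) ≤ κ / 4 * Fintype.card V) :
    ∃ e ∈ F, ¬ bad e ∧ Disjoint e W := by
  simpa using exists_superset_disjoint (L := ∅) (r := r) (by rw [card_empty]; omega)
    (fun e he => ⟨hF e he, empty_subset e⟩) hκ hn (by simpa using hcard) bad
    (by simpa using hbad) hW

end LoosePath

/-! ### Paths as sequences of sets -/

namespace LoosePath

variable {V : Type*} [DecidableEq V] {k ℓ : ℕ}

/-- `SetPath H ℓ L L' X t`: the set `X` is the vertex set of an `ℓ`-path of `H` with `t` edges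
and ends `L`, `L'`. As the order of the vertices inside the intersection of two consecutive edges,
and inside the rest of an edge, is irrelevant, the path is recorded by the sequence of these blocks:
adding an edge adds a block `M` of `k - 2ℓ` vertices and a new end `L'`.
A single `ℓ`-set is a path without edges. -/
inductive SetPath (H : UniformHypergraph V k) (ℓ : ℕ) (L : Finset V) :
    Finset V → Finset V → ℕ → Prop
  | nil : #L = ℓ → SetPath H ℓ L L L 0
  | snoc {L₁ X : Finset V} {t : ℕ} (M L₂ : Finset V) : SetPath H ℓ L L₁ X t →
      #M = k - 2 * ℓ → #L₂ = ℓ → Disjoint M L₂ → Disjoint X (M ∪ L₂) → L₁ ∪ M ∪ L₂ ∈ H.edges →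
      SetPath H ℓ L L₂ (X ∪ (M ∪ L₂)) (t + 1)

namespace SetPath

variable {H : UniformHypergraph V k} {L L₁ L₂ X Y : Finset V} {s t : ℕ}

lemma first_subset (h : SetPath H ℓ L L₁ X t) : L ⊆ X := by
  induction h with
  | nil h => exact Subset.rfl
  | snoc M L₂ h _ _ _ _ _ ih => exact ih.trans subset_union_left

lemma last_subset (h : SetPath H ℓ L L₁ X t) : L₁ ⊆ X := by
  cases h with
  | nil h => exact Subset.rfl
  | snoc M L₂ h _ _ _ _ _ => exact subset_union_right.trans subset_union_right

lemma card_first (h : SetPath H ℓ L L₁ X t) : #L = ℓ := by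
  induction h with
  | nil h => exact h
  | snoc M L₂ h _ _ _ _ _ ih => exact ih

lemma card_last (h : SetPath H ℓ L L₁ X t) : #L₁ = ℓ := by
  cases h with
  | nil h => exact h
  | snoc M L₂ h _ h _ _ _ => exact h

lemma card_eq (hk : 2 * ℓ ≤ k) (h : SetPath H ℓ L L₁ X t) : #X = t * (k - ℓ) + ℓ := by
  induction h with
  | nil h => simpa using h
  | snoc M L₂ h hM hL hd hX _ ih =>
    rw [card_union_of_disjoint hX, card_union_of_disjoint hd, ih, hM, hL, add_mul]
    omega

lemma disjoint_ends (h : SetPath H ℓ L L₁ X t) (ht : 1 ≤ t) : Disjoint L L₁ := by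
  cases h with
  | nil h => omega
  | snoc M L₂ h hM hL hd hX _ =>
    exact disjoint_of_subset_left h.first_subset (disjoint_of_subset_right subset_union_right hX)

lemma single {M : Finset V} (h₁ : #L = ℓ) (hM : #M = k - 2 * ℓ) (h₂ : #L₁ = ℓ)
    (hM₁ : Disjoint M L₁) (hLM : Disjoint L (M ∪ L₁)) (he : L ∪ M ∪ L₁ ∈ H.edges) :
    SetPath H ℓ L L₁ (L ∪ (M ∪ L₁)) 1 :=
  snoc M L₁ (nil h₁) hM h₂ hM₁ hLM he

lemma trans (h : SetPath H ℓ L L₁ X s) (h' : SetPath H ℓ L₁ L₂ Y t) (hXY : X ∩ Y ⊆ L₁) :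
    SetPath H ℓ L L₂ (X ∪ Y) (s + t) := by
  induction h' with
  | nil hL => rwa [union_eq_left.2 h.last_subset]
  | @snoc L₂ Y t M L₃ h' hM hL hd hY he ih =>
    have h1 := ih ((inter_subset_inter_left subset_union_left).trans hXY)
    rw [← union_assoc]
    refine snoc M L₃ h1 hM hL hd (disjoint_union_left.2 ⟨?_, hY⟩) he
    refine disjoint_left.2 fun x hx hx' => ?_
    exact disjoint_left.1 hY (h'.first_subset (hXY (mem_inter.2 ⟨hx, mem_union_right _ hx'⟩))) hx'

lemma reverse (h : SetPath H ℓ L L₁ X t) : SetPath H ℓ L₁ L X t := by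
  induction h with
  | nil hL => exact nil hL
  | @snoc L₁ X t M L₂ h hM hL hd hX he ih =>
    have hL₁ := h.last_subset
    have hML := disjoint_of_subset_left hL₁ hX
    rw [disjoint_union_right] at hML
    have h1 : SetPath H ℓ L₂ L₁ (L₂ ∪ (M ∪ L₁)) 1 := by
      refine single hL hM h.card_last hML.1.symm ?_ ?_
      · exact disjoint_union_right.2 ⟨hd.symm, hML.2.symm⟩
      · rwa [union_right_comm, union_comm L₂, union_right_comm]
    have h2 := h1.trans ih fun x hx => by
      rw [mem_inter, mem_union, mem_union] at hx
      obtain ⟨hx | hx | hx, hx'⟩ := hx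
      · exact absurd (mem_union_right _ hx) (disjoint_left.1 hX hx')
      · exact absurd (mem_union_left _ hx) (disjoint_left.1 hX hx')
      · exact hx
    have h3 : X ∪ (M ∪ L₂) = L₂ ∪ (M ∪ L₁) ∪ X := by
      ext x
      have := @hL₁ x
      simp only [mem_union]
      tauto
    rwa [h3, add_comm]

/-- Listing the blocks of a `SetPath` one after the other gives an `ℓ`-path. -/
lemma exists_list (hk : 2 * ℓ ≤ k) (h : SetPath H ℓ L L₁ X t) (ht : 1 ≤ t) :
    ∃ p : List V, H.IsNonemptyPath ℓ p ∧ firstEnd ℓ p = L ∧ lastEnd ℓ p = L₁ ∧ p.toFinset = X := by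
  suffices hs : ∃ p : List V, p.Nodup ∧ p.length = t * (k - ℓ) + ℓ ∧
      (∀ j < t, ((p.drop (j * (k - ℓ))).take k).toFinset ∈ H.edges) ∧
      (p.take ℓ).toFinset = L ∧ (p.drop (t * (k - ℓ))).toFinset = L₁ ∧ p.toFinset = X by
    obtain ⟨p, hp, hlen, he, hf, hl, hX⟩ := hs
    refine ⟨p, ⟨hp, t, ht, hlen, he⟩, hf, ?_, hX⟩
    rw [lastEnd, hlen, Nat.add_sub_cancel, hl]
  clear ht
  induction h with
  | nil hL =>
    refine ⟨L.toList, L.nodup_toList, by simpa using hL, by simp, ?_, by simp, by simp⟩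
    rw [List.take_of_length_le (by simp [hL]), toList_toFinset]
  | @snoc L₁ X t M L₂ h hM hL hd hX he ih =>
    obtain ⟨p, hp, hlen, hpe, hf, hl, hpX⟩ := ih
    have hlen' : (M.toList ++ L₂.toList).length = k - ℓ := by
      rw [List.length_append, length_toList, length_toList, hM, hL]; omega
    refine ⟨p ++ (M.toList ++ L₂.toList), ?_, ?_, fun j hj => ?_, ?_, ?_, ?_⟩
    · refine List.nodup_append'.2 ⟨hp, List.nodup_append'.2
        ⟨M.nodup_toList, L₂.nodup_toList, fun x hx hx' => ?_⟩, fun x hx hx' => ?_⟩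
      · exact disjoint_left.1 hd (mem_toList.1 hx) (mem_toList.1 hx')
      · refine disjoint_left.1 hX (hpX ▸ List.mem_toFinset.2 hx) ?_
        simpa using hx'
    · rw [List.length_append, hlen', hlen, add_mul]; omega
    · obtain hj | rfl := Nat.lt_succ_iff_lt_or_eq.1 hj
      · have h1 : (j + 1) * (k - ℓ) ≤ t * (k - ℓ) := Nat.mul_le_mul_right _ hj
        rw [add_mul] at h1
        rw [List.drop_append_of_le_length (by omega), List.take_append_of_le_length]
        · exact hpe j hj
        · rw [List.length_drop]; omega
      · rw [List.drop_append_of_le_length (by omega), List.take_of_length_le]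
        · simpa [List.toFinset_append, hl, union_assoc] using he
        · rw [List.length_append, hlen', List.length_drop]; omega
    · rw [List.take_append_of_le_length (by omega), hf]
    · rw [← List.append_assoc, List.drop_left', toList_toFinset]
      rw [List.length_append, hlen, length_toList, hM, add_mul]; omega
    · simp [List.toFinset_append, hpX]

end SetPath

end LoosePath

/-! ### Typical sets and reservoirs -/

namespace LoosePath

variable {V : Type*} [DecidableEq V] [Fintype V] {k ℓ : ℕ}

/-- The `r`-sets contained in `A ∪ B` that meet `A` in exactly one vertex. -/
def crossing (A B : Finset V) (r : ℕ) : Finset (Finset V) :=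
  {Z ∈ powersetCard r univ | #(Z ∩ A) = 1 ∧ Z ⊆ A ∪ B}

/-- The crossing `k`-sets that are not edges of `H`. -/
def missing (H : UniformHypergraph V k) (A B : Finset V) : Finset (Finset V) :=
  {Z ∈ crossing A B k | Z ∉ H.edges}

lemma mem_crossing {A B Z : Finset V} {r : ℕ} :
    Z ∈ crossing A B r ↔ #Z = r ∧ #(Z ∩ A) = 1 ∧ Z ⊆ A ∪ B := by
  simp [crossing]

lemma mem_missing {H : UniformHypergraph V k} {A B Z : Finset V} :
    Z ∈ missing H A B ↔ Z ∈ crossing A B k ∧ Z ∉ H.edges := by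
  simp [missing]

lemma card_of_mem_missing {H : UniformHypergraph V k} {A B : Finset V} :
    ∀ Z ∈ missing H A B, #Z = k := fun _ hZ => (mem_crossing.1 (mem_missing.1 hZ).1).1

lemma union_mem_crossing {A B Z C : Finset V} {r j s : ℕ} (hAB : Disjoint A B)
    (hZ : Z ∈ crossing A B r) (hC : C ⊆ B) (hCj : #C = j) (hZC : Disjoint Z C) (hs : r + j = s) :
    Z ∪ C ∈ crossing A B s := by
  rw [mem_crossing] at hZ ⊢
  refine ⟨by rw [card_union_of_disjoint hZC, hZ.1, hCj, hs], ?_,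
    union_subset hZ.2.2 (hC.trans subset_union_right)⟩
  rw [union_inter_distrib_right, disjoint_iff_inter_eq_empty.1
    (disjoint_of_subset_left hC hAB.symm), union_empty, hZ.2.1]

/-- An `ℓ`-set is typical if it lies in few missing crossing `k`-sets. -/
def IsTypical (H : UniformHypergraph V k) (ℓ : ℕ) (A B : Finset V) (τ : ℝ) (Y : Finset V) :
    Prop :=
  (codegree (missing H A B) Y : ℝ) ≤ τ * (Fintype.card V : ℝ) ^ (k - ℓ)

/-- The conditions on `A` and `B` under which `ℓ`-paths can be built and joined greedily:
there are many sets of both kinds, nearly all `ℓ`-sets are typical, and every `ℓ`-subset of `B`,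
typical or not, lies in many edges with at most one vertex in `A`. -/
structure IsReservoir (H : UniformHypergraph V k) (ℓ : ℕ) (A B : Finset V) (κ τ : ℝ) : Prop where
  one_le : 1 ≤ ℓ
  two_mul_lt : 2 * ℓ < k
  disjoint : Disjoint A B
  card_pos : 0 < Fintype.card V
  pos : 0 < κ
  le_one : κ ≤ 1
  nonneg : 0 ≤ τ
  mul_le : 2 ^ (k + 4) * τ ≤ κ ^ 2
  card_powersetCard : ∀ r ≤ k, κ * (Fintype.card V : ℝ) ^ r ≤ #(B.powersetCard r)
  card_crossing : ∀ r, 1 ≤ r → r ≤ k → κ * (Fintype.card V : ℝ) ^ r ≤ #(crossing A B r)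
  card_atypical : (#{Y ∈ powersetCard ℓ univ |
    τ * (Fintype.card V : ℝ) ^ (k - ℓ) < codegree (missing H A B) Y} : ℝ) ≤
      κ / 8 * (Fintype.card V : ℝ) ^ ℓ
  card_edges : ∀ L ⊆ B, #L = ℓ → κ * (Fintype.card V : ℝ) ^ (k - ℓ) ≤
    #{Z ∈ H.edges | L ⊆ Z ∧ Z ⊆ A ∪ B ∧ #(Z ∩ A) ≤ 1}

namespace IsReservoir

variable {H : UniformHypergraph V k} {A B : Finset V} {κ τ : ℝ}

lemma cast_card_pos (h : IsReservoir H ℓ A B κ τ) : (0 : ℝ) < Fintype.card V := by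
  exact_mod_cast h.card_pos

lemma tau_le (h : IsReservoir H ℓ A B κ τ) : τ ≤ κ / 4 := by
  have h1 : (2 : ℝ) ^ 4 ≤ 2 ^ (k + 4) := pow_le_pow_right₀ (by norm_num) (by omega)
  have h2 := h.mul_le
  have h3 := mul_le_mul_of_nonneg_right h1 h.nonneg
  have h4 : κ ^ 2 ≤ κ := by nlinarith [h.pos, h.le_one]
  linarith [h.pos]

open Classical in
/-- Few sets contain an atypical `ℓ`-set. -/
lemma card_filter_atypical_le (h : IsReservoir H ℓ A B κ τ) {F : Finset (Finset V)} {r : ℕ}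
    {L : Finset V} (hF : ∀ e ∈ F, #e = r ∧ L ⊆ e) :
    (#{e ∈ F | ∃ Y, #Y = ℓ ∧ Y ⊆ e \ L ∧ ¬ IsTypical H ℓ A B τ Y} : ℝ) ≤
      κ / 8 * (Fintype.card V : ℝ) ^ (r - #L) := by
  classical
  have hn := h.cast_card_pos
  have hκ := h.pos
  by_cases hr : r - #L < ℓ
  · have h1 : ({e ∈ F | ∃ Y, #Y = ℓ ∧ Y ⊆ e \ L ∧ ¬ IsTypical H ℓ A B τ Y} : Finset _) = ∅ := by
      refine filter_eq_empty_iff.2 fun e he => ?_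
      rintro ⟨Y, hY, hYe, -⟩
      have h2 := card_le_card hYe
      rw [card_sdiff_of_subset (hF e he).2, (hF e he).1] at h2
      omega
    rw [h1, card_empty, Nat.cast_zero]
    positivity
  · set S : Finset (Finset V) := {Y ∈ powersetCard ℓ univ |
      τ * (Fintype.card V : ℝ) ^ (k - ℓ) < codegree (missing H A B) Y} with hS
    have h1 := card_filter_exists_subset_le (S := S) (j := ℓ) (fun e he => (hF e he).1)
      (fun Y hY => by simpa using (mem_filter.1 hY).1) L
    have h2 : ({e ∈ F | ∃ Y, #Y = ℓ ∧ Y ⊆ e \ L ∧ ¬ IsTypical H ℓ A B τ Y} : Finset _) ⊆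
        {e ∈ F | L ⊆ e ∧ ∃ Y ∈ S, Y ⊆ e \ L} := by
      intro e he
      obtain ⟨he, Y, hY, hYe, hYt⟩ := mem_filter.1 he
      exact mem_filter.2 ⟨he, (hF e he).2, Y, mem_filter.2 ⟨mem_powersetCard.2
        ⟨subset_univ _, hY⟩, not_le.1 hYt⟩, hYe⟩
    have h3 : (#{e ∈ F | ∃ Y, #Y = ℓ ∧ Y ⊆ e \ L ∧ ¬ IsTypical H ℓ A B τ Y} : ℝ) ≤
        #S * (Fintype.card V : ℝ) ^ (r - #L - ℓ) := by
      exact_mod_cast (card_le_card h2).trans h1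
    calc _ ≤ _ := h3
      _ ≤ κ / 8 * (Fintype.card V : ℝ) ^ ℓ * (Fintype.card V : ℝ) ^ (r - #L - ℓ) := by
        gcongr
        exact h.card_atypical
      _ = κ / 8 * (Fintype.card V : ℝ) ^ (r - #L) := by
        rw [mul_assoc, ← pow_add, Nat.add_sub_cancel' (not_lt.1 hr)]

/-- Choosing a set that makes an edge together with `L`, avoids a small set, and has
only typical `ℓ`-subsets. -/
lemma exists_fill (h : IsReservoir H ℓ A B κ τ) {F : Finset (Finset V)} {L : Finset V}
    (hL : #L < k) (hF : ∀ M ∈ F, #M = k - #L)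
    (hFκ : κ * (Fintype.card V : ℝ) ^ (k - #L) ≤ #F)
    (hFL : ∀ M ∈ F, Disjoint L M → L ∪ M ∈ crossing A B k)
    (hLN : (codegree (missing H A B) L : ℝ) ≤ κ / 4 * (Fintype.card V : ℝ) ^ (k - #L))
    {W : Finset V} (hW : (#W : ℝ) + k ≤ κ / 4 * Fintype.card V) :
    ∃ M ∈ F, L ∪ M ∈ H.edges ∧ Disjoint L M ∧ Disjoint M W ∧
      ∀ Y ⊆ M, #Y = ℓ → IsTypical H ℓ A B τ Y := by
  classical
  have hW' : (#(W ∪ L) : ℝ) ≤ κ / 4 * Fintype.card V := by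
    have h1 : (#(W ∪ L) : ℝ) ≤ #W + #L := by exact_mod_cast card_union_le W L
    have h2 : (#L : ℝ) ≤ k := by exact_mod_cast hL.le
    linarith
  have h1 := h.card_filter_atypical_le (F := F) (L := ∅) (r := k - #L)
    fun e he => ⟨hF e he, empty_subset e⟩
  have h2 := card_filter_union_mem_le F (missing H A B) L
  obtain ⟨M, hM, hMb, hMW⟩ := exists_mem_disjoint (by omega) hF h.pos h.card_pos hFκ
    (fun M => (Disjoint L M ∧ L ∪ M ∈ missing H A B) ∨
      ∃ Y, #Y = ℓ ∧ Y ⊆ M \ ∅ ∧ ¬ IsTypical H ℓ A B τ Y) (by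
      rw [filter_or]
      have h3 : (#({M ∈ F | Disjoint L M ∧ L ∪ M ∈ missing H A B} ∪
          {M ∈ F | ∃ Y, #Y = ℓ ∧ Y ⊆ M \ ∅ ∧ ¬ IsTypical H ℓ A B τ Y}) : ℝ) ≤
          #{M ∈ F | Disjoint L M ∧ L ∪ M ∈ missing H A B} +
          #{M ∈ F | ∃ Y, #Y = ℓ ∧ Y ⊆ M \ ∅ ∧ ¬ IsTypical H ℓ A B τ Y} := by
        exact_mod_cast card_union_le _ _
      have h4 : (#{M ∈ F | Disjoint L M ∧ L ∪ M ∈ missing H A B} : ℝ) ≤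
          codegree (missing H A B) L := by exact_mod_cast h2
      rw [card_empty, Nat.sub_zero] at h1
      have h5 : 0 ≤ κ * (Fintype.card V : ℝ) ^ (k - #L) := by
        have := h.pos; positivity
      linarith) hW'
  rw [disjoint_union_right] at hMW
  rw [not_or] at hMb
  refine ⟨M, hM, ?_, hMW.2.symm, hMW.1, fun Y hY hYc => ?_⟩
  · by_contra hcon
    exact hMb.1 ⟨hMW.2.symm, mem_missing.2 ⟨hFL M hM hMW.2.symm, hcon⟩⟩
  · by_contra hcon
    exact hMb.2 ⟨Y, hYc, by simpa using hY, hcon⟩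

/-- Extending a crossing set by vertices of `B`. -/
lemma exists_fill_of_mem_crossing (h : IsReservoir H ℓ A B κ τ) {L : Finset V} (hLk : #L < k)
    (hL : L ∈ crossing A B #L)
    (hLN : (codegree (missing H A B) L : ℝ) ≤ κ / 4 * (Fintype.card V : ℝ) ^ (k - #L))
    {W : Finset V} (hW : (#W : ℝ) + k ≤ κ / 4 * Fintype.card V) :
    ∃ M ⊆ B, #M = k - #L ∧ L ∪ M ∈ H.edges ∧ Disjoint L M ∧ Disjoint M W ∧
      ∀ Y ⊆ M, #Y = ℓ → IsTypical H ℓ A B τ Y := by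
  obtain ⟨M, hM, h1⟩ := h.exists_fill hLk (F := B.powersetCard (k - #L))
    (fun M hM => (mem_powersetCard.1 hM).2) (h.card_powersetCard _ (by omega))
    (fun M hM hd => union_mem_crossing h.disjoint hL (mem_powersetCard.1 hM).1
      (mem_powersetCard.1 hM).2 hd (by omega)) hLN hW
  rw [mem_powersetCard] at hM
  exact ⟨M, hM.1, hM.2, h1⟩

lemma exists_typical (h : IsReservoir H ℓ A B κ τ) {W : Finset V}
    (hW : (#W : ℝ) ≤ κ / 4 * Fintype.card V) :
    ∃ L ⊆ B, #L = ℓ ∧ IsTypical H ℓ A B τ L ∧ Disjoint L W := by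
  classical
  have hn := h.cast_card_pos
  have hκ := h.pos
  obtain ⟨L, hL, hLt, hLW⟩ := exists_mem_disjoint (F := B.powersetCard ℓ) h.one_le
    (fun e he => (mem_powersetCard.1 he).2) h.pos h.card_pos
    (h.card_powersetCard _ (by have := h.two_mul_lt; omega))
    (fun L => ¬ IsTypical H ℓ A B τ L) (by
      refine le_trans ?_ (h.card_atypical.trans ?_)
      · refine Nat.cast_le.2 (card_le_card fun L hL => ?_)
        rw [mem_filter, mem_powersetCard] at hL
        exact mem_filter.2 ⟨mem_powersetCard.2 ⟨subset_univ _, hL.1.2⟩, not_le.1 hL.2⟩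
      · gcongr; norm_num) hW
  rw [mem_powersetCard] at hL
  exact ⟨L, hL.1, hL.2, not_not.1 hLt, hLW⟩

lemma card_sdiff_of_mem_crossing {Z : Finset V} {r : ℕ} (hAB : Disjoint A B)
    (hZ : Z ∈ crossing A B r) : #(Z \ B) = 1 := by
  rw [mem_crossing] at hZ
  rw [← hZ.2.1]
  congr 1
  ext x
  have h1 := @hZ.2.2 x
  have h2 : x ∈ A → x ∉ B := fun hx => disjoint_left.1 hAB hx
  simp only [mem_union, mem_sdiff, mem_inter] at h1 ⊢
  tauto

/-- Two typical sets are joined by a path of two edges whose intersection contains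
the only vertex of the path outside `B`. -/
lemma exists_connection (h : IsReservoir H ℓ A B κ τ) {L L' W : Finset V} (hL : L ⊆ B)
    (hL' : L' ⊆ B) (hLℓ : #L = ℓ) (hLℓ' : #L' = ℓ) (hLt : IsTypical H ℓ A B τ L)
    (hLt' : IsTypical H ℓ A B τ L') (hd : Disjoint L L')
    (hW : (#W : ℝ) + 4 * k ≤ κ / 4 * Fintype.card V) :
    ∃ X, SetPath H ℓ L L' X 2 ∧ Disjoint (X \ (L ∪ L')) W ∧ X ⊆ A ∪ B ∧ #(X \ B) = 1 := by
  classical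
  have hn := h.cast_card_pos
  have hκ := h.pos
  have hℓk := h.two_mul_lt
  set n : ℝ := (Fintype.card V : ℝ) with hn_def
  have hℓk' : (2 * ℓ : ℝ) ≤ k := by exact_mod_cast hℓk.le
  have hbound : ∀ K : Finset V, #K = ℓ → IsTypical H ℓ A B τ K →
      (#{Y ∈ crossing A B ℓ | κ / 4 * n ^ (k - 2 * ℓ) < codegree (missing H A B) (K ∪ Y)} : ℝ) ≤
        κ / 4 * n ^ ℓ := by
    intro K hK hKt
    have h1 := card_filter_lt_codegree_mul_le (card_of_mem_missing (H := H) (A := A) (B := B))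
      (crossing A B ℓ) K (κ / 4 * n ^ (k - 2 * ℓ))
    have h2 : (2 : ℝ) ^ k * codegree (missing H A B) K ≤ 2 ^ k * (τ * n ^ (k - ℓ)) := by
      gcongr
      exact hKt
    have h3 : (2 : ℝ) ^ k * (τ * n ^ (k - ℓ)) ≤ κ / 4 * n ^ ℓ * (κ / 4 * n ^ (k - 2 * ℓ)) := by
      have h4 : n ^ (k - ℓ) = n ^ ℓ * n ^ (k - 2 * ℓ) := by
        rw [← pow_add]; congr 1; omega
      have h5 := h.mul_le
      rw [pow_add] at h5
      rw [h4]
      have h6 : 0 < n ^ ℓ * n ^ (k - 2 * ℓ) := by positivity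
      nlinarith
    exact le_of_mul_le_mul_right (h1.trans (h2.trans h3)) (by positivity)
  have hWL : (#(W ∪ L ∪ L') : ℝ) ≤ #W + 2 * ℓ := by
    have h1 := card_union_le (W ∪ L) L'
    have h2 := card_union_le W L
    have h3 : #(W ∪ L ∪ L') ≤ #W + 2 * ℓ := by omega
    exact_mod_cast h3
  obtain ⟨Y, hY, hYb, hYW⟩ := exists_mem_disjoint (F := crossing A B ℓ) h.one_le
    (fun e he => (mem_crossing.1 he).1) h.pos h.card_pos
    (h.card_crossing _ h.one_le (by omega))
    (fun Y => κ / 4 * n ^ (k - 2 * ℓ) < codegree (missing H A B) (L ∪ Y) ∨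
      κ / 4 * n ^ (k - 2 * ℓ) < codegree (missing H A B) (L' ∪ Y)) (by
      rw [filter_or]
      refine (Nat.cast_le.2 (card_union_le _ _)).trans ?_
      rw [Nat.cast_add]
      linarith [hbound L hLℓ hLt, hbound L' hLℓ' hLt']) (W := W ∪ L ∪ L') (by
      have h0 : (0 : ℝ) ≤ k := Nat.cast_nonneg k
      linarith)
  rw [not_or, not_lt, not_lt] at hYb
  simp only [disjoint_union_right] at hYW
  obtain ⟨⟨hYW, hYL⟩, hYL'⟩ := hYW
  have hYℓ := (mem_crossing.1 hY).1
  have key : ∀ K : Finset V, K ⊆ B → #K = ℓ → Disjoint Y K →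
      (codegree (missing H A B) (K ∪ Y) : ℝ) ≤ κ / 4 * n ^ (k - 2 * ℓ) → ∀ U : Finset V,
      (#U : ℝ) ≤ #W + 3 * k →
      ∃ M ⊆ B, #M = k - 2 * ℓ ∧ K ∪ Y ∪ M ∈ H.edges ∧ Disjoint (K ∪ Y) M ∧ Disjoint M U := by
    intro K hK hKℓ hYK hKY U hU
    have hc : #(K ∪ Y) = 2 * ℓ := by rw [card_union_of_disjoint hYK.symm, hKℓ, hYℓ]; omega
    have hcr : K ∪ Y ∈ crossing A B #(K ∪ Y) := by
      rw [union_comm]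
      exact union_mem_crossing h.disjoint hY hK rfl hYK (by
        rw [← hYℓ, card_union_of_disjoint hYK])
    obtain ⟨M, hM, hMc, h1, h2, h3, -⟩ := h.exists_fill_of_mem_crossing (L := K ∪ Y) (by omega) hcr
      (by rw [hc]; exact hKY) (W := U) (by linarith)
    exact ⟨M, hM, hc ▸ hMc, h1, h2, h3⟩
  have hk0 : (0 : ℝ) ≤ k := Nat.cast_nonneg k
  obtain ⟨M, hMB, hMc, hME, hMd, hMW⟩ := key L hL hLℓ hYL hYb.1 (W ∪ L ∪ L') (by linarith)
  have hc : #(W ∪ L ∪ L' ∪ M) ≤ #(W ∪ L ∪ L') + #M := card_union_le _ _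
  rw [hMc] at hc
  have hc' : (#(W ∪ L ∪ L' ∪ M) : ℝ) ≤ #(W ∪ L ∪ L') + k := by
    have : #(W ∪ L ∪ L' ∪ M) ≤ #(W ∪ L ∪ L') + k := by omega
    exact_mod_cast this
  obtain ⟨M', hMB', hMc', hME', hMd', hMW'⟩ := key L' hL' hLℓ' hYL' hYb.2 (W ∪ L ∪ L' ∪ M)
    (by linarith)
  simp only [disjoint_union_right, disjoint_union_left] at hMW hMW' hMd hMd'
  have hp1 : SetPath H ℓ L Y (L ∪ (M ∪ Y)) 1 := by
    refine SetPath.single hLℓ hMc hYℓ hMd.2.symm (disjoint_union_right.2 ⟨hMd.1, hYL.symm⟩) ?_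
    rwa [union_right_comm]
  have hp2 : SetPath H ℓ L L' (L ∪ (M ∪ Y) ∪ (M' ∪ L')) 2 := by
    refine SetPath.snoc M' L' hp1 hMc' hLℓ' hMd'.1.symm ?_ ?_
    · simp only [disjoint_union_left, disjoint_union_right]
      exact ⟨⟨hMW'.1.1.2.symm, hMW'.2.symm, hMd'.2⟩, hd, hMW.2, hYL'⟩
    · rwa [union_right_comm, union_comm Y L']
  refine ⟨_, hp2, ?_, ?_, ?_⟩
  · refine disjoint_of_subset_left (u := M ∪ Y ∪ M') ?_ ?_
    · intro x
      simp only [mem_sdiff, mem_union]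
      tauto
    · simp only [disjoint_union_left]
      exact ⟨⟨hMW.1.1, hYW⟩, hMW'.1.1.1⟩
  · have h1 := (mem_crossing.1 hY).2.2
    have h2 : B ⊆ A ∪ B := subset_union_right
    exact union_subset (union_subset (hL.trans h2) (union_subset (hMB.trans h2) h1))
      (union_subset (hMB'.trans h2) (hL'.trans h2))
  · rw [← card_sdiff_of_mem_crossing h.disjoint hY]
    congr 1
    ext x
    have h1 := @hL x
    have h2 := @hL' x
    have h3 := @hMB x
    have h4 := @hMB' x
    simp only [mem_sdiff, mem_union]
    tauto

/-- A path can be prolonged by one edge with exactly one vertex outside `B`. -/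
lemma exists_edge (h : IsReservoir H ℓ A B κ τ) {L W : Finset V} (hL : L ⊆ B) (hLℓ : #L = ℓ)
    (hLt : IsTypical H ℓ A B τ L) (hW : (#W : ℝ) + k ≤ κ / 4 * Fintype.card V) :
    ∃ L' X, SetPath H ℓ L L' X 1 ∧ IsTypical H ℓ A B τ L' ∧ L' ⊆ B ∧ Disjoint (X \ L) W ∧
      X ⊆ A ∪ B ∧ #(X \ B) = 1 := by
  have hn := h.cast_card_pos
  have hℓk := h.two_mul_lt
  obtain ⟨R, hR, hRE, hRL, hRW, hRt⟩ := h.exists_fill (F := crossing A B (k - ℓ)) (L := L)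
    (by omega) (fun M hM => by rw [(mem_crossing.1 hM).1, hLℓ])
    (by rw [hLℓ]; exact h.card_crossing _ (by omega) (by omega))
    (fun M hM hd => by
      rw [union_comm]
      exact union_mem_crossing h.disjoint hM hL hLℓ hd.symm (by omega))
    (by
      rw [hLℓ]
      refine hLt.trans ?_
      gcongr
      exact h.tau_le) hW
  have hRc := card_sdiff_of_mem_crossing h.disjoint hR
  have hR' := mem_crossing.1 hR
  have hRB : ℓ ≤ #(R ∩ B) := by
    have := card_inter_add_card_sdiff R B
    omega
  obtain ⟨L', hL', hL'c⟩ := exists_subset_card_eq hRB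
  have hL'R : L' ⊆ R := hL'.trans inter_subset_left
  have hRu : R \ L' ∪ L' = R := sdiff_union_of_subset hL'R
  have hL'B : L' ⊆ B := hL'.trans inter_subset_right
  refine ⟨L', L ∪ (R \ L' ∪ L'), SetPath.single hLℓ ?_ hL'c sdiff_disjoint (by rwa [hRu])
    (by rwa [union_assoc, hRu]), hRt _ hL'R hL'c, hL'B, ?_, ?_, ?_⟩
  · rw [card_sdiff_of_subset hL'R, hR'.1, hL'c]; omega
  · rw [hRu, union_sdiff_left]
    exact disjoint_of_subset_left sdiff_subset hRW
  · rw [hRu]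
    exact union_subset (hL.trans subset_union_right) hR'.2.2
  · rw [hRu, union_sdiff_distrib, sdiff_eq_empty_iff_subset.2 hL, empty_union, hRc]

/-- From any `ℓ`-subset of `B` there is a short path to a typical one, in which
at most every second edge needs a vertex outside `B`. -/
lemma exists_path_to_typical (h : IsReservoir H ℓ A B κ τ) {L W : Finset V} (hL : L ⊆ B)
    (hLℓ : #L = ℓ) (hW : (#W : ℝ) + 2 * k ≤ κ / 4 * Fintype.card V) :
    ∃ L' X t, SetPath H ℓ L L' X t ∧ IsTypical H ℓ A B τ L' ∧ L' ⊆ B ∧ Disjoint (X \ L) W ∧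
      X ⊆ A ∪ B ∧ 2 * #(X \ B) ≤ t ∧ 1 ≤ t ∧ t ≤ 2 := by
  classical
  have hn := h.cast_card_pos
  have hκ := h.pos
  have hℓk := h.two_mul_lt
  have hℓ1 := h.one_le
  have hk0 : (0 : ℝ) ≤ k := Nat.cast_nonneg k
  have hF : ∀ Z ∈ ({Z ∈ H.edges | L ⊆ Z ∧ Z ⊆ A ∪ B ∧ #(Z ∩ A) ≤ 1} : Finset (Finset V)),
      #Z = k ∧ L ⊆ Z := fun Z hZ =>
    ⟨H.card_of_mem_edges Z (mem_filter.1 hZ).1, (mem_filter.1 hZ).2.1⟩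
  obtain ⟨Z, hZ, hZt, hZW⟩ := exists_superset_disjoint (by omega) hF h.pos h.card_pos
    (by rw [hLℓ]; exact h.card_edges L hL hLℓ)
    (fun e => ∃ Y, #Y = ℓ ∧ Y ⊆ e \ L ∧ ¬ IsTypical H ℓ A B τ Y)
    ((h.card_filter_atypical_le hF).trans (by gcongr; norm_num)) (W := W) (by linarith)
  have hZk := hF Z hZ
  obtain ⟨hZE, hLZ, hZAB, hZA⟩ := mem_filter.1 hZ
  replace hZt : ∀ Y ⊆ Z \ L, #Y = ℓ → IsTypical H ℓ A B τ Y := fun Y hY hYc => by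
    by_contra hcon
    exact hZt ⟨Y, hYc, hY, hcon⟩
  have hZL : #(Z \ L) = k - ℓ := by rw [card_sdiff_of_subset hLZ, hZk.1, hLℓ]
  -- A decomposition of `Z` into `L`, a given set `Y` and the rest is an edge of a path.
  have hstep : ∀ Y ⊆ Z \ L, #Y = ℓ → SetPath H ℓ L Y Z 1 := by
    intro Y hY hYc
    have hYu : (Z \ L) \ Y ∪ Y = Z \ L := sdiff_union_of_subset hY
    have hZu : L ∪ ((Z \ L) \ Y ∪ Y) = Z := by rw [hYu, union_sdiff_of_subset hLZ]
    have := SetPath.single (H := H) (M := (Z \ L) \ Y) hLℓ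
      (by rw [card_sdiff_of_subset hY, hZL, hYc]; omega) hYc sdiff_disjoint
      (by rw [hYu]; exact disjoint_sdiff) (by rwa [union_assoc, hZu])
    rwa [hZu] at this
  by_cases hZB : Z ⊆ B
  · obtain ⟨L', hL', hL'c⟩ := exists_subset_card_eq (show ℓ ≤ #(Z \ L) by omega)
    refine ⟨L', Z, 1, hstep L' hL' hL'c, hZt L' hL' hL'c, (hL'.trans sdiff_subset).trans hZB, hZW,
      hZAB, ?_, le_rfl, by norm_num⟩
    rw [sdiff_eq_empty_iff_subset.2 hZB, card_empty]
    omega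
  · obtain ⟨x, hxZ, hxB⟩ := not_subset.1 hZB
    have hxA : x ∈ A := (mem_union.1 (hZAB hxZ)).resolve_right hxB
    have hxL : x ∉ L := fun hx => hxB (hL hx)
    have hZx : Z ∩ A = {x} := eq_singleton_iff_unique_mem.2 ⟨mem_inter.2 ⟨hxZ, hxA⟩, fun y hy =>
      card_le_one.1 hZA y hy x (mem_inter.2 ⟨hxZ, hxA⟩)⟩
    have hZB' : ∀ z ∈ Z, z ≠ x → z ∈ B := fun z hz hzx =>
      (mem_union.1 (hZAB hz)).resolve_left fun hzA => hzx <| by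
        rw [← mem_singleton, ← hZx]; exact mem_inter.2 ⟨hz, hzA⟩
    -- The end of the first edge contains the vertex outside `B`.
    obtain ⟨Y, hxY, hY, hYc⟩ := exists_subsuperset_card_eq
      (singleton_subset_iff.2 (mem_sdiff.2 ⟨hxZ, hxL⟩)) (show #{x} ≤ ℓ by rwa [card_singleton])
      (show ℓ ≤ #(Z \ L) by omega)
    rw [singleton_subset_iff] at hxY
    have hYZ := hY.trans sdiff_subset
    have hYcr : Y ∈ crossing A B ℓ := by
      refine mem_crossing.2 ⟨hYc, ?_, hYZ.trans hZAB⟩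
      rw [card_eq_one]
      refine ⟨x, subset_antisymm ?_ (singleton_subset_iff.2 (mem_inter.2 ⟨hxY, hxA⟩))⟩
      rw [← hZx]
      exact inter_subset_inter_right hYZ
    have hZu : (#(W ∪ Z) : ℝ) ≤ #W + k := by
      rw [← hZk.1]; exact_mod_cast card_union_le W Z
    obtain ⟨R, hR, hRc, hRE, hRY, hRW, hRt⟩ := h.exists_fill_of_mem_crossing (L := Y) (by omega)
      (by rwa [hYc]) (by
        rw [hYc]
        refine (hZt Y hY hYc).trans ?_
        gcongr
        exact h.tau_le) (W := W ∪ Z) (by linarith)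
    rw [hYc] at hRc
    rw [disjoint_union_right] at hRW
    obtain ⟨L', hL', hL'c⟩ := exists_subset_card_eq (show ℓ ≤ #R by omega)
    have hRu : R \ L' ∪ L' = R := sdiff_union_of_subset hL'
    refine ⟨L', Z ∪ (R \ L' ∪ L'), 2, SetPath.snoc _ _ (hstep Y hY hYc) ?_ hL'c sdiff_disjoint ?_ ?_,
      hRt L' hL' hL'c, hL'.trans hR, ?_, ?_, ?_, by norm_num, le_rfl⟩
    · rw [card_sdiff_of_subset hL', hRc, hL'c]; omega
    · rw [hRu]; exact hRW.2.symm
    · rwa [union_assoc, hRu]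
    · rw [hRu, union_sdiff_distrib, disjoint_union_left]
      exact ⟨hZW, disjoint_of_subset_left sdiff_subset hRW.1⟩
    · rw [hRu]
      exact union_subset hZAB (hR.trans subset_union_right)
    · have h1 : (Z ∪ (R \ L' ∪ L')) \ B ⊆ {x} := by
        rw [hRu]
        intro z hz
        rw [mem_sdiff, mem_union] at hz
        rw [mem_singleton]
        by_contra hzx
        exact hz.2 (hz.1.elim (fun hz' => hZB' z hz' hzx) fun hz' => hR hz')
      have := card_le_card h1
      rw [card_singleton] at this
      omega

/-- A path with a typical end can absorb a disjoint path with ends in `B`: the two connecting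
paths need a vertex outside `B` for at most every second of their edges. -/
lemma exists_absorb (h : IsReservoir H ℓ A B κ τ) {L₀ L K₀ K₁ X Y W : Finset V} {t s : ℕ}
    (hX : SetPath H ℓ L₀ L X t) (hLB : L ⊆ B) (hLt : IsTypical H ℓ A B τ L)
    (hY : SetPath H ℓ K₀ K₁ Y s) (hK₀ : K₀ ⊆ B) (hK₁ : K₁ ⊆ B) (hXY : Disjoint X Y)
    (hW : (#X : ℝ) + #Y + #W + 10 * k ≤ κ / 4 * Fintype.card V) :
    ∃ L' X' t', SetPath H ℓ L₀ L' X' t' ∧ L' ⊆ B ∧ IsTypical H ℓ A B τ L' ∧ X ∪ Y ⊆ X' ∧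
      X' \ (X ∪ Y) ⊆ (A ∪ B) \ W ∧ t ≤ t' ∧ t' ≤ t + s + 6 ∧
      2 * #(X' \ B) + t + s ≤ t' + 2 * #(X \ B) + 2 * #(Y \ B) := by
  have hk0 : (0 : ℝ) ≤ k := Nat.cast_nonneg k
  have hℓk := h.two_mul_lt
  have hcu : ∀ S T : Finset V, (#(S ∪ T) : ℝ) ≤ #S + #T := fun S T => by
    exact_mod_cast card_union_le S T
  have hcard : ∀ {P P' U : Finset V} {r : ℕ}, SetPath H ℓ P P' U r → r ≤ 2 → (#U : ℝ) ≤ 3 * k := by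
    intro P P' U r hU hr
    have h1 := hU.card_eq hℓk.le
    have h2 : r * (k - ℓ) ≤ 2 * (k - ℓ) := Nat.mul_le_mul_right _ hr
    have h3 : #U ≤ 3 * k := by omega
    exact_mod_cast h3
  obtain ⟨K₁', X₁, t₁, hX₁, hK₁t, hK₁B, hX₁W, hX₁AB, hX₁s, -, ht₁⟩ :=
    h.exists_path_to_typical hK₁ hY.card_last (W := X ∪ Y ∪ W) (by
      linarith [hcu (X ∪ Y) W, hcu X Y])
  have hc₁ := hcard hX₁ ht₁
  obtain ⟨K₀', X₀, t₀, hX₀, hK₀t, hK₀B, hX₀W, hX₀AB, hX₀s, ht₀', ht₀⟩ :=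
    h.exists_path_to_typical hK₀ hY.card_first (W := X ∪ Y ∪ W ∪ X₁) (by
      linarith [hcu (X ∪ Y ∪ W) X₁, hcu (X ∪ Y) W, hcu X Y])
  have hc₀ := hcard hX₀ ht₀
  simp only [disjoint_union_right] at hX₁W hX₀W
  have hdK : Disjoint L K₀' := by
    refine disjoint_left.2 fun x hx hx' => ?_
    exact disjoint_left.1 hX₀W.1.1.1 (mem_sdiff.2 ⟨hX₀.last_subset hx',
      fun hx'' => disjoint_left.1 (hX₀.disjoint_ends ht₀') hx'' hx'⟩) (hX.last_subset hx)
  obtain ⟨X₂, hX₂, hX₂W, hX₂AB, hX₂s⟩ := h.exists_connection hLB hK₀B hX.card_last hX₀.card_last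
    hLt hK₀t hdK (W := X ∪ Y ∪ W ∪ X₁ ∪ X₀) (by
      linarith [hcu (X ∪ Y ∪ W ∪ X₁) X₀, hcu (X ∪ Y ∪ W) X₁, hcu (X ∪ Y) W, hcu X Y])
  simp only [disjoint_union_right] at hX₂W
  obtain ⟨⟨⟨⟨h2X, h2Y⟩, h2W⟩, h21⟩, h20⟩ := hX₂W
  obtain ⟨⟨⟨h0X, h0Y⟩, h0W⟩, h01⟩ := hX₀W
  obtain ⟨⟨h1X, h1Y⟩, h1W⟩ := hX₁W
  have hLX := hX.last_subset
  have hK₀Y := hY.first_subset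
  have hK₀'X := hX₀.last_subset
  simp only [disjoint_left, mem_sdiff, mem_union, not_or] at h2X h2Y h2W h21 h20 h0X h0Y h0W h01
  simp only [disjoint_left, mem_sdiff] at h1X h1Y h1W hXY hdK
  have hp₁ := hX.trans hX₂ fun x hx => by
    rw [mem_inter] at hx
    by_contra hxL
    by_cases hxK : x ∈ K₀'
    · refine h0X ⟨hK₀'X hxK, fun hx0 => ?_⟩ hx.1
      exact hXY hx.1 (hK₀Y hx0)
    · exact h2X ⟨hx.2, hxL, hxK⟩ hx.1
  have hp₂ := hp₁.trans hX₀.reverse fun x hx => by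
    rw [mem_inter, mem_union] at hx
    by_contra hxK
    obtain ⟨hx | hx, hx'⟩ := hx
    · exact h0X ⟨hx', fun hx0 => hXY hx (hK₀Y hx0)⟩ hx
    · by_cases hxL : x ∈ L
      · exact h0X ⟨hx', fun hx0 => hXY (hLX hxL) (hK₀Y hx0)⟩ (hLX hxL)
      · exact h20 ⟨hx, hxL, hxK⟩ hx'
  have hp₃ := hp₂.trans hY fun x hx => by
    rw [mem_inter, mem_union, mem_union] at hx
    by_contra hxK
    obtain ⟨(hx | hx) | hx, hx'⟩ := hx
    · exact hXY hx hx'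
    · by_cases hxL : x ∈ L
      · exact hXY (hLX hxL) hx'
      · by_cases hxK' : x ∈ K₀'
        · exact h0Y ⟨hK₀'X hxK', hxK⟩ hx'
        · exact h2Y ⟨hx, hxL, hxK'⟩ hx'
    · exact h0Y ⟨hx, hxK⟩ hx'
  have hp₄ := hp₃.trans hX₁ fun x hx => by
    rw [mem_inter, mem_union, mem_union, mem_union] at hx
    by_contra hxK
    obtain ⟨((hx | hx) | hx) | hx, hx'⟩ := hx
    · exact h1X ⟨hx', hxK⟩ hx
    · by_cases hxL : x ∈ L
      · exact h1X ⟨hx', hxK⟩ (hLX hxL)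
      · by_cases hxK' : x ∈ K₀'
        · by_cases hx0 : x ∈ K₀
          · exact h1Y ⟨hx', hxK⟩ (hK₀Y hx0)
          · exact h01 ⟨hK₀'X hxK', hx0⟩ hx'
        · exact h21 ⟨hx, hxL, hxK'⟩ hx'
    · by_cases hx0 : x ∈ K₀
      · exact h1Y ⟨hx', hxK⟩ (hK₀Y hx0)
      · exact h01 ⟨hx, hx0⟩ hx'
    · exact h1Y ⟨hx', hxK⟩ hx
  refine ⟨_, _, _, hp₄, hK₁B, hK₁t, ?_, ?_, by omega, by omega, ?_⟩
  · intro x hx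
    rw [mem_union] at hx
    simp only [mem_union]
    tauto
  · intro x hx
    simp only [mem_sdiff, mem_union, not_or] at hx ⊢
    obtain ⟨hx, hxX, hxY⟩ := hx
    have hxL : x ∉ L := fun h' => hxX (hLX h')
    have hxK₀ : x ∉ K₀ := fun h' => hxY (hK₀Y h')
    have hxK₁ : x ∉ K₁ := fun h' => hxY (hY.last_subset h')
    obtain (((hx | hx) | hx) | hx) | hx := hx
    · exact absurd hx hxX
    · refine ⟨mem_union.1 (hX₂AB hx), fun hxW => ?_⟩
      by_cases hxK' : x ∈ K₀'
      · exact h0W ⟨hK₀'X hxK', hxK₀⟩ hxW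
      · exact h2W ⟨hx, hxL, hxK'⟩ hxW
    · exact ⟨mem_union.1 (hX₀AB hx), fun hxW => h0W ⟨hx, hxK₀⟩ hxW⟩
    · exact absurd hx hxY
    · exact ⟨mem_union.1 (hX₁AB hx), fun hxW => h1W ⟨hx, hxK₁⟩ hxW⟩
  · simp only [union_sdiff_distrib]
    have h1 := card_union_le (X \ B ∪ X₂ \ B ∪ X₀ \ B ∪ Y \ B) (X₁ \ B)
    have h2 := card_union_le (X \ B ∪ X₂ \ B ∪ X₀ \ B) (Y \ B)
    have h3 := card_union_le (X \ B ∪ X₂ \ B) (X₀ \ B)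
    have h4 := card_union_le (X \ B) (X₂ \ B)
    omega

end IsReservoir

end LoosePath

/-! ### Two edges with a prescribed intersection -/

namespace LoosePath

variable {V : Type*} [DecidableEq V] {k ℓ : ℕ}

/-- `C` is a kernel of the `k`-uniform set system `F` if the members of `F` containing `C` cannot be
blocked outside `C` by `k` vertices, as it is the case for the kernel of a large sunflower. -/
def IsKernel (F : Finset (Finset V)) (k : ℕ) (C : Finset V) : Prop :=
  ∀ W : Finset V, #W ≤ k → ∃ e ∈ F, C ⊆ e ∧ Disjoint (e \ C) W

lemma IsKernel.card_le {F : Finset (Finset V)} (hF : ∀ e ∈ F, #e = k) {C : Finset V}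
    (hC : IsKernel F k C) : #C ≤ k := by
  obtain ⟨e, he, hCe, -⟩ := hC ∅ (by simp)
  rw [← hF e he]
  exact card_le_card hCe

/-- Two kernels extend to members with the same intersection. -/
lemma IsKernel.exists_inter_eq {F : Finset (Finset V)} (hF : ∀ e ∈ F, #e = k) {C C' : Finset V}
    (hC : IsKernel F k C) (hC' : IsKernel F k C') : ∃ e ∈ F, ∃ f ∈ F, e ∩ f = C ∩ C' := by
  obtain ⟨e, he, hCe, hd⟩ := hC C' (hC'.card_le hF)
  obtain ⟨f, hf, hCf, hd'⟩ := hC' e (hF e he).le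
  refine ⟨e, he, f, hf, ?_⟩
  rw [disjoint_left] at hd hd'
  ext x
  have h1 := @hd x
  have h2 := @hd' x
  have h3 := @hCe x
  have h4 := @hCf x
  simp only [mem_sdiff, mem_inter] at h1 h2 ⊢
  tauto

/-- The bound in `exists_blocking_set`. -/
def blockingBound (k : ℕ) : ℕ → ℕ
  | 0 => k
  | d + 1 => k + k * blockingBound k d

/-- If no set of size at most `#T + d` that contains `T` is a kernel, then a bounded set meets
all members containing `T` in more than `d` vertices outside `T`. -/
lemma exists_blocking_set (F : Finset (Finset V)) (k d : ℕ) (T : Finset V)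
    (hT : ∀ C, T ⊆ C → #C ≤ #T + d → ¬ IsKernel F k C) :
    ∃ W : Finset V, #W ≤ blockingBound k d ∧ ∀ e ∈ F, T ⊆ e → d + 1 ≤ #((e \ T) ∩ W) := by
  induction d generalizing T with
  | zero =>
    have h := hT T Subset.rfl le_rfl
    simp only [IsKernel, not_forall, not_exists, not_and] at h
    obtain ⟨W, hW, h⟩ := h
    refine ⟨W, hW, fun e he hTe => ?_⟩
    rw [zero_add, Nat.one_le_iff_ne_zero, Ne, card_eq_zero, ← disjoint_iff_inter_eq_empty]
    exact h e he hTe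
  | succ d ih =>
    have h := hT T Subset.rfl (by omega)
    simp only [IsKernel, not_forall, not_exists, not_and] at h
    obtain ⟨W, hW, h⟩ := h
    have h1 : ∀ w ∈ W \ T, ∃ U : Finset V, #U ≤ blockingBound k d ∧
        ∀ e ∈ F, insert w T ⊆ e → d + 1 ≤ #((e \ insert w T) ∩ U) := fun w hw =>
      ih (insert w T) fun C hC hCc => hT C ((subset_insert _ _).trans hC) (by
        rw [card_insert_of_notMem (mem_sdiff.1 hw).2] at hCc
        omega)
    choose! U hU hUe using h1
    refine ⟨W ∪ (W \ T).biUnion U, ?_, fun e he hTe => ?_⟩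
    · refine (card_union_le _ _).trans (add_le_add hW ?_)
      refine (card_biUnion_le_card_mul _ _ _ hU).trans (Nat.mul_le_mul_right _ ?_)
      exact (card_le_card sdiff_subset).trans hW
    · obtain ⟨w, hw, hwW⟩ := not_disjoint_iff.1 (h e he hTe)
      rw [mem_sdiff] at hw
      have hwT := mem_sdiff.2 ⟨hwW, hw.2⟩
      have h2 := hUe w hwT e he (insert_subset hw.1 hTe)
      have h3 : insert w ((e \ insert w T) ∩ U w) ⊆ (e \ T) ∩ (W ∪ (W \ T).biUnion U) := by
        refine insert_subset (mem_inter.2 ⟨mem_sdiff.2 hw, mem_union_left _ hwW⟩) ?_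
        exact inter_subset_inter (sdiff_subset_sdiff Subset.rfl (subset_insert _ _))
          ((subset_biUnion_of_mem U hwT).trans subset_union_right)
      have h4 := card_le_card h3
      rw [card_insert_of_notMem (by simp)] at h4
      omega

lemma exists_subset_disjoint {B : Finset V} (U : Finset V) (j : ℕ) (h : #U + j ≤ #B) :
    ∃ T ⊆ B, #T = j ∧ Disjoint T U := by
  obtain ⟨T, hT, hTc⟩ := exists_subset_card_eq (show j ≤ #(B \ U) by
    have := le_card_sdiff U B
    omega)
  exact ⟨T, hT.trans sdiff_subset, hTc, disjoint_of_subset_left hT sdiff_disjoint⟩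

/-- In a `k`-uniform set system on `B` that covers all `(k - 2)`-sets, every small set extends
to a kernel by at most two vertices. -/
lemma exists_isKernel {F : Finset (Finset V)} {B : Finset V} (hF : ∀ e ∈ F, #e = k)
    (hk : 2 ≤ k) (hcov : ∀ S ⊆ B, #S = k - 2 → ∃ e ∈ F, S ⊆ e)
    (hB : blockingBound k 2 + k ≤ #B) {T : Finset V} (hTB : T ⊆ B) (hT : #T ≤ k - 2) :
    ∃ C, T ⊆ C ∧ #C ≤ #T + 2 ∧ IsKernel F k C := by
  by_contra! hcon
  obtain ⟨W, hW, hWe⟩ := exists_blocking_set F k 2 T hcon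
  obtain ⟨S, hTS, hS, hSc⟩ := exists_subsuperset_card_eq
    (show T ⊆ T ∪ B \ W from subset_union_left) hT (by
      have h1 := le_card_sdiff W B
      have h2 := card_le_card (show B \ W ⊆ T ∪ B \ W from subset_union_right)
      omega)
  obtain ⟨e, he, hSe⟩ := hcov S (hS.trans (union_subset hTB sdiff_subset)) hSc
  have h1 := hWe e he (hTS.trans hSe)
  have h2 : (e \ T) ∩ W ⊆ e \ S := by
    intro x hx
    simp only [mem_inter, mem_sdiff] at hx ⊢
    refine ⟨hx.1.1, fun hxS => ?_⟩
    obtain h3 | h3 := mem_union.1 (hS hxS)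
    · exact hx.1.2 h3
    · exact (mem_sdiff.1 h3).2 hx.2
  have h3 := card_le_card h2
  rw [card_sdiff_of_subset hSe, hF e he, hSc] at h3
  omega

/-- A system of sets that covers all `(k - 2)`-sets contains two disjoint sets or
two sets that share exactly `ℓ` vertices, for `2 ≤ ℓ < k / 2`. Otherwise, any two kernels would
intersect, but not in `ℓ` vertices. This forces a vertex `a` common to all kernels, and the kernels
`C x` obtained from the sets `T₀ ∪ {x}`, with `T₀` a fixed `(ℓ - 2)`-set, to have `ℓ + 1` vertices.
For suitable `x`, `y` the kernel obtained from `T₀ ∪ {x, y}` contains both `C x` and `C y`,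
for which it is too small. -/
lemma exists_disjoint_or_card_inter_eq_of_two_le {F : Finset (Finset V)} {B : Finset V}
    (hF : ∀ e ∈ F, #e = k) (hℓ : 2 ≤ ℓ) (hℓk : 2 * ℓ < k)
    (hcov : ∀ S ⊆ B, #S = k - 2 → ∃ e ∈ F, S ⊆ e) (hB : blockingBound k 2 + 5 * k ≤ #B) :
    ∃ e ∈ F, ∃ f ∈ F, Disjoint e f ∨ #(e ∩ f) = ℓ := by
  by_contra! hcon
  have hinter : ∀ C C', IsKernel F k C → IsKernel F k C' → (C ∩ C').Nonempty ∧ #(C ∩ C') ≠ ℓ := by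
    intro C C' hC hC'
    obtain ⟨e, he, f, hf, hef⟩ := hC.exists_inter_eq hF hC'
    rw [← hef, nonempty_iff_ne_empty, Ne, ← disjoint_iff_inter_eq_empty]
    exact hcon e he f hf
  have hex : ∀ T ⊆ B, #T ≤ ℓ → ∃ C, T ⊆ C ∧ #C ≤ #T + 2 ∧ IsKernel F k C := fun T hT hTc =>
    exists_isKernel hF (by omega) hcov (by omega) hT (by omega)
  obtain ⟨C₀, -, hC₀, hC₀k⟩ := hex ∅ (empty_subset _) (by simp)
  rw [card_empty] at hC₀
  have hsmall : ∀ T ⊆ B, #T = ℓ - 2 → Disjoint T C₀ → ∃ a ∈ C₀, IsKernel F k (insert a T) := by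
    intro T hT hTc hTd
    obtain ⟨C, hTC, hCc, hC⟩ := hex T hT (by omega)
    obtain ⟨a, ha⟩ := (hinter C C₀ hC hC₀k).1
    have h1 := (hinter C C hC hC).2
    rw [inter_self] at h1
    rw [mem_inter] at ha
    have h2 : insert a T = C := by
      refine eq_of_subset_of_card_le (insert_subset ha.1 hTC) ?_
      rw [card_insert_of_notMem (disjoint_right.1 hTd ha.2)]
      omega
    exact ⟨a, ha.2, h2 ▸ hC⟩
  obtain ⟨T₁, hT₁B, hT₁c, hT₁d⟩ := exists_subset_disjoint (B := B) C₀ (ℓ - 2) (by omega)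
  obtain ⟨a, ha, haT₁⟩ := hsmall T₁ hT₁B hT₁c hT₁d
  have hall : ∀ C, IsKernel F k C → a ∈ C := by
    intro C hC
    have hCk := hC.card_le hF
    obtain ⟨T, hTB, hTc, hTd⟩ := exists_subset_disjoint (B := B) (C₀ ∪ C ∪ T₁) (ℓ - 2) (by
      have h1 := card_union_le (C₀ ∪ C) T₁
      have h2 := card_union_le C₀ C
      omega)
    simp only [disjoint_union_right] at hTd
    obtain ⟨a', ha', haT⟩ := hsmall T hTB hTc hTd.1.1
    have h1 : a' = a := by
      obtain ⟨x, hx⟩ := (hinter _ _ haT haT₁).1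
      rw [mem_inter, mem_insert, mem_insert] at hx
      obtain ⟨rfl | hx, rfl | hx'⟩ := hx
      · rfl
      · exact absurd ha' (disjoint_left.1 hT₁d hx')
      · exact absurd ha (disjoint_left.1 hTd.1.1 hx)
      · exact absurd hx' (disjoint_left.1 hTd.2 hx)
    obtain ⟨x, hx⟩ := (hinter _ _ haT hC).1
    rw [mem_inter, mem_insert] at hx
    obtain ⟨rfl | hx, hx'⟩ := hx
    · exact h1 ▸ hx'
    · exact absurd hx' (disjoint_left.1 hTd.1.2 hx)
  obtain ⟨T₀, hT₀B, hT₀c, hT₀d⟩ := exists_subset_disjoint (B := B) {a} (ℓ - 2) (by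
    rw [card_singleton]; omega)
  rw [disjoint_singleton_right] at hT₀d
  have hC : ∀ x ∈ B, x ∉ T₀ → x ≠ a → ∃ C, IsKernel F k C ∧ insert x T₀ ⊆ C ∧ #C = ℓ + 1 := by
    intro x hxB hxT hxa
    have hc : #(insert x T₀) = ℓ - 1 := by rw [card_insert_of_notMem hxT]; omega
    obtain ⟨C, hTC, hCc, hC⟩ := hex (insert x T₀) (insert_subset hxB hT₀B) (by omega)
    refine ⟨C, hC, hTC, ?_⟩
    have h1 := (hinter C C hC hC).2
    rw [inter_self] at h1
    have h2 := card_le_card (insert_subset (hall C hC) hTC)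
    rw [card_insert_of_notMem (by simp [hxa.symm, hT₀d])] at h2
    omega
  choose! C hC hCx hCc using hC
  have hpair : ∀ x ∈ B, ∀ y ∈ B, x ∉ T₀ → x ≠ a → y ∉ T₀ → y ≠ a → y ∉ C x → x ∉ C y → False := by
    intro x hxB y hyB hxT hxa hyT hya hyC hxC
    have hxy : x ≠ y := by
      rintro rfl
      exact hyC (hCx x hxB hxT hxa (mem_insert_self _ _))
    have hc : #(insert x (insert y T₀)) = ℓ := by
      rw [card_insert_of_notMem (by simp [hxy, hxT]), card_insert_of_notMem hyT]
      omega
    obtain ⟨D, hTD, hDc, hD⟩ := hex (insert x (insert y T₀))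
      (insert_subset hxB (insert_subset hyB hT₀B)) hc.le
    have hsub : ∀ z ∈ B, z ∉ T₀ → z ≠ a → insert z T₀ ⊆ D → C z ⊆ D := by
      intro z hzB hzT hza hzD
      have h1 : insert a (insert z T₀) ⊆ C z ∩ D := insert_subset
        (mem_inter.2 ⟨hall _ (hC z hzB hzT hza), hall _ hD⟩)
        (subset_inter (hCx z hzB hzT hza) hzD)
      have h2 := card_le_card h1
      rw [card_insert_of_notMem (by simp [hza.symm, hT₀d]), card_insert_of_notMem hzT] at h2
      have h3 := (hinter _ _ (hC z hzB hzT hza) hD).2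
      have h4 := hCc z hzB hzT hza
      have h5 : C z ∩ D = C z := eq_of_subset_of_card_le inter_subset_left (by omega)
      rw [← h5]
      exact inter_subset_right
    have h1 := hsub x hxB hxT hxa ((insert_subset_insert _ (subset_insert _ _)).trans hTD)
    have h2 := hsub y hyB hyT hya ((subset_insert _ _).trans hTD)
    have h3 : C x ∩ C y ⊆ (C x).erase x := fun z hz => by
      rw [mem_inter] at hz
      exact mem_erase.2 ⟨fun h => hxC (h ▸ hz.2), hz.1⟩
    have h4 := card_le_card h3
    rw [card_erase_of_mem (hCx x hxB hxT hxa (mem_insert_self _ _)), hCc x hxB hxT hxa] at h4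
    have h5 := (hinter _ _ (hC x hxB hxT hxa) (hC y hyB hyT hya)).2
    have h6 := card_union_add_card_inter (C x) (C y)
    rw [hCc x hxB hxT hxa, hCc y hyB hyT hya] at h6
    have h7 := card_le_card (union_subset h1 h2)
    omega
  have hpick : ∀ U : Finset V, #U ≤ 3 * k → ∃ x ∈ B, x ∉ U ∧ x ∉ T₀ ∧ x ≠ a := by
    intro U hU
    obtain ⟨T, hTB, hTc, hTd⟩ := exists_subset_disjoint (B := B) (insert a (U ∪ T₀)) 1 (by
      have h1 := card_insert_le a (U ∪ T₀)
      have h2 := card_union_le U T₀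
      omega)
    obtain ⟨x, rfl⟩ := card_eq_one.1 hTc
    rw [disjoint_singleton_left, mem_insert, mem_union, not_or, not_or] at hTd
    exact ⟨x, singleton_subset_iff.1 hTB, hTd.2.1, hTd.2.2, hTd.1⟩
  obtain ⟨x, hxB, -, hxT, hxa⟩ := hpick ∅ (by simp)
  have hCxc := hCc x hxB hxT hxa
  obtain ⟨y, hyB, hyC, hyT, hya⟩ := hpick (C x) (by omega)
  have hCyc := hCc y hyB hyT hya
  obtain ⟨z, hzB, hzC, hzT, hza⟩ := hpick (C x ∪ C y) (by
    have := card_union_le (C x) (C y)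
    omega)
  rw [mem_union, not_or] at hzC
  by_cases hxz : x ∈ C z
  · refine hpair y hyB z hzB hyT hya hzT hza hzC.2 fun hyz => ?_
    have h1 : insert y (insert x (insert a (insert z T₀))) ⊆ C z := insert_subset hyz
      (insert_subset hxz (insert_subset (hall _ (hC z hzB hzT hza)) (hCx z hzB hzT hza)))
    have h2 := card_le_card h1
    have hyx : y ≠ x := by
      rintro rfl
      exact hyC (hCx y hxB hxT hxa (mem_insert_self _ _))
    have hyz' : y ≠ z := by
      rintro rfl
      exact hzC.2 (hCx y hyB hyT hya (mem_insert_self _ _))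
    have hxz' : x ≠ z := by
      rintro rfl
      exact hzC.1 (hCx x hxB hxT hxa (mem_insert_self _ _))
    rw [card_insert_of_notMem (by simp [hyx, hya, hyz', hyT]),
      card_insert_of_notMem (by simp [hxa, hxz', hxT]),
      card_insert_of_notMem (by simp [hza.symm, hT₀d]), card_insert_of_notMem hzT,
      hCc z hzB hzT hza] at h2
    omega
  · exact hpair x hxB z hzB hxT hxa hzT hza hzC.1 hxz

/-- A system of sets that covers all `(k - 2)`-sets twice contains two sets that share
at most one vertex. Otherwise, fix a member `f`; the two vertices by which a member extends
a given `(k - 2)`-set outside `f` lie in `f`, and have to agree for any two disjoint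
`(k - 2)`-sets. -/
lemma exists_disjoint_or_card_inter_eq_one {F : Finset (Finset V)} {B : Finset V}
    (hF : ∀ e ∈ F, #e = k) (hk : 3 ≤ k) (hcov : ∀ S ⊆ B, #S = k - 2 → 2 ≤ codegree F S)
    (hB : 5 * k ≤ #B) :
    ∃ e ∈ F, ∃ f ∈ F, Disjoint e f ∨ #(e ∩ f) = 1 := by
  by_contra! hcon
  have hinter : ∀ e ∈ F, ∀ f ∈ F, 2 ≤ #(e ∩ f) := by
    intro e he f hf
    obtain ⟨h1, h2⟩ := hcon e he f hf
    rw [disjoint_iff_inter_eq_empty, ← card_eq_zero] at h1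
    omega
  obtain ⟨S₀, hS₀B, hS₀c, -⟩ := exists_subset_disjoint (B := B) ∅ (k - 2) (by simp; omega)
  obtain ⟨f, hf⟩ : ({e ∈ F | S₀ ⊆ e} : Finset (Finset V)).Nonempty := card_pos.1 (by
    have := hcov S₀ hS₀B hS₀c
    rw [codegree] at this
    omega)
  replace hf := (mem_filter.1 hf).1
  have hfk := hF f hf
  obtain ⟨S₁, hS₁B, hS₁c, hS₁f⟩ := exists_subset_disjoint (B := B) f (k - 2) (by omega)
  obtain ⟨S₂, hS₂B, hS₂c, hS₂d⟩ := exists_subset_disjoint (B := B) (f ∪ S₁) (k - 2) (by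
    have := card_union_le f S₁
    omega)
  rw [disjoint_union_right] at hS₂d
  have hP : ∀ S, #S = k - 2 → Disjoint S f → ∀ e ∈ F, S ⊆ e → e \ S ⊆ f ∧ #(e \ S) = 2 := by
    intro S hS hSf e he hSe
    have h1 : e ∩ f ⊆ e \ S := fun x hx => by
      rw [mem_inter] at hx
      exact mem_sdiff.2 ⟨hx.1, fun hxS => disjoint_left.1 hSf hxS hx.2⟩
    have h2 : #(e \ S) = 2 := by rw [card_sdiff_of_subset hSe, hF e he, hS]; omega
    have h3 : e ∩ f = e \ S := eq_of_subset_of_card_le h1 (by rw [h2]; exact hinter e he f hf)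
    exact ⟨h3 ▸ inter_subset_right, h2⟩
  have hagree : ∀ e₁ ∈ F, S₁ ⊆ e₁ → ∀ e₂ ∈ F, S₂ ⊆ e₂ → e₁ \ S₁ = e₂ \ S₂ := by
    intro e₁ he₁ hSe₁ e₂ he₂ hSe₂
    obtain ⟨h1, h2⟩ := hP S₁ hS₁c hS₁f e₁ he₁ hSe₁
    obtain ⟨h3, h4⟩ := hP S₂ hS₂c hS₂d.1 e₂ he₂ hSe₂
    have h5 : e₁ ∩ e₂ ⊆ (e₁ \ S₁) ∩ (e₂ \ S₂) := by
      intro x hx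
      rw [mem_inter] at hx
      have h6 : x ∉ S₁ := fun h => by
        by_cases hx2 : x ∈ S₂
        · exact disjoint_left.1 hS₂d.2 hx2 h
        · exact disjoint_left.1 hS₁f h (h3 (mem_sdiff.2 ⟨hx.2, hx2⟩))
      have h7 : x ∉ S₂ := fun h =>
        disjoint_left.1 hS₂d.1 h (h1 (mem_sdiff.2 ⟨hx.1, h6⟩))
      exact mem_inter.2 ⟨mem_sdiff.2 ⟨hx.1, h6⟩, mem_sdiff.2 ⟨hx.2, h7⟩⟩
    have h6 := (hinter e₁ he₁ e₂ he₂).trans (card_le_card h5)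
    have h7 : (e₁ \ S₁) ∩ (e₂ \ S₂) = e₁ \ S₁ :=
      eq_of_subset_of_card_le inter_subset_left (by rw [h2]; exact h6)
    have h8 : (e₁ \ S₁) ∩ (e₂ \ S₂) = e₂ \ S₂ :=
      eq_of_subset_of_card_le inter_subset_right (by rw [h4]; exact h6)
    exact h7.symm.trans h8
  obtain ⟨e₂, he₂⟩ : ({e ∈ F | S₂ ⊆ e} : Finset (Finset V)).Nonempty := card_pos.1 (by
    have := hcov S₂ hS₂B hS₂c
    rw [codegree] at this
    omega)
  obtain ⟨e, he, e', he', hne⟩ := one_lt_card.1 (hcov S₁ hS₁B hS₁c)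
  rw [mem_filter] at he he' he₂
  apply hne
  rw [← sdiff_union_of_subset he.2, ← sdiff_union_of_subset he'.2,
    hagree e he.1 he.2 e₂ he₂.1 he₂.2, hagree e' he'.1 he'.2 e₂ he₂.1 he₂.2]

end LoosePath

/-! ### The minimum degree of the extremal example -/

namespace LoosePath

variable {V : Type*} [DecidableEq V] {k ℓ : ℕ}

lemma card_filter_subset_subset [Fintype V] {S T : Finset V} (hST : S ⊆ T) (hS : #S ≤ k) :
    #{Z ∈ powersetCard k (univ : Finset V) | S ⊆ Z ∧ Z ⊆ T} = (#T - #S).choose (k - #S) := by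
  rw [← card_sdiff_of_subset hST, ← card_powersetCard]
  symm
  refine card_bij (fun P _ => S ∪ P) (fun P hP => ?_) (fun P hP P' hP' h => ?_) fun Z hZ => ?_
  · rw [mem_powersetCard] at hP
    have hd : Disjoint S P := disjoint_of_subset_right hP.1 disjoint_sdiff
    refine mem_filter.2 ⟨mem_powersetCard.2 ⟨subset_univ _, ?_⟩, subset_union_left,
      union_subset hST (hP.1.trans sdiff_subset)⟩
    rw [card_union_of_disjoint hd, hP.2]
    omega
  · rw [mem_powersetCard] at hP hP'
    have hd : Disjoint S P := disjoint_of_subset_right hP.1 disjoint_sdiff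
    have hd' : Disjoint S P' := disjoint_of_subset_right hP'.1 disjoint_sdiff
    rw [← union_sdiff_cancel_left hd, ← union_sdiff_cancel_left hd']
    exact congrArg (· \ S) h
  · obtain ⟨hZ, hSZ, hZT⟩ := mem_filter.1 hZ
    refine ⟨Z \ S, mem_powersetCard.2 ⟨sdiff_subset_sdiff hZT Subset.rfl, ?_⟩,
      union_sdiff_of_subset hSZ⟩
    rw [card_sdiff_of_subset hSZ, (mem_powersetCard.1 hZ).2]

/-- The `k`-sets of vertices that are not edges of `H`. -/
def nonEdges [Fintype V] (H : UniformHypergraph V k) : Finset (Finset V) :=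
  powersetCard k univ \ H.edges

lemma mem_nonEdges [Fintype V] {H : UniformHypergraph V k} {Z : Finset V} :
    Z ∈ nonEdges H ↔ #Z = k ∧ Z ∉ H.edges := by
  simp [nonEdges]

lemma card_of_mem_nonEdges [Fintype V] {H : UniformHypergraph V k} :
    ∀ Z ∈ nonEdges H, #Z = k := fun _ hZ => (mem_nonEdges.1 hZ).1

/-- Every `k`-set between `S` and `T` is either an edge or not. -/
lemma card_edges_add_card_nonEdges [Fintype V] (H : UniformHypergraph V k) {S T : Finset V}
    (hST : S ⊆ T) (hS : #S ≤ k) :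
    #{Z ∈ H.edges | S ⊆ Z ∧ Z ⊆ T} + #{Z ∈ nonEdges H | S ⊆ Z ∧ Z ⊆ T} =
      (#T - #S).choose (k - #S) := by
  rw [← card_filter_subset_subset hST hS, ← card_union_of_disjoint]
  · congr 1
    ext Z
    simp only [mem_union, mem_filter, mem_nonEdges, mem_powersetCard]
    constructor
    · rintro (⟨h1, h2⟩ | ⟨h1, h2⟩)
      · exact ⟨⟨subset_univ _, H.card_of_mem_edges Z h1⟩, h2⟩
      · exact ⟨⟨subset_univ _, h1.1⟩, h2⟩
    · rintro ⟨⟨-, h1⟩, h2⟩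
      by_cases h : Z ∈ H.edges
      · exact Or.inl ⟨h, h2⟩
      · exact Or.inr ⟨⟨h1, h⟩, h2⟩
  · refine disjoint_left.2 fun Z hZ hZ' => ?_
    exact (mem_nonEdges.1 (mem_filter.1 hZ').1).2 (mem_filter.1 hZ).1

lemma degree_add_codegree_nonEdges [Fintype V] (H : UniformHypergraph V k) {S : Finset V}
    (hS : #S ≤ k) :
    H.degree S + codegree (nonEdges H) S = (Fintype.card V - #S).choose (k - #S) := by
  have h := card_edges_add_card_nonEdges H (subset_univ S) hS
  simp only [subset_univ, and_true, card_univ] at h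
  exact h

lemma exists_degree_eq_minDegree [Fintype V] (H : UniformHypergraph V k) {s : ℕ}
    (hs : s ≤ Fintype.card V) : ∃ S : Finset V, #S = s ∧ H.degree S = H.minDegree s := by
  obtain ⟨S, -, hS⟩ := exists_subset_card_eq (s := (univ : Finset V)) (n := s) (by rwa [card_univ])
  exact Nat.sInf_mem (s := {d : ℕ | ∃ S : Finset V, #S = s ∧ H.degree S = d}) ⟨_, S, hS, rfl⟩

lemma minDegree_le_degree (H : UniformHypergraph V k) {s : ℕ} {S : Finset V} (hS : #S = s) :
    H.minDegree s ≤ H.degree S :=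
  Nat.sInf_le ⟨S, hS, rfl⟩

/-- A `(k - 2)`-set that avoids the first part of the extremal example lies in all
`k`-sets meeting that part and, for `ℓ = 1`, in one further edge
if `n` is an even multiple of `k - ℓ`. -/
lemma le_minDegree_extremalExample {n : ℕ} (hk : 3 ≤ k) (hn : extremalExampleSize k ℓ n + k ≤ n) :
    (n - (k - 2)).choose 2 + (if Even (n / (k - ℓ)) ∧ ℓ = 1 then 1 else 0) ≤
      (extremalExample k ℓ n).minDegree (k - 2) +
        (n - extremalExampleSize k ℓ n - (k - 2)).choose 2 := by
  set a := extremalExampleSize k ℓ n with ha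
  obtain ⟨S, hS, hSd⟩ := exists_degree_eq_minDegree (extremalExample k ℓ n) (s := k - 2)
    (by rw [Fintype.card_fin]; omega)
  have h1 := degree_add_codegree_nonEdges (extremalExample k ℓ n) (S := S) (by omega)
  have hk2 : k - (k - 2) = 2 := by omega
  rw [hS, hSd, Fintype.card_fin, hk2] at h1
  rw [← h1, add_assoc, add_le_add_iff_left]
  set B : Finset (Fin n) := {v | a ≤ (v : ℕ)} with hB
  have hBc : #B = n - a := by
    have h2 : #{v : Fin n | (v : ℕ) < a} = a := by
      rw [Fin.card_filter_val_lt]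
      omega
    have h3 := card_filter_add_card_filter_not (s := (univ : Finset (Fin n)))
      (fun v => (v : ℕ) < a)
    simp only [not_lt, card_univ, Fintype.card_fin] at h3
    rw [hB]
    omega
  have hsub : ∀ Z ∈ nonEdges (extremalExample k ℓ n), Z ⊆ B ∧
      ¬ (Even (n / (k - ℓ)) ∧ ∀ v : Fin n, a ≤ v → (v : ℕ) ≤ a + ℓ → v ∈ Z) := by
    intro Z hZ
    obtain ⟨hZ, hZE⟩ := mem_nonEdges.1 hZ
    simp only [extremalExample, mem_filter, mem_powersetCard, subset_univ, hZ, true_and, not_or,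
      not_exists, not_and] at hZE
    refine ⟨fun v hv => ?_, fun h => hZE.2 h.1 h.2⟩
    rw [hB, mem_filter]
    exact ⟨mem_univ _, not_lt.1 (hZE.1 v hv)⟩
  by_cases hSB : S ⊆ B
  · have h2 := card_filter_subset_subset hSB (k := k) (by omega)
    rw [hS, hBc, hk2] at h2
    rw [← h2]
    split_ifs with hif
    · obtain ⟨heven, rfl⟩ := hif
      let x : Fin n := ⟨a, by omega⟩
      let y : Fin n := ⟨a + 1, by omega⟩
      obtain ⟨Z, hZ, hZB, hZc⟩ := exists_subsuperset_card_eq (s := insert x (insert y S)) (t := B)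
        (n := k) (insert_subset (by simp [hB, x]) (insert_subset (by simp [hB, y]) hSB))
        ((card_insert_le _ _).trans (by have := card_insert_le y S; omega)) (by omega)
      have hZ' : Z ∉ nonEdges (extremalExample k 1 n) := by
        intro hcon
        refine (hsub Z hcon).2 ⟨heven, fun v hv hv' => ?_⟩
        obtain hv | hv : (v : ℕ) = a ∨ (v : ℕ) = a + 1 := by omega
        · have : v = x := Fin.ext hv
          exact hZ (this ▸ mem_insert_self _ _)
        · have : v = y := Fin.ext hv
          exact hZ (this ▸ mem_insert_of_mem (mem_insert_self _ _))
      rw [codegree, ← card_insert_of_notMem (s := filter _ _) (a := Z)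
        (fun h => hZ' (mem_filter.1 h).1)]
      refine card_le_card (insert_subset ?_ fun Z hZ => ?_)
      · exact mem_filter.2 ⟨mem_powersetCard.2 ⟨subset_univ _, hZc⟩,
          (subset_insert _ _).trans ((subset_insert _ _).trans hZ), hZB⟩
      · rw [mem_filter] at hZ
        exact mem_filter.2 ⟨mem_powersetCard.2 ⟨subset_univ _, card_of_mem_nonEdges Z hZ.1⟩,
          hZ.2, (hsub Z hZ.1).1⟩
    · rw [add_zero]
      refine card_le_card fun Z hZ => ?_
      rw [mem_filter] at hZ
      exact mem_filter.2 ⟨mem_powersetCard.2 ⟨subset_univ _, card_of_mem_nonEdges Z hZ.1⟩,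
        hZ.2, (hsub Z hZ.1).1⟩
  · have h2 : codegree (nonEdges (extremalExample k ℓ n)) S = 0 := by
      rw [codegree, card_eq_zero, filter_eq_empty_iff]
      exact fun Z hZ hSZ => hSB (hSZ.trans (hsub Z hZ).1)
    have h3 : 0 < (n - a - (k - 2)).choose 2 := Nat.choose_pos (by omega)
    rw [h2]
    split_ifs <;> omega

/-- The degree condition in terms of the non-edges at a `(k - 2)`-set. -/
lemma codegree_nonEdges_add_le [Fintype V] {H : UniformHypergraph V k} (hk : 3 ≤ k)
    (hn : extremalExampleSize k ℓ (Fintype.card V) + k ≤ Fintype.card V)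
    (hδ : (extremalExample k ℓ (Fintype.card V)).minDegree (k - 2) < H.minDegree (k - 2))
    {S : Finset V} (hS : #S = k - 2) :
    codegree (nonEdges H) S + 1 +
      (if Even (Fintype.card V / (k - ℓ)) ∧ ℓ = 1 then 1 else 0) ≤
        (Fintype.card V - extremalExampleSize k ℓ (Fintype.card V) - (k - 2)).choose 2 := by
  have h1 := le_minDegree_extremalExample hk hn
  have h2 := minDegree_le_degree H hS
  have h3 := degree_add_codegree_nonEdges H (S := S) (by omega)
  rw [hS, show k - (k - 2) = 2 by omega] at h3
  omega

/-- The size of the smaller part, in terms of the number `m` of edges of an `ℓ`-cycle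
on all `n = m (k - ℓ)` vertices. -/
lemma eq_extremalExampleSize {n m a : ℕ} (hℓk : ℓ < k) (hnm : n = m * (k - ℓ)) (hm : 2 ≤ m)
    (ha : (a : ℤ) = ⌈(n : ℝ) / (2 * ((k : ℝ) - ℓ)) - 1⌉) :
    a = extremalExampleSize k ℓ n ∧ n / (k - ℓ) = m ∧
      2 * a + 1 + (if Even m then 1 else 0) = m := by
  have hpos : 0 < k - ℓ := by omega
  have hdiv : n / (k - ℓ) = m := by rw [hnm, Nat.mul_div_cancel _ hpos]
  have hdiv2 : n / (2 * (k - ℓ)) = m / 2 := by rw [mul_comm 2, ← Nat.div_div_eq_div_mul, hdiv]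
  have hreal : (n : ℝ) / (2 * ((k : ℝ) - ℓ)) = m / 2 := by
    have h1 : ((k - ℓ : ℕ) : ℝ) = (k : ℝ) - ℓ := Nat.cast_sub hℓk.le
    have h2 : (0 : ℝ) < (k : ℝ) - ℓ := by rw [← h1]; exact_mod_cast hpos
    rw [hnm, Nat.cast_mul, h1]
    field_simp
  rw [hreal, eq_comm, Int.ceil_eq_iff] at ha
  rw [extremalExampleSize, hdiv, hdiv2]
  have h3 : (m : ℝ) < 2 * a + 4 - 0 ∧ (m : ℝ) ≤ 2 * a + 2 ∧ 2 * (a : ℝ) < m := by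
    obtain ⟨h1, h2⟩ := ha
    push_cast at h1 h2
    refine ⟨?_, ?_, ?_⟩ <;> linarith
  have h4 : m ≤ 2 * a + 2 := by exact_mod_cast h3.2.1
  have h5 : 2 * a < m := by exact_mod_cast h3.2.2
  split_ifs with hm'
  · obtain ⟨c, rfl⟩ := hm'
    omega
  · obtain ⟨c, rfl⟩ := Nat.not_even_iff_odd.1 hm'
    omega

end LoosePath

/-! ### Classification of the vertices -/

namespace LoosePath

variable {V : Type*} [DecidableEq V] [Fintype V] {k ℓ : ℕ}

/-- Markov's inequality for the degrees of the vertices. -/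
lemma card_filter_lt_degree_mul_le {F : Finset (Finset V)} {r : ℕ} (hF : ∀ e ∈ F, #e = r)
    (t : ℝ) : (#{v : V | t < codegree F {v}} : ℝ) * t ≤ 2 ^ r * #F := by
  have h := card_filter_lt_codegree_mul_le hF ((univ : Finset V).image fun v => {v}) ∅ t
  simp only [empty_union, filter_image, codegree_empty] at h
  rwa [card_image_of_injective _ singleton_injective] at h

lemma card_filter_singleton_le {F : Finset (Finset V)} (hF : ∀ e ∈ F, #e = k) (hk : 2 ≤ k) (v : V)
    {W : Finset V} {η : ℝ} (hW : (#W : ℝ) ≤ η * Fintype.card V) :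
    (#{e ∈ F | {v} ⊆ e ∧ ¬ Disjoint (e \ {v}) W} : ℝ) ≤ η * (Fintype.card V : ℝ) ^ (k - 1) := by
  have h := card_filter_not_disjoint_le hF {v} W
  rw [card_singleton] at h
  calc (#{e ∈ F | {v} ⊆ e ∧ ¬ Disjoint (e \ {v}) W} : ℝ)
      ≤ #W * (Fintype.card V : ℝ) ^ (k - 1 - 1) := by exact_mod_cast h
    _ ≤ η * Fintype.card V * (Fintype.card V : ℝ) ^ (k - 1 - 1) := by gcongr
    _ = η * (Fintype.card V : ℝ) ^ (k - 1) := by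
      rw [mul_assoc, ← pow_succ', Nat.sub_add_cancel (by omega)]

lemma card_filter_subset_union_le {F : Finset (Finset V)} (hF : ∀ e ∈ F, #e = k) (hk : 2 ≤ k)
    (v : V) {B B' : Finset V} {η : ℝ} (hB : (#(B \ B') : ℝ) ≤ η * Fintype.card V) :
    (#{Z ∈ F | {v} ⊆ Z ∧ Z ⊆ {v} ∪ B} : ℝ) ≤
      #{Z ∈ F | {v} ⊆ Z ∧ Z ⊆ {v} ∪ B'} + η * (Fintype.card V : ℝ) ^ (k - 1) := by
  have h1 : ({Z ∈ F | {v} ⊆ Z ∧ Z ⊆ {v} ∪ B} : Finset (Finset V)) ⊆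
      {Z ∈ F | {v} ⊆ Z ∧ Z ⊆ {v} ∪ B'} ∪
      {Z ∈ F | {v} ⊆ Z ∧ ¬ Disjoint (Z \ {v}) (B \ B')} := by
    intro Z hZ
    obtain ⟨hZ, hvZ, hZB⟩ := mem_filter.1 hZ
    by_cases hZB' : Z ⊆ {v} ∪ B'
    · exact mem_union_left _ (mem_filter.2 ⟨hZ, hvZ, hZB'⟩)
    · refine mem_union_right _ (mem_filter.2 ⟨hZ, hvZ, ?_⟩)
      obtain ⟨w, hw, hwB⟩ := not_subset.1 hZB'
      rw [mem_union, not_or] at hwB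
      rw [not_disjoint_iff]
      exact ⟨w, mem_sdiff.2 ⟨hw, hwB.1⟩, mem_sdiff.2
        ⟨(mem_union.1 (hZB hw)).resolve_left hwB.1, hwB.2⟩⟩
  have h2 : (#{Z ∈ F | {v} ⊆ Z ∧ Z ⊆ {v} ∪ B} : ℝ) ≤ #{Z ∈ F | {v} ⊆ Z ∧ Z ⊆ {v} ∪ B'} +
      #{Z ∈ F | {v} ⊆ Z ∧ ¬ Disjoint (Z \ {v}) (B \ B')} := by
    exact_mod_cast (card_le_card h1).trans (card_union_le _ _)
  linarith [card_filter_singleton_le hF hk v hB]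

/-- By the degree condition, a `(k - 2)`-set `S ⊆ U ∪ B` lies in at most as many non-edges that
leave `U ∪ B` as edges inside `U ∪ B`. As every non-edge with exactly one vertex outside `U ∪ B`
contains such a set, there are few of them if there are few edges inside `U ∪ B`. -/
lemma card_nonEdges_le {H : UniformHypergraph V k} {B : Finset V} (hk : 3 ≤ k)
    (hδ : ∀ S : Finset V, #S = k - 2 → codegree (nonEdges H) S ≤ (#B - (k - 2)).choose 2)
    {U : Finset V} (hU : #U ≤ 1) :
    #{Z ∈ nonEdges H | U ⊆ Z ∧ #(Z \ (U ∪ B)) = 1} ≤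
      2 ^ k * #{Z ∈ H.edges | U ⊆ Z ∧ Z ⊆ U ∪ B} := by
  set F : Finset (Finset V) := {Z ∈ H.edges | U ⊆ Z ∧ Z ⊆ U ∪ B} with hF
  set 𝒮 : Finset (Finset V) := {S ∈ powersetCard (k - 2) univ | U ⊆ S ∧ S ⊆ U ∪ B} with h𝒮
  have hsub : ({Z ∈ nonEdges H | U ⊆ Z ∧ #(Z \ (U ∪ B)) = 1} : Finset (Finset V)) ⊆
      𝒮.biUnion fun S => {Z ∈ nonEdges H | S ⊆ Z ∧ ¬ Z ⊆ U ∪ B} := by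
    intro Z hZ
    obtain ⟨hZ, hUZ, hZc⟩ := mem_filter.1 hZ
    have hZk := card_of_mem_nonEdges Z hZ
    obtain ⟨S, hUS, hS, hSc⟩ := exists_subsuperset_card_eq (s := U) (t := Z ∩ (U ∪ B)) (n := k - 2)
      (subset_inter hUZ subset_union_left) (by omega) (by
        have := card_inter_add_card_sdiff Z (U ∪ B)
        omega)
    rw [mem_biUnion]
    refine ⟨S, mem_filter.2 ⟨mem_powersetCard.2 ⟨subset_univ _, hSc⟩, hUS,
      hS.trans inter_subset_right⟩, mem_filter.2 ⟨hZ, hS.trans inter_subset_left, fun h => ?_⟩⟩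
    rw [sdiff_eq_empty_iff_subset.2 h, card_empty] at hZc
    omega
  have hS : ∀ S ∈ 𝒮, #{Z ∈ nonEdges H | S ⊆ Z ∧ ¬ Z ⊆ U ∪ B} ≤ codegree F (∅ ∪ S) := by
    intro S hS
    obtain ⟨hS, hUS, hSB⟩ := mem_filter.1 hS
    have hSc := (mem_powersetCard.1 hS).2
    have h1 := card_edges_add_card_nonEdges H hSB (by omega)
    rw [hSc, show k - (k - 2) = 2 by omega] at h1
    have h2 : (#B - (k - 2)).choose 2 ≤ (#(U ∪ B) - (k - 2)).choose 2 :=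
      Nat.choose_le_choose _ (Nat.sub_le_sub_right (card_le_card subset_union_right) _)
    have h3 := card_filter_add_card_filter_not (s := ({Z ∈ nonEdges H | S ⊆ Z} : Finset _))
      (fun Z => Z ⊆ U ∪ B)
    rw [filter_filter, filter_filter] at h3
    have h4 := hδ S hSc
    rw [codegree] at h4
    have h5 : codegree F (∅ ∪ S) = #{Z ∈ H.edges | S ⊆ Z ∧ Z ⊆ U ∪ B} := by
      rw [empty_union, codegree, hF, filter_filter]
      congr 1
      ext Z
      simp only [mem_filter]
      constructor
      · rintro ⟨h, ⟨-, h'⟩, h''⟩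
        exact ⟨h, h'', h'⟩
      · rintro ⟨h, h', h''⟩
        exact ⟨h, ⟨hUS.trans h', h''⟩, h'⟩
    omega
  calc _ ≤ _ := card_le_card hsub
    _ ≤ ∑ S ∈ 𝒮, #{Z ∈ nonEdges H | S ⊆ Z ∧ ¬ Z ⊆ U ∪ B} := card_biUnion_le
    _ ≤ ∑ S ∈ 𝒮, codegree F (∅ ∪ S) := sum_le_sum hS
    _ ≤ 2 ^ k * codegree F ∅ := sum_codegree_le (fun Z hZ =>
        H.card_of_mem_edges Z (mem_filter.1 hZ).1) _ _
    _ = 2 ^ k * #F := by rw [codegree_empty]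

lemma codegree_missing_le_of_mem_left {H : UniformHypergraph V k} {A' B' B : Finset V} {η : ℝ}
    (hk : 2 ≤ k) (hB2 : (#(B' \ B) : ℝ) ≤ η * Fintype.card V) {v : V} (hv : v ∈ A') :
    (codegree (missing H A' B') {v} : ℝ) ≤
      #{Z ∈ nonEdges H | {v} ⊆ Z ∧ Z ⊆ {v} ∪ B} + η * (Fintype.card V : ℝ) ^ (k - 1) := by
  have h1 : ({Z ∈ missing H A' B' | {v} ⊆ Z} : Finset (Finset V)) ⊆
      {Z ∈ nonEdges H | {v} ⊆ Z ∧ Z ⊆ {v} ∪ B} ∪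
      {Z ∈ missing H A' B' | {v} ⊆ Z ∧ ¬ Disjoint (Z \ {v}) (B' \ B)} := by
    intro Z hZ
    obtain ⟨hZ, hvZ⟩ := mem_filter.1 hZ
    obtain ⟨hZc, hZE⟩ := mem_missing.1 hZ
    obtain ⟨hZk, hZA, hZAB⟩ := mem_crossing.1 hZc
    by_cases hZB : Z ⊆ {v} ∪ B
    · exact mem_union_left _ (mem_filter.2 ⟨mem_nonEdges.2 ⟨hZk, hZE⟩, hvZ, hZB⟩)
    · refine mem_union_right _ (mem_filter.2 ⟨hZ, hvZ, ?_⟩)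
      obtain ⟨w, hw, hwB⟩ := not_subset.1 hZB
      rw [mem_union, not_or, mem_singleton] at hwB
      rw [not_disjoint_iff]
      refine ⟨w, mem_sdiff.2 ⟨hw, by simpa using hwB.1⟩, mem_sdiff.2 ⟨?_, hwB.2⟩⟩
      refine (mem_union.1 (hZAB hw)).resolve_left fun hwA => hwB.1 ?_
      exact card_le_one.1 hZA.le w (mem_inter.2 ⟨hw, hwA⟩) v
        (mem_inter.2 ⟨singleton_subset_iff.1 hvZ, hv⟩)
  have h2 := card_filter_singleton_le (card_of_mem_missing (H := H) (A := A') (B := B')) hk v hB2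
  have h4 := (Nat.cast_le (α := ℝ).2 (card_le_card h1)).trans (Nat.cast_le.2 (card_union_le _ _))
  rw [Nat.cast_add] at h4
  exact h4.trans (add_le_add_right h2 _)

lemma codegree_missing_le_of_mem_right {H : UniformHypergraph V k} {A' B' B : Finset V} {η : ℝ}
    (hk : 2 ≤ k) (hAB : Disjoint A' B') (hB2 : (#(B' \ B) : ℝ) ≤ η * Fintype.card V)
    (hA2 : (#(A' ∩ B) : ℝ) ≤ η * Fintype.card V) {v : V} (hv : v ∈ B') :
    (codegree (missing H A' B') {v} : ℝ) ≤
      #{Z ∈ nonEdges H | {v} ⊆ Z ∧ #(Z \ ({v} ∪ B)) = 1} +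
        2 * η * (Fintype.card V : ℝ) ^ (k - 1) := by
  have h1 : ({Z ∈ missing H A' B' | {v} ⊆ Z} : Finset (Finset V)) ⊆
      {Z ∈ nonEdges H | {v} ⊆ Z ∧ #(Z \ ({v} ∪ B)) = 1} ∪
      ({Z ∈ missing H A' B' | {v} ⊆ Z ∧ ¬ Disjoint (Z \ {v}) (B' \ B)} ∪
      {Z ∈ missing H A' B' | {v} ⊆ Z ∧ ¬ Disjoint (Z \ {v}) (A' ∩ B)}) := by
    intro Z hZ
    obtain ⟨hZ, hvZ⟩ := mem_filter.1 hZ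
    obtain ⟨hZc, hZE⟩ := mem_missing.1 hZ
    obtain ⟨hZk, hZA, hZAB⟩ := mem_crossing.1 hZc
    by_cases h1 : Disjoint (Z \ {v}) (B' \ B)
    swap
    · exact mem_union_right _ (mem_union_left _ (mem_filter.2 ⟨hZ, hvZ, h1⟩))
    by_cases h2 : Disjoint (Z \ {v}) (A' ∩ B)
    swap
    · exact mem_union_right _ (mem_union_right _ (mem_filter.2 ⟨hZ, hvZ, h2⟩))
    refine mem_union_left _ (mem_filter.2 ⟨mem_nonEdges.2 ⟨hZk, hZE⟩, hvZ, ?_⟩)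
    rw [← hZA]
    congr 1
    ext w
    rw [disjoint_left] at h1 h2
    have h3 := @h1 w
    have h4 := @h2 w
    have h5 := @hZAB w
    have h6 : w = v → w ∉ A' := fun h => h ▸ disjoint_right.1 hAB hv
    simp only [mem_sdiff, mem_union, mem_inter, mem_singleton] at h3 h4 h5 ⊢
    tauto
  have h2 := card_filter_singleton_le (card_of_mem_missing (H := H) (A := A') (B := B')) hk v hB2
  have h3 := card_filter_singleton_le (card_of_mem_missing (H := H) (A := A') (B := B')) hk v hA2
  have h4 := ((card_le_card h1).trans (card_union_le _ _)).trans
    (Nat.add_le_add_left (card_union_le _ _) _)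
  have h5 : (codegree (missing H A' B') {v} : ℝ) ≤ _ := Nat.cast_le.2 h4
  push_cast at h5
  linarith

/-- The vertices can be classified according to their degree into `B`: the vertices of `A'` make
edges with nearly all `(k - 1)`-subsets of `B`, those of `B'` with only few of them.
Only few vertices are on the wrong side or remain unclassified, nearly all crossing `k`-sets
at a classified vertex are edges, and the remaining vertices make edges with many
`(k - 1)`-subsets of `B'`. -/
lemma exists_classification {H : UniformHypergraph V k} {B : Finset V} (hk : 3 ≤ k)
    (hδ : ∀ S : Finset V, #S = k - 2 → codegree (nonEdges H) S ≤ (#B - (k - 2)).choose 2)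
    {ε η : ℝ} (hε : 0 < ε) (hn : 0 < Fintype.card V)
    (hB : (H.edgesWithin B : ℝ) * 4 ^ k ≤ ε * η * (Fintype.card V : ℝ) ^ k)
    (hεB : 2 * ε * (Fintype.card V : ℝ) ^ (k - 1) < ((#B - 1).choose (k - 1) : ℕ)) :
    ∃ A' B' : Finset V, Disjoint A' B' ∧
      (#((univ \ B) \ A') : ℝ) ≤ η * Fintype.card V ∧ (#(B \ B') : ℝ) ≤ η * Fintype.card V ∧
      (∀ v ∈ A' ∪ B', (codegree (missing H A' B') {v} : ℝ) ≤
        (2 ^ k * ε + 2 * η) * (Fintype.card V : ℝ) ^ (k - 1)) ∧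
      (∀ v ∉ A' ∪ B', (ε - η) * (Fintype.card V : ℝ) ^ (k - 1) ≤
        #{Z ∈ H.edges | {v} ⊆ Z ∧ Z ⊆ {v} ∪ B'}) ∧
      (∀ v ∈ B', (#{Z ∈ H.edges | {v} ⊆ Z ∧ Z ⊆ B'} : ℝ) ≤
        (ε + η) * (Fintype.card V : ℝ) ^ (k - 1)) := by
  set n : ℝ := (Fintype.card V : ℝ) with hn_def
  have hn' : 0 < n := by rw [hn_def]; exact_mod_cast hn
  set A' : Finset V := {v | (#{Z ∈ nonEdges H | {v} ⊆ Z ∧ Z ⊆ {v} ∪ B} : ℝ) ≤ ε * n ^ (k - 1)}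
    with hA'
  set B' : Finset V := {v | v ∉ A' ∧ (#{Z ∈ H.edges | {v} ⊆ Z ∧ Z ⊆ {v} ∪ B} : ℝ) ≤
    ε * n ^ (k - 1)} with hB'
  have hAB : Disjoint A' B' := disjoint_left.2 fun v hv hv' => (mem_filter.1 hv').2.1 hv
  have hnk : n ^ k = n * n ^ (k - 1) := by rw [← pow_succ', Nat.sub_add_cancel (by omega)]
  have h24 : (2 : ℝ) ^ k * 2 ^ k = 4 ^ k := by rw [← mul_pow]; norm_num
  have hE : ∀ Z ∈ H.edges, #Z = k := H.card_of_mem_edges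
  -- Few vertices outside `B` are not in `A'`.
  have hA1 : (#((univ \ B) \ A') : ℝ) ≤ η * n := by
    set G : Finset (Finset V) := {Z ∈ nonEdges H | ∅ ⊆ Z ∧ #(Z \ (∅ ∪ B)) = 1} with hG
    have h1 : #G ≤ 2 ^ k * H.edgesWithin B := by
      have := card_nonEdges_le hk hδ (U := ∅) (by simp)
      simpa [hG, UniformHypergraph.edgesWithin] using this
    have h2 := card_filter_lt_degree_mul_le (F := G) (r := k)
      (fun Z hZ => card_of_mem_nonEdges Z (mem_filter.1 hZ).1) (ε * n ^ (k - 1))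
    have h3 : (univ \ B) \ A' ⊆ ({v : V | ε * n ^ (k - 1) < codegree G {v}} : Finset V) := by
      intro v hv
      simp only [mem_sdiff, mem_univ, true_and] at hv
      rw [mem_filter]
      refine ⟨mem_univ _, ?_⟩
      have h4 : ε * n ^ (k - 1) < #{Z ∈ nonEdges H | {v} ⊆ Z ∧ Z ⊆ {v} ∪ B} := by
        rw [← not_le]
        exact fun h => hv.2 (mem_filter.2 ⟨mem_univ _, h⟩)
      refine h4.trans_le (Nat.cast_le.2 (card_le_card fun Z hZ => ?_))
      obtain ⟨hZ, hvZ, hZB⟩ := mem_filter.1 hZ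
      refine mem_filter.2 ⟨mem_filter.2 ⟨hZ, empty_subset _, ?_⟩, hvZ⟩
      rw [empty_union, card_eq_one]
      refine ⟨v, subset_antisymm (fun w hw => ?_) (singleton_subset_iff.2
        (mem_sdiff.2 ⟨singleton_subset_iff.1 hvZ, hv.1⟩))⟩
      rw [mem_sdiff] at hw
      exact (mem_union.1 (hZB hw.1)).resolve_right hw.2
    have h4 : (#((univ \ B) \ A') : ℝ) ≤ #{v : V | ε * n ^ (k - 1) < codegree G {v}} :=
      Nat.cast_le.2 (card_le_card h3)
    have h5 : (#G : ℝ) ≤ 2 ^ k * H.edgesWithin B := by exact_mod_cast h1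
    have h6 : (#((univ \ B) \ A') : ℝ) * (ε * n ^ (k - 1)) ≤ η * n * (ε * n ^ (k - 1)) := by
      calc (#((univ \ B) \ A') : ℝ) * (ε * n ^ (k - 1))
          ≤ #{v : V | ε * n ^ (k - 1) < codegree G {v}} * (ε * n ^ (k - 1)) := by gcongr
        _ ≤ 2 ^ k * #G := h2
        _ ≤ 2 ^ k * (2 ^ k * H.edgesWithin B) := by gcongr
        _ = H.edgesWithin B * 4 ^ k := by rw [← mul_assoc, h24, mul_comm]
        _ ≤ ε * η * n ^ k := hB
        _ = η * n * (ε * n ^ (k - 1)) := by rw [hnk]; ring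
    exact le_of_mul_le_mul_right h6 (by positivity)
  -- Few vertices of `B` are not in `B'`.
  have hB1 : (#(B \ B') : ℝ) ≤ η * n := by
    set G : Finset (Finset V) := {Z ∈ H.edges | Z ⊆ B} with hG
    have h2 := card_filter_lt_degree_mul_le (F := G) (r := k)
      (fun Z hZ => hE Z (mem_filter.1 hZ).1) (ε * n ^ (k - 1))
    have h3 : B \ B' ⊆ ({v : V | ε * n ^ (k - 1) < codegree G {v}} : Finset V) := by
      intro v hv
      rw [mem_sdiff] at hv
      have hvB : {v} ∪ B = B := union_eq_right.2 (singleton_subset_iff.2 hv.1)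
      have h4 : codegree G {v} = #{Z ∈ H.edges | {v} ⊆ Z ∧ Z ⊆ {v} ∪ B} := by
        rw [codegree, hG, filter_filter, hvB]
        congr 1
        ext Z
        simp only [mem_filter]
        tauto
      refine mem_filter.2 ⟨mem_univ _, ?_⟩
      by_contra hcon
      rw [h4, not_lt] at hcon
      have hvA : v ∈ A' := by
        by_contra hvA
        exact hv.2 (mem_filter.2 ⟨mem_univ _, hvA, hcon⟩)
      have h5 := card_edges_add_card_nonEdges H (S := {v}) (T := {v} ∪ B) subset_union_left
        (by rw [card_singleton]; omega)
      have h6 := (mem_filter.1 hvA).2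
      rw [hvB, card_singleton] at h5
      rw [hvB] at h6 hcon
      rw [← h5, Nat.cast_add] at hεB
      linarith
    have h4 : (#(B \ B') : ℝ) ≤ #{v : V | ε * n ^ (k - 1) < codegree G {v}} :=
      Nat.cast_le.2 (card_le_card h3)
    have h6 : (#(B \ B') : ℝ) * (ε * n ^ (k - 1)) ≤ η * n * (ε * n ^ (k - 1)) := by
      calc (#(B \ B') : ℝ) * (ε * n ^ (k - 1))
          ≤ #{v : V | ε * n ^ (k - 1) < codegree G {v}} * (ε * n ^ (k - 1)) := by gcongr
        _ ≤ 2 ^ k * #G := h2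
        _ ≤ 4 ^ k * #G := by gcongr; norm_num
        _ = H.edgesWithin B * 4 ^ k := by rw [mul_comm]; rfl
        _ ≤ ε * η * n ^ k := hB
        _ = η * n * (ε * n ^ (k - 1)) := by rw [hnk]; ring
    exact le_of_mul_le_mul_right h6 (by positivity)
  have hB2 : (#(B' \ B) : ℝ) ≤ η * n := by
    refine le_trans (Nat.cast_le.2 (card_le_card fun v hv => ?_)) hA1
    rw [mem_sdiff] at hv
    exact mem_sdiff.2 ⟨mem_sdiff.2 ⟨mem_univ _, hv.2⟩, disjoint_right.1 hAB hv.1⟩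
  have hA2 : (#(A' ∩ B) : ℝ) ≤ η * n := by
    refine le_trans (Nat.cast_le.2 (card_le_card fun v hv => ?_)) hB1
    rw [mem_inter] at hv
    exact mem_sdiff.2 ⟨hv.2, disjoint_left.1 hAB hv.1⟩
  have hη : 0 ≤ η := by
    have : 0 ≤ η * n := (Nat.cast_nonneg _).trans hA1
    exact nonneg_of_mul_nonneg_left this hn'
  refine ⟨A', B', hAB, hA1, hB1, fun v hv => ?_, fun v hv => ?_, fun v hv => ?_⟩
  · have h1 : (1 : ℝ) ≤ 2 ^ k := one_le_pow₀ (by norm_num)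
    have h2 : 0 < ε * n ^ (k - 1) := by positivity
    have h3 : 0 ≤ η * n ^ (k - 1) := by positivity
    obtain hv | hv := mem_union.1 hv
    · have h4 := codegree_missing_le_of_mem_left (H := H) (by omega) hB2 hv
      have h5 := (mem_filter.1 hv).2
      nlinarith
    · have h4 := codegree_missing_le_of_mem_right (H := H) (by omega) hAB hB2 hA2 hv
      have h5 : (#{Z ∈ nonEdges H | {v} ⊆ Z ∧ #(Z \ ({v} ∪ B)) = 1} : ℝ) ≤
          2 ^ k * #{Z ∈ H.edges | {v} ⊆ Z ∧ Z ⊆ {v} ∪ B} := by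
        exact_mod_cast card_nonEdges_le hk hδ (U := {v}) (by simp)
      have h6 : (2 : ℝ) ^ k * #{Z ∈ H.edges | {v} ⊆ Z ∧ Z ⊆ {v} ∪ B} ≤
          2 ^ k * (ε * n ^ (k - 1)) := by
        gcongr
        exact (mem_filter.1 hv).2.2
      linarith
  · rw [mem_union, not_or] at hv
    have h2 := card_filter_subset_union_le hE (by omega) v hB1
    have h3 : ε * n ^ (k - 1) < #{Z ∈ H.edges | {v} ⊆ Z ∧ Z ⊆ {v} ∪ B} := by
      by_contra hcon
      exact hv.2 (mem_filter.2 ⟨mem_univ _, hv.1, not_lt.1 hcon⟩)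
    linarith
  · have h2 := card_filter_subset_union_le hE (by omega) v hB2
    have h3 := (mem_filter.1 hv).2.2
    rw [union_eq_right.2 (singleton_subset_iff.2 hv)] at h2
    linarith

end LoosePath

/-! ### The parts of the classification form a reservoir -/

namespace LoosePath

variable {V : Type*} [DecidableEq V] [Fintype V] {k ℓ : ℕ}

/-- A lower bound for the density of the `r`-subsets, `r ≤ k`, of a set that contains at least
the proportion `1 / (4k)` of all vertices. -/
noncomputable def subsetDensity (k : ℕ) : ℝ := (1 / (8 * (k : ℝ) ^ 2)) ^ (k + 1)

/-- The density parameter with which the classified vertices form a reservoir. -/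
noncomputable def reservoirDensity (k : ℕ) : ℝ := subsetDensity k / (2 ^ k * (32 * k))

lemma subsetDensity_pos (hk : 1 ≤ k) : 0 < subsetDensity k := by
  have : (0 : ℝ) < k := by exact_mod_cast hk
  unfold subsetDensity
  positivity

lemma reservoirDensity_pos (hk : 1 ≤ k) : 0 < reservoirDensity k := by
  have : (0 : ℝ) < k := by exact_mod_cast hk
  have := subsetDensity_pos hk
  unfold reservoirDensity
  positivity

lemma subsetDensity_le (hk : 1 ≤ k) : subsetDensity k ≤ 1 := by
  have : (1 : ℝ) ≤ k := by exact_mod_cast hk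
  refine pow_le_one₀ (by positivity) ?_
  rw [div_le_one (by positivity)]
  nlinarith

lemma reservoirDensity_mul (hk : 1 ≤ k) :
    reservoirDensity k * (2 ^ k * (32 * k)) = subsetDensity k := by
  have : (0 : ℝ) < k := by exact_mod_cast hk
  unfold reservoirDensity
  field_simp

lemma reservoirDensity_le (hk : 1 ≤ k) : reservoirDensity k ≤ subsetDensity k := by
  have h0 := reservoirDensity_pos hk
  have h1 : (1 : ℝ) ≤ k := by exact_mod_cast hk
  have h2 : (1 : ℝ) ≤ 2 ^ k := one_le_pow₀ (by norm_num)
  have h3 : (1 : ℝ) ≤ 2 ^ k * (32 * k) := by nlinarith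
  rw [← reservoirDensity_mul hk]
  exact le_mul_of_one_le_right h0.le h3

lemma le_choose_of_le_mul {r u n : ℕ} (hk : 1 ≤ k) (hr : r ≤ k) (hu : n ≤ 4 * k * u)
    (hn : 8 * k ^ 2 ≤ n) :
    (1 / (8 * (k : ℝ) ^ 2)) ^ k * (n : ℝ) ^ r ≤ (u.choose r : ℕ) := by
  have hk0 : (0 : ℝ) < k := by exact_mod_cast hk
  have hu2 : 2 * k ≤ u := by
    have h1 : 4 * k * (2 * k) ≤ 4 * k * u := by nlinarith
    exact Nat.le_of_mul_le_mul_left h1 (by omega)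
  have h1 : (n : ℝ) / (8 * k) ≤ ((u + 1 - r : ℕ) : ℝ) := by
    have h2 : u ≤ 2 * (u + 1 - r) := by omega
    have h3 : (u : ℝ) ≤ 2 * ((u + 1 - r : ℕ) : ℝ) := by exact_mod_cast h2
    have h4 : (n : ℝ) ≤ 4 * k * u := by exact_mod_cast hu
    rw [div_le_iff₀ (by positivity)]
    nlinarith
  have h2 : ((r.factorial : ℕ) : ℝ) ≤ (k : ℝ) ^ r := by
    have h3 : r.factorial ≤ k ^ r := (Nat.factorial_le_pow r).trans (Nat.pow_le_pow_left hr r)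
    exact_mod_cast h3
  have h3 : (1 / (8 * (k : ℝ) ^ 2)) ^ k ≤ (1 / (8 * (k : ℝ) ^ 2)) ^ r := by
    refine pow_le_pow_of_le_one (by positivity) ?_ hr
    have : (1 : ℝ) ≤ k := by exact_mod_cast hk
    rw [div_le_one (by positivity)]
    nlinarith
  calc (1 / (8 * (k : ℝ) ^ 2)) ^ k * (n : ℝ) ^ r
      ≤ (1 / (8 * (k : ℝ) ^ 2)) ^ r * (n : ℝ) ^ r := by gcongr
    _ = ((n : ℝ) / (8 * k)) ^ r / (k : ℝ) ^ r := by
      rw [← mul_pow, ← div_pow]; congr 1; field_simp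
    _ ≤ ((u + 1 - r : ℕ) : ℝ) ^ r / ((r.factorial : ℕ) : ℝ) := by
      gcongr
    _ ≤ (u.choose r : ℕ) := Nat.pow_le_choose r u

lemma subsetDensity_mul_le_choose {r u n : ℕ} (hk : 1 ≤ k) (hr : r ≤ k) (hu : n ≤ 4 * k * u)
    (hn : 8 * k ^ 2 ≤ n) : subsetDensity k * (n : ℝ) ^ r ≤ (u.choose r : ℕ) := by
  refine le_trans ?_ (le_choose_of_le_mul hk hr hu hn)
  have h1 : (1 : ℝ) ≤ k := by exact_mod_cast hk
  unfold subsetDensity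
  gcongr ?_ * _
  refine pow_le_pow_of_le_one (by positivity) ?_ (Nat.le_succ k)
  rw [div_le_one (by positivity)]
  nlinarith

lemma subsetDensity_mul_le_mul_choose {r u w n : ℕ} (hk : 1 ≤ k) (hr : r + 1 ≤ k)
    (hu : n ≤ 4 * k * u) (hw : n ≤ 4 * k * w) (hn : 8 * k ^ 2 ≤ n) :
    subsetDensity k * (n : ℝ) ^ (r + 1) ≤ w * (u.choose r : ℕ) := by
  have h1 : (1 : ℝ) ≤ k := by exact_mod_cast hk
  have h2 := le_choose_of_le_mul hk (by omega : r ≤ k) hu hn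
  have h3 : 1 / (8 * (k : ℝ) ^ 2) * n ≤ w := by
    have h4 : (n : ℝ) ≤ 4 * k * w := by exact_mod_cast hw
    rw [one_div_mul_eq_div, div_le_iff₀ (by positivity)]
    have h5 : (0 : ℝ) ≤ w * k := by positivity
    nlinarith
  calc subsetDensity k * (n : ℝ) ^ (r + 1)
      = 1 / (8 * (k : ℝ) ^ 2) * n * ((1 / (8 * (k : ℝ) ^ 2)) ^ k * (n : ℝ) ^ r) := by
        unfold subsetDensity; ring
    _ ≤ w * (u.choose r : ℕ) := by gcongr

lemma mul_choose_le_card_crossing {A B : Finset V} (hAB : Disjoint A B) (r : ℕ) :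
    #A * (#B).choose r ≤ #(crossing A B (r + 1)) := by
  rw [← card_powersetCard, ← card_product]
  refine card_le_card_of_injOn (fun p => {p.1} ∪ p.2) (fun p hp => ?_) fun p hp q hq hpq => ?_
  · rw [mem_coe, mem_product, mem_powersetCard] at hp
    have hd : Disjoint {p.1} p.2 := by
      rw [disjoint_singleton_left]
      exact fun h => disjoint_left.1 hAB hp.1 (hp.2.1 h)
    have h1 : {p.1} ∈ crossing A B 1 := by
      rw [mem_crossing, card_singleton, singleton_inter_of_mem hp.1, card_singleton]
      exact ⟨rfl, rfl, singleton_subset_iff.2 (mem_union_left _ hp.1)⟩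
    exact union_mem_crossing hAB h1 hp.2.1 hp.2.2 hd (add_comm _ _)
  · rw [mem_coe, mem_product, mem_powersetCard] at hp hq
    have key : ∀ p : V × Finset V, p.1 ∈ A → p.2 ⊆ B →
        ({p.1} ∪ p.2) ∩ A = {p.1} ∧ ({p.1} ∪ p.2) ∩ B = p.2 := by
      intro p hpA hpB
      have h1 := disjoint_left.1 hAB hpA
      have h2 : p.2 ∩ A = ∅ :=
        disjoint_iff_inter_eq_empty.1 (disjoint_of_subset_left hpB hAB.symm)
      rw [union_inter_distrib_right, union_inter_distrib_right, singleton_inter_of_mem hpA,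
        singleton_inter_of_notMem h1, h2, inter_eq_left.2 hpB, union_empty, empty_union]
      exact ⟨rfl, rfl⟩
    obtain ⟨h1, h2⟩ := key p hp.1 hp.2.1
    obtain ⟨h3, h4⟩ := key q hq.1 hq.2.1
    have hpq : {p.1} ∪ p.2 = {q.1} ∪ q.2 := hpq
    rw [hpq] at h1 h2
    exact Prod.ext (singleton_injective (h1.symm.trans h3)) (h2.symm.trans h4)

lemma card_mul_card_sdiff_le {A B S : Finset V} {r : ℕ} (hAB : Disjoint A B) (hS : S ⊆ B)
    (hSc : #S + 2 = r) : #A * #(B \ S) ≤ #{Z ∈ crossing A B r | S ⊆ Z} := by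
  rw [← card_product]
  refine card_le_card_of_injOn (fun p => {p.1} ∪ ({p.2} ∪ S)) (fun p hp => ?_)
    fun p hp q hq hpq => ?_
  · rw [mem_coe, mem_product, mem_sdiff] at hp
    obtain ⟨hpA, hpB, hpS⟩ := hp
    have h1 : {p.1} ∈ crossing A B 1 := by
      rw [mem_crossing, card_singleton, singleton_inter_of_mem hpA, card_singleton]
      exact ⟨rfl, rfl, singleton_subset_iff.2 (mem_union_left _ hpA)⟩
    have h2 : {p.2} ∪ S ⊆ B := union_subset (singleton_subset_iff.2 hpB) hS
    refine mem_filter.2 ⟨union_mem_crossing hAB h1 h2 rfl ?_ ?_,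
      subset_union_right.trans subset_union_right⟩
    · rw [disjoint_singleton_left]
      exact fun h => disjoint_left.1 hAB hpA (h2 h)
    · rw [card_union_of_disjoint (disjoint_singleton_left.2 hpS), card_singleton]
      omega
  · rw [mem_coe, mem_product, mem_sdiff] at hp hq
    have hpq : {p.1} ∪ ({p.2} ∪ S) = {q.1} ∪ ({q.2} ∪ S) := hpq
    have h1 : p.1 ∈ {q.1} ∪ ({q.2} ∪ S) := hpq ▸ mem_union_left _ (mem_singleton_self _)
    have h2 : p.2 ∈ {q.1} ∪ ({q.2} ∪ S) :=
      hpq ▸ mem_union_right _ (mem_union_left _ (mem_singleton_self _))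
    simp only [mem_union, mem_singleton] at h1 h2
    have h3 : p.1 ∉ B := disjoint_left.1 hAB hp.1
    have h4 : q.1 ∉ B := disjoint_left.1 hAB hq.1
    refine Prod.ext ?_ ?_
    · obtain h1 | h1 | h1 := h1
      · exact h1
      · exact absurd (h1 ▸ hq.2.1) h3
      · exact absurd (hS h1) h3
    · obtain h2 | h2 | h2 := h2
      · exact absurd (h2 ▸ hp.2.1) h4
      · exact h2
      · exact absurd h2 hp.2.2

lemma choose_two_add_le (x d : ℕ) : (x + d).choose 2 ≤ x.choose 2 + d * (x + d) := by
  induction d with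
  | zero => simp
  | succ d ih =>
    have h : (x + d + 1).choose 2 = (x + d) + (x + d).choose 2 := by
      rw [Nat.choose_succ_succ' (x + d) 1, Nat.choose_one_right]
    rw [← add_assoc, h]
    nlinarith

/-- Every `(k - 2)`-subset of `B` lies in many edges with at most one vertex in `A`. -/
lemma card_edges_le_one_of_card_eq {H : UniformHypergraph V k} {A B S : Finset V} {b : ℕ}
    (hk : 3 ≤ k) (hAB : Disjoint A B) (hS : S ⊆ B) (hSc : #S = k - 2)
    (hδ : codegree (nonEdges H) S ≤ (b - (k - 2)).choose 2) (hbn : b ≤ Fintype.card V)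
    (hb : (b : ℝ) ≤ #B + Fintype.card V / (32 * k))
    (hA : Fintype.card V ≤ 4 * k * #A) (hB : Fintype.card V ≤ 2 * #B)
    (hn : 16 * k ^ 2 ≤ Fintype.card V) :
    (Fintype.card V : ℝ) ^ 2 / (32 * k) ≤
      codegree {Z ∈ H.edges | Z ⊆ A ∪ B ∧ #(Z ∩ A) ≤ 1} S := by
  have hk0 : (0 : ℝ) < k := by exact_mod_cast (by omega : 0 < k)
  set n := Fintype.card V with hn_def
  have hSle := card_le_card hS
  have h1 : #{Z ∈ powersetCard k (univ : Finset V) | S ⊆ Z ∧ Z ⊆ B} = (#B - (k - 2)).choose 2 := by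
    rw [card_filter_subset_subset hS (by omega), hSc, show k - (k - 2) = 2 by omega]
  have h2 := card_mul_card_sdiff_le (r := k) hAB hS (by omega)
  rw [card_sdiff_of_subset hS, hSc] at h2
  have hd : Disjoint ({Z ∈ powersetCard k (univ : Finset V) | S ⊆ Z ∧ Z ⊆ B} : Finset _)
      {Z ∈ crossing A B k | S ⊆ Z} := by
    refine disjoint_left.2 fun Z hZ hZ' => ?_
    have h3 := (mem_crossing.1 (mem_filter.1 hZ').1).2.1
    rw [disjoint_iff_inter_eq_empty.1 (disjoint_of_subset_left (mem_filter.1 hZ).2.2 hAB.symm),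
      card_empty] at h3
    omega
  have h3 : ({Z ∈ powersetCard k (univ : Finset V) | S ⊆ Z ∧ Z ⊆ B} ∪
      {Z ∈ crossing A B k | S ⊆ Z} : Finset (Finset V)) ⊆
      {Z ∈ ({Z ∈ H.edges | Z ⊆ A ∪ B ∧ #(Z ∩ A) ≤ 1} : Finset _) | S ⊆ Z} ∪
        {Z ∈ nonEdges H | S ⊆ Z} := by
    have key : ∀ Z : Finset V, #Z = k → S ⊆ Z → Z ⊆ A ∪ B → #(Z ∩ A) ≤ 1 →
        Z ∈ {Z ∈ ({Z ∈ H.edges | Z ⊆ A ∪ B ∧ #(Z ∩ A) ≤ 1} : Finset _) | S ⊆ Z} ∪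
          {Z ∈ nonEdges H | S ⊆ Z} := by
      intro Z hZk hSZ hZAB hZA
      by_cases hZ : Z ∈ H.edges
      · exact mem_union_left _ (mem_filter.2 ⟨mem_filter.2 ⟨hZ, hZAB, hZA⟩, hSZ⟩)
      · exact mem_union_right _ (mem_filter.2 ⟨mem_nonEdges.2 ⟨hZk, hZ⟩, hSZ⟩)
    intro Z hZ
    obtain hZ | hZ := mem_union.1 hZ
    · obtain ⟨hZ, hSZ, hZB⟩ := mem_filter.1 hZ
      refine key Z (mem_powersetCard.1 hZ).2 hSZ (hZB.trans subset_union_right) ?_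
      rw [disjoint_iff_inter_eq_empty.1 (disjoint_of_subset_left hZB hAB.symm), card_empty]
      omega
    · obtain ⟨hZ, hSZ⟩ := mem_filter.1 hZ
      obtain ⟨hZk, hZA, hZAB⟩ := mem_crossing.1 hZ
      exact key Z hZk hSZ hZAB hZA.le
  have h4 := (card_le_card h3).trans (card_union_le _ _)
  rw [card_union_of_disjoint hd, h1] at h4
  have h5 : (b - (k - 2)).choose 2 ≤ (#B - (k - 2)).choose 2 + (b - #B) * n := by
    have h6 := choose_two_add_le (#B - (k - 2)) (b - #B)
    have h7 : (b - (k - 2)).choose 2 ≤ (#B - (k - 2) + (b - #B)).choose 2 :=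
      Nat.choose_le_choose _ (by omega)
    have h9 : #B - (k - 2) + (b - #B) ≤ n := by
      have : #B ≤ n := card_le_univ B
      omega
    have h8 : (b - #B) * (#B - (k - 2) + (b - #B)) ≤ (b - #B) * n := Nat.mul_le_mul_left _ h9
    omega
  have h6 : #A * (#B - (k - 2)) ≤
      codegree {Z ∈ H.edges | Z ⊆ A ∪ B ∧ #(Z ∩ A) ≤ 1} S + (b - #B) * n := by
    rw [codegree] at hδ
    rw [codegree]
    omega
  have h7 : ((b - #B : ℕ) : ℝ) ≤ n / (32 * k) := by
    rcases le_total b #B with h | h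
    · rw [Nat.sub_eq_zero_of_le h, Nat.cast_zero]; positivity
    · rw [Nat.cast_sub h]; linarith
  have h8 : (n : ℝ) / (4 * k) ≤ #A := by
    rw [div_le_iff₀ (by positivity)]
    have : (n : ℝ) ≤ 4 * k * #A := by exact_mod_cast hA
    linarith
  have h9 : (n : ℝ) / 4 ≤ ((#B - (k - 2) : ℕ) : ℝ) := by
    have h10 : n ≤ 4 * (#B - (k - 2)) := by
      have : 16 * k ≤ 16 * k ^ 2 := by nlinarith
      omega
    have : (n : ℝ) ≤ 4 * ((#B - (k - 2) : ℕ) : ℝ) := by exact_mod_cast h10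
    linarith
  have h10 : (n : ℝ) / (4 * k) * (n / 4) ≤ #A * ((#B - (k - 2) : ℕ) : ℝ) := by gcongr
  have h11 : (#A : ℝ) * ((#B - (k - 2) : ℕ) : ℝ) ≤
      codegree {Z ∈ H.edges | Z ⊆ A ∪ B ∧ #(Z ∩ A) ≤ 1} S + ((b - #B : ℕ) : ℝ) * n := by
    exact_mod_cast h6
  have h12 : ((b - #B : ℕ) : ℝ) * n ≤ n / (32 * k) * n := by gcongr
  have h13 : (n : ℝ) / (4 * k) * (n / 4) = 2 * ((n : ℝ) ^ 2 / (32 * k)) := by field_simp; ring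
  have h14 : (n : ℝ) / (32 * k) * n = (n : ℝ) ^ 2 / (32 * k) := by field_simp
  linarith

/-- Large sets `A` and `B` with few missing crossing sets at every vertex of `A`
form a reservoir. -/
lemma isReservoir_of_codegree_le {H : UniformHypergraph V k} {A B : Finset V} {b : ℕ}
    {ε τ : ℝ} (hℓ : 1 ≤ ℓ) (hℓk : 2 * ℓ < k) (hAB : Disjoint A B)
    (hδ : ∀ S : Finset V, #S = k - 2 → codegree (nonEdges H) S ≤ (b - (k - 2)).choose 2)
    (hbn : b ≤ Fintype.card V) (hb : (b : ℝ) ≤ #B + Fintype.card V / (32 * k))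
    (hA : Fintype.card V ≤ 4 * k * #A) (hB : Fintype.card V ≤ 2 * #B)
    (hn : 16 * k ^ 2 ≤ Fintype.card V)
    (hmiss : ∀ v ∈ A, (codegree (missing H A B) {v} : ℝ) ≤ ε * (Fintype.card V : ℝ) ^ (k - 1))
    (hτ : 0 < τ) (hτκ : 2 ^ (k + 4) * τ ≤ reservoirDensity k ^ 2)
    (hετ : 2 ^ k * ε ≤ reservoirDensity k / 8 * τ) :
    IsReservoir H ℓ A B (reservoirDensity k) τ := by
  have hk1 : 1 ≤ k := by omega
  have hk0 : (0 : ℝ) < k := by exact_mod_cast hk1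
  have hnpos : 0 < Fintype.card V := by
    have : 0 < 16 * k ^ 2 := by positivity
    omega
  have hn0 : (0 : ℝ) < Fintype.card V := by exact_mod_cast hnpos
  have hκ := reservoirDensity_pos hk1
  have hκc := reservoirDensity_le hk1
  have hn8 : 8 * k ^ 2 ≤ Fintype.card V := by omega
  have hB4 : Fintype.card V ≤ 4 * k * #B := hB.trans (by nlinarith)
  refine ⟨hℓ, hℓk, hAB, hnpos, hκ, hκc.trans (subsetDensity_le hk1), hτ.le, hτκ, fun r hr => ?_,
    fun r hr hr' => ?_, ?_, fun L hL hLc => ?_⟩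
  · rw [card_powersetCard]
    refine le_trans ?_ (subsetDensity_mul_le_choose hk1 hr hB4 hn8)
    gcongr
  · obtain ⟨r, rfl⟩ := Nat.exists_eq_add_of_le' hr
    have h1 := subsetDensity_mul_le_mul_choose hk1 hr' hB4 hA hn8
    have h2 : (#A : ℝ) * ((#B).choose r : ℕ) ≤ #(crossing A B (r + 1)) := by
      exact_mod_cast mul_choose_le_card_crossing hAB r
    refine le_trans ?_ (h1.trans h2)
    gcongr
  · have h1 := card_filter_lt_codegree_mul_le (card_of_mem_missing (H := H) (A := A) (B := B))
      (powersetCard ℓ univ) ∅ (τ * (Fintype.card V : ℝ) ^ (k - ℓ))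
    simp only [empty_union, codegree_empty] at h1
    have h2 : missing H A B ⊆ A.biUnion fun v => {Z ∈ missing H A B | {v} ⊆ Z} := by
      intro Z hZ
      obtain ⟨v, hv⟩ := card_pos.1 (by
        rw [(mem_crossing.1 (mem_missing.1 hZ).1).2.1]; norm_num : 0 < #(Z ∩ A))
      rw [mem_inter] at hv
      exact mem_biUnion.2 ⟨v, hv.2, mem_filter.2 ⟨hZ, singleton_subset_iff.2 hv.1⟩⟩
    have hε : 0 ≤ ε * (Fintype.card V : ℝ) ^ (k - 1) := by
      have : 0 < #A := by
        by_contra h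
        rw [Nat.eq_zero_of_not_pos h] at hA
        omega
      obtain ⟨v, hv⟩ := card_pos.1 this
      exact (Nat.cast_nonneg _).trans (hmiss v hv)
    have h3 : (#(missing H A B) : ℝ) ≤ ε * (Fintype.card V : ℝ) ^ k := by
      calc (#(missing H A B) : ℝ) ≤ ∑ v ∈ A, (codegree (missing H A B) {v} : ℝ) := by
            exact_mod_cast (card_le_card h2).trans card_biUnion_le
        _ ≤ #A • (ε * (Fintype.card V : ℝ) ^ (k - 1)) := sum_le_card_nsmul _ _ _ hmiss
        _ ≤ Fintype.card V * (ε * (Fintype.card V : ℝ) ^ (k - 1)) := by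
            rw [nsmul_eq_mul]
            gcongr
            exact card_le_univ A
        _ = ε * (Fintype.card V : ℝ) ^ k := by
            rw [mul_left_comm, ← pow_succ', Nat.sub_add_cancel hk1]
    have h4 : (Fintype.card V : ℝ) ^ k =
        (Fintype.card V : ℝ) ^ ℓ * (Fintype.card V : ℝ) ^ (k - ℓ) := by
      rw [← pow_add]; congr 1; omega
    refine le_of_mul_le_mul_right (h1.trans ?_)
      (show 0 < τ * (Fintype.card V : ℝ) ^ (k - ℓ) by positivity)
    calc (2 : ℝ) ^ k * #(missing H A B) ≤ 2 ^ k * (ε * (Fintype.card V : ℝ) ^ k) := by gcongr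
      _ = 2 ^ k * ε * (Fintype.card V : ℝ) ^ k := by ring
      _ ≤ reservoirDensity k / 8 * τ * (Fintype.card V : ℝ) ^ k := by gcongr
      _ = _ := by rw [h4]; ring
  · set F : Finset (Finset V) := {Z ∈ H.edges | L ⊆ Z ∧ Z ⊆ A ∪ B ∧ #(Z ∩ A) ≤ 1} with hF
    set 𝒮 : Finset (Finset V) := {S ∈ powersetCard (k - 2) univ | L ⊆ S ∧ S ⊆ B} with h𝒮
    have h1 := sum_codegree_le (F := F) (r := k)
      (fun Z hZ => H.card_of_mem_edges Z (mem_filter.1 hZ).1) 𝒮 ∅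
    simp only [empty_union, codegree_empty] at h1
    have h2 : ∀ S ∈ 𝒮, (Fintype.card V : ℝ) ^ 2 / (32 * k) ≤ codegree F S := by
      intro S hS
      obtain ⟨hS, hLS, hSB⟩ := mem_filter.1 hS
      have hSc := (mem_powersetCard.1 hS).2
      refine (card_edges_le_one_of_card_eq (by omega) hAB hSB hSc (hδ S hSc) hbn hb hA hB hn).trans
        (Nat.cast_le.2 (card_le_card fun Z hZ => ?_))
      obtain ⟨hZ, hSZ⟩ := mem_filter.1 hZ
      obtain ⟨hZ, hZ'⟩ := mem_filter.1 hZ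
      exact mem_filter.2 ⟨mem_filter.2 ⟨hZ, hLS.trans hSZ, hZ'⟩, hSZ⟩
    have h3 : subsetDensity k * (Fintype.card V : ℝ) ^ (k - 2 - ℓ) ≤ #𝒮 := by
      rw [h𝒮, card_filter_subset_subset hL (by omega), hLc]
      refine subsetDensity_mul_le_choose hk1 (by omega) ?_ hn8
      have h4 : Fintype.card V ≤ 4 * (#B - ℓ) := by
        have : 16 * k ≤ 16 * k ^ 2 := by nlinarith
        omega
      exact h4.trans (by nlinarith [Nat.zero_le (#B - ℓ)])
    have h4 : (#𝒮 : ℝ) * ((Fintype.card V : ℝ) ^ 2 / (32 * k)) ≤ 2 ^ k * #F := by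
      calc (#𝒮 : ℝ) * ((Fintype.card V : ℝ) ^ 2 / (32 * k)) ≤ ∑ S ∈ 𝒮, (codegree F S : ℝ) := by
            rw [← nsmul_eq_mul]; exact card_nsmul_le_sum _ _ _ h2
        _ ≤ 2 ^ k * #F := by exact_mod_cast h1
    have h5 : (Fintype.card V : ℝ) ^ (k - ℓ) =
        (Fintype.card V : ℝ) ^ (k - 2 - ℓ) * (Fintype.card V : ℝ) ^ 2 := by
      rw [← pow_add]; congr 1; omega
    refine le_of_mul_le_mul_left (a := (2 : ℝ) ^ k) (le_trans ?_ h4) (by positivity)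
    calc (2 : ℝ) ^ k * (reservoirDensity k * (Fintype.card V : ℝ) ^ (k - ℓ))
        = subsetDensity k * (Fintype.card V : ℝ) ^ (k - 2 - ℓ) *
          ((Fintype.card V : ℝ) ^ 2 / (32 * k)) := by
          rw [h5, ← reservoirDensity_mul hk1]; field_simp
      _ ≤ _ := by gcongr

end LoosePath

/-! ### Typical paths and absorption of vertices -/

namespace LoosePath

variable {V : Type*} [DecidableEq V] {k ℓ : ℕ}

/-- Two edges that share exactly `ℓ` vertices form a path. -/
lemma SetPath.exists_of_card_inter_eq {H : UniformHypergraph V k} (hℓk : 2 * ℓ < k)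
    {Z₁ Z₂ : Finset V} (h₁ : Z₁ ∈ H.edges) (h₂ : Z₂ ∈ H.edges) (hZ : #(Z₁ ∩ Z₂) = ℓ) :
    ∃ K₀ K₁, SetPath H ℓ K₀ K₁ (Z₁ ∪ Z₂) 2 ∧ K₀ ⊆ Z₁ \ Z₂ ∧ K₁ ⊆ Z₂ \ Z₁ := by
  have hc₁ := card_inter_add_card_sdiff Z₁ Z₂
  have hc₂ := card_inter_add_card_sdiff Z₂ Z₁
  rw [H.card_of_mem_edges _ h₁] at hc₁
  rw [inter_comm, H.card_of_mem_edges _ h₂] at hc₂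
  obtain ⟨K₀, hK₀, hK₀c⟩ := exists_subset_card_eq (show ℓ ≤ #(Z₁ \ Z₂) by omega)
  obtain ⟨K₁, hK₁, hK₁c⟩ := exists_subset_card_eq (show ℓ ≤ #(Z₂ \ Z₁) by omega)
  set Y := Z₁ ∩ Z₂ with hY
  have e1 : K₀ ∪ (((Z₁ \ Z₂) \ K₀) ∪ Y) = Z₁ := by
    ext x
    have h := @hK₀ x
    simp only [hY, mem_union, mem_sdiff, mem_inter] at h ⊢
    tauto
  have e2 : ((Z₂ \ Z₁) \ K₁) ∪ K₁ = Z₂ \ Z₁ := sdiff_union_of_subset hK₁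
  have e3 : Y ∪ (Z₂ \ Z₁) = Z₂ := by
    ext x
    simp only [hY, mem_union, mem_sdiff, mem_inter]
    tauto
  have p1 : SetPath H ℓ K₀ Y Z₁ 1 := by
    have := SetPath.single (H := H) (M := (Z₁ \ Z₂) \ K₀) (L₁ := Y) hK₀c
      (by rw [card_sdiff_of_subset hK₀]; omega) hZ ?_ ?_ (by rwa [union_assoc, e1])
    · rwa [e1] at this
    · refine disjoint_left.2 fun x hx hx' => ?_
      simp only [hY, mem_sdiff, mem_inter] at hx hx'
      tauto
    · refine disjoint_left.2 fun x hx hx' => ?_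
      have h := hK₀ hx
      simp only [hY, mem_union, mem_sdiff, mem_inter] at h hx'
      tauto
  have p2 := SetPath.snoc ((Z₂ \ Z₁) \ K₁) K₁ p1 (by rw [card_sdiff_of_subset hK₁]; omega) hK₁c
    sdiff_disjoint (by rw [e2]; exact disjoint_sdiff) (by rwa [union_assoc, e2, e3])
  rw [e2, union_sdiff_self_eq_union] at p2
  exact ⟨K₀, K₁, p2, hK₀, hK₁⟩

/-- An edge forms a path. -/
lemma SetPath.exists_of_mem_edges {H : UniformHypergraph V k} (hℓk : 2 * ℓ < k)
    {Z : Finset V} (hZ : Z ∈ H.edges) :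
    ∃ K₀ K₁, SetPath H ℓ K₀ K₁ Z 1 ∧ K₀ ⊆ Z ∧ K₁ ⊆ Z := by
  have hc := H.card_of_mem_edges _ hZ
  obtain ⟨K₀, hK₀, hK₀c⟩ := exists_subset_card_eq (show ℓ ≤ #Z by omega)
  have hc' := card_sdiff_of_subset hK₀
  obtain ⟨K₁, hK₁, hK₁c⟩ := exists_subset_card_eq (show ℓ ≤ #(Z \ K₀) by omega)
  have e1 : ((Z \ K₀) \ K₁) ∪ K₁ = Z \ K₀ := sdiff_union_of_subset hK₁
  have e2 : K₀ ∪ (Z \ K₀) = Z := union_sdiff_of_subset hK₀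
  have p := SetPath.single (H := H) (M := (Z \ K₀) \ K₁) (L₁ := K₁) hK₀c
    (by rw [card_sdiff_of_subset hK₁]; omega) hK₁c sdiff_disjoint
    (by rw [e1]; exact disjoint_sdiff) (by rwa [union_assoc, e1, e2])
  rw [e1, e2] at p
  exact ⟨K₀, K₁, p, hK₀, hK₁.trans sdiff_subset⟩

variable [Fintype V]

/-- A vertex outside `B` with many edges into `B` is the common vertex outside `B`
of two consecutive edges of a path. -/
lemma SetPath.exists_of_vertex {H : UniformHypergraph V k} {B : Finset V} (hℓ : 1 ≤ ℓ)
    (hℓk : 2 * ℓ < k) {v : V} {γ : ℝ} (hγ : 0 < γ) (hn : 0 < Fintype.card V)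
    (hdeg : γ * (Fintype.card V : ℝ) ^ (k - 1) ≤ #{Z ∈ H.edges | {v} ⊆ Z ∧ Z ⊆ {v} ∪ B})
    {W : Finset V} (hW : (#W : ℝ) ≤ γ / 2 * Fintype.card V)
    (hk : (k : ℝ) ≤ γ / 16 * Fintype.card V) :
    ∃ K₀ K₁ Y, SetPath H ℓ K₀ K₁ Y 2 ∧ K₀ ⊆ B ∧ K₁ ⊆ B ∧ v ∈ Y ∧ Y ⊆ {v} ∪ B ∧
      Disjoint (Y \ {v}) W := by
  set n : ℝ := (Fintype.card V : ℝ) with hn_def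
  have hn' : 0 < n := by rw [hn_def]; exact_mod_cast hn
  set F : Finset (Finset V) := {Z ∈ H.edges | ({v} ⊆ Z ∧ Z ⊆ {v} ∪ B) ∧ Disjoint (Z \ {v}) W}
    with hF
  have hFk : ∀ Z ∈ F, #Z = k := fun Z hZ => H.card_of_mem_edges Z (mem_filter.1 hZ).1
  have hFc : γ / 2 * n ^ (k - 1) ≤ #F := by
    have h1 : ({Z ∈ H.edges | {v} ⊆ Z ∧ Z ⊆ {v} ∪ B} : Finset (Finset V)) ⊆
        F ∪ {Z ∈ H.edges | {v} ⊆ Z ∧ ¬ Disjoint (Z \ {v}) W} := by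
      intro Z hZ
      obtain ⟨hZ, hZv⟩ := mem_filter.1 hZ
      by_cases hd : Disjoint (Z \ {v}) W
      · exact mem_union_left _ (mem_filter.2 ⟨hZ, hZv, hd⟩)
      · exact mem_union_right _ (mem_filter.2 ⟨hZ, hZv.1, hd⟩)
    have h2 := card_filter_singleton_le H.card_of_mem_edges (by omega) v hW
    have h3 : (#{Z ∈ H.edges | {v} ⊆ Z ∧ Z ⊆ {v} ∪ B} : ℝ) ≤
        #F + #{Z ∈ H.edges | {v} ⊆ Z ∧ ¬ Disjoint (Z \ {v}) W} := by
      exact_mod_cast (card_le_card h1).trans (card_union_le _ _)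
    linarith
  -- By averaging, some `ℓ`-set containing `v` lies in many members of `F`.
  obtain ⟨Y, hYc, hvY, hYd⟩ : ∃ Y : Finset V, #Y = ℓ ∧ {v} ⊆ Y ∧
      γ / 4 * n ^ (k - ℓ) < codegree F Y := by
    by_contra! hcon
    set 𝒴 : Finset (Finset V) := {Y ∈ powersetCard ℓ univ | {v} ⊆ Y} with h𝒴
    have h1 : F ⊆ 𝒴.biUnion fun Y => {Z ∈ F | Y ⊆ Z} := by
      intro Z hZ
      obtain ⟨Y, hvY, hYZ, hYc⟩ := exists_subsuperset_card_eq (mem_filter.1 hZ).2.1.1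
        (show #{v} ≤ ℓ by rwa [card_singleton]) (show ℓ ≤ #Z by rw [hFk Z hZ]; omega)
      exact mem_biUnion.2 ⟨Y, mem_filter.2 ⟨mem_powersetCard.2 ⟨subset_univ _, hYc⟩, hvY⟩,
        mem_filter.2 ⟨hZ, hYZ⟩⟩
    have h2 : (#F : ℝ) ≤ ∑ Y ∈ 𝒴, (codegree F Y : ℝ) := by
      exact_mod_cast (card_le_card h1).trans card_biUnion_le
    have h3 : ∑ Y ∈ 𝒴, (codegree F Y : ℝ) ≤ #𝒴 • (γ / 4 * n ^ (k - ℓ)) := by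
      refine sum_le_card_nsmul _ _ _ fun Y hY => ?_
      rw [h𝒴, mem_filter, mem_powersetCard] at hY
      exact hcon Y hY.1.2 hY.2
    have h4 : (#𝒴 : ℝ) ≤ n ^ (ℓ - 1) := by
      have := codegree_le_pow (F := powersetCard ℓ (univ : Finset V))
        (fun e he => (mem_powersetCard.1 he).2) {v}
      rw [card_singleton] at this
      have h : #𝒴 ≤ Fintype.card V ^ (ℓ - 1) := this
      rw [hn_def]
      exact_mod_cast h
    have h5 : (#𝒴 : ℝ) * (γ / 4 * n ^ (k - ℓ)) ≤ n ^ (ℓ - 1) * (γ / 4 * n ^ (k - ℓ)) := by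
      gcongr
    have h6 : n ^ (k - 1) = n ^ (ℓ - 1) * n ^ (k - ℓ) := by
      rw [← pow_add]; congr 1; omega
    rw [nsmul_eq_mul] at h3
    have h7 : 0 < γ * n ^ (k - 1) := by positivity
    have h8 : n ^ (ℓ - 1) * (γ / 4 * n ^ (k - ℓ)) = γ / 4 * n ^ (k - 1) := by rw [h6]; ring
    linarith
  set G : Finset (Finset V) := {Z ∈ F | Y ⊆ Z} with hG
  have hGk : ∀ Z ∈ G, #Z = k ∧ Y ⊆ Z := fun Z hZ =>
    ⟨hFk Z (mem_filter.1 hZ).1, (mem_filter.1 hZ).2⟩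
  have hGc : γ / 4 * n ^ (k - #Y) ≤ #G := by rw [hYc]; exact hYd.le
  obtain ⟨Z₁, hZ₁⟩ : G.Nonempty := by
    refine card_pos.1 ?_
    have : (0 : ℝ) < #G := (show (0 : ℝ) < γ / 4 * n ^ (k - #Y) by positivity).trans_le hGc
    exact_mod_cast this
  obtain ⟨Z₂, hZ₂, -, hd⟩ := exists_superset_disjoint (by omega) hGk (by positivity) hn hGc
    (fun _ => False) (by simp only [filter_false, card_empty, Nat.cast_zero]; positivity)
    (W := Z₁) (by rw [(hGk Z₁ hZ₁).1]; linarith)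
  have hYZ₁ := (hGk Z₁ hZ₁).2
  have hYZ₂ := (hGk Z₂ hZ₂).2
  have hinter : Z₁ ∩ Z₂ = Y := by
    refine subset_antisymm (fun x hx => ?_) (subset_inter hYZ₁ hYZ₂)
    rw [mem_inter] at hx
    by_contra hxY
    exact disjoint_left.1 hd (mem_sdiff.2 ⟨hx.2, hxY⟩) hx.1
  obtain ⟨hZ₁E, ⟨hvZ₁, hZ₁B⟩, hZ₁W⟩ := mem_filter.1 (mem_filter.1 hZ₁).1
  obtain ⟨hZ₂E, ⟨hvZ₂, hZ₂B⟩, hZ₂W⟩ := mem_filter.1 (mem_filter.1 hZ₂).1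
  obtain ⟨K₀, K₁, hp, hK₀, hK₁⟩ := SetPath.exists_of_card_inter_eq hℓk hZ₁E hZ₂E
    (by rw [hinter, hYc])
  rw [singleton_subset_iff] at hvZ₁ hvZ₂
  refine ⟨K₀, K₁, _, hp, fun x hx => ?_, fun x hx => ?_, mem_union_left _ hvZ₁,
    union_subset hZ₁B hZ₂B, ?_⟩
  · have h := mem_sdiff.1 (hK₀ hx)
    refine (mem_union.1 (hZ₁B h.1)).resolve_left fun hxv => h.2 ?_
    rwa [mem_singleton.1 hxv]
  · have h := mem_sdiff.1 (hK₁ hx)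
    refine (mem_union.1 (hZ₂B h.1)).resolve_left fun hxv => h.2 ?_
    rwa [mem_singleton.1 hxv]
  · rw [union_sdiff_distrib, disjoint_union_left]
    exact ⟨hZ₁W, hZ₂W⟩

/-- A path with at least one edge, both of whose ends are typical subsets of `B`. -/
structure IsTypicalPath (H : UniformHypergraph V k) (ℓ : ℕ) (A B : Finset V) (τ : ℝ)
    (L₀ L₁ X : Finset V) (t : ℕ) : Prop where
  path : SetPath H ℓ L₀ L₁ X t
  first_subset : L₀ ⊆ B
  last_subset : L₁ ⊆ B
  first_typical : IsTypical H ℓ A B τ L₀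
  last_typical : IsTypical H ℓ A B τ L₁
  one_le : 1 ≤ t

namespace IsTypicalPath

variable {H : UniformHypergraph V k} {A B : Finset V} {κ τ : ℝ} {L₀ L₁ X : Finset V} {t : ℕ}

lemma card_le (hℓk : 2 * ℓ < k) (hX : IsTypicalPath H ℓ A B τ L₀ L₁ X t) :
    (#X : ℝ) ≤ k * (t + 1) := by
  have h1 := hX.path.card_eq hℓk.le
  have h2 : #X ≤ k * (t + 1) := by
    rw [h1, mul_comm k, add_mul]
    have := Nat.mul_le_mul_left t (Nat.sub_le k ℓ)
    omega
  exact_mod_cast h2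

/-- A typical path with two edges and only one vertex outside `B`. -/
lemma exists_two_edges (h : IsReservoir H ℓ A B κ τ) {W : Finset V}
    (hW : (#W : ℝ) + 5 * k ≤ κ / 4 * Fintype.card V) :
    ∃ L₀ L₁ X, IsTypicalPath H ℓ A B τ L₀ L₁ X 2 ∧ X ⊆ A ∪ B ∧ #(X \ B) = 1 ∧ Disjoint X W := by
  have hk0 : (0 : ℝ) ≤ k := Nat.cast_nonneg k
  obtain ⟨L₀, hL₀, hL₀c, hL₀t, hL₀W⟩ := h.exists_typical (W := W) (by linarith)
  have hc : (#(W ∪ L₀) : ℝ) ≤ #W + k := by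
    have h1 := card_union_le W L₀
    have h2 := h.two_mul_lt
    have h3 : #(W ∪ L₀) ≤ #W + k := by omega
    exact_mod_cast h3
  obtain ⟨L₁, hL₁, hL₁c, hL₁t, hL₁W⟩ := h.exists_typical (W := W ∪ L₀) (by linarith)
  rw [disjoint_union_right] at hL₁W
  obtain ⟨X, hX, hXW, hXAB, hXB⟩ := h.exists_connection hL₀ hL₁ hL₀c hL₁c hL₀t hL₁t hL₁W.2.symm
    (W := W) (by linarith)
  refine ⟨L₀, L₁, X, ⟨hX, hL₀, hL₁, hL₀t, hL₁t, by norm_num⟩, hXAB, hXB, ?_⟩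
  refine disjoint_left.2 fun x hx hxW => ?_
  by_cases hxL : x ∈ L₀ ∪ L₁
  · obtain hxL | hxL := mem_union.1 hxL
    · exact disjoint_left.1 hL₀W hxL hxW
    · exact disjoint_left.1 hL₁W.1 hxL hxW
  · exact disjoint_left.1 hXW (mem_sdiff.2 ⟨hx, hxL⟩) hxW

lemma exists_absorb (h : IsReservoir H ℓ A B κ τ) (hX : IsTypicalPath H ℓ A B τ L₀ L₁ X t)
    {K₀ K₁ Y W : Finset V} {s : ℕ} (hY : SetPath H ℓ K₀ K₁ Y s) (hK₀ : K₀ ⊆ B) (hK₁ : K₁ ⊆ B)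
    (hXY : Disjoint X Y) (hW : (#X : ℝ) + #Y + #W + 10 * k ≤ κ / 4 * Fintype.card V) :
    ∃ L₁' X' t', IsTypicalPath H ℓ A B τ L₀ L₁' X' t' ∧ X ∪ Y ⊆ X' ∧
      X' \ (X ∪ Y) ⊆ (A ∪ B) \ W ∧ t' ≤ t + s + 6 ∧
      2 * #(X' \ B) + t + s ≤ t' + 2 * #(X \ B) + 2 * #(Y \ B) := by
  obtain ⟨L', X', t', hp, hLB, hLt, h1, h2, h3, h4, h5⟩ := h.exists_absorb hX.path hX.last_subset
    hX.last_typical hY hK₀ hK₁ hXY hW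
  exact ⟨L', X', t', ⟨hp, hX.first_subset, hLB, hX.first_typical, hLt, hX.one_le.trans h3⟩,
    h1, h2, h4, h5⟩

/-- A typical path through all edges of a small matching in `B`. -/
lemma exists_matching_subset (h : IsReservoir H ℓ A B κ τ) (M : Finset (Finset V))
    (hME : ∀ Z ∈ M, Z ∈ H.edges ∧ Z ⊆ B)
    (hMd : (M : Set (Finset V)).PairwiseDisjoint id) (W : Finset V)
    (hMW : ∀ Z ∈ M, Disjoint Z W)
    (hW : (#W : ℝ) + 8 * k * #M + 20 * k ≤ κ / 4 * Fintype.card V) :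
    ∃ L₀ L₁ X t, IsTypicalPath H ℓ A B τ L₀ L₁ X t ∧ X ⊆ A ∪ B ∧ Disjoint X W ∧
      t ≤ 2 + 7 * #M ∧ 2 * #(X \ B) + #M ≤ t := by
  have hk0 : (0 : ℝ) ≤ k := Nat.cast_nonneg k
  have hℓk := h.two_mul_lt
  induction M using Finset.induction_on generalizing W with
  | empty =>
    rw [card_empty, Nat.cast_zero] at hW
    obtain ⟨L₀, L₁, X, hX, hXAB, hXB, hXW⟩ := exists_two_edges h (W := W) (by linarith)
    exact ⟨L₀, L₁, X, 2, hX, hXAB, hXW, by omega, by rw [hXB, card_empty]⟩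
  | insert Z M hZM ih =>
    obtain ⟨hZE, hZB⟩ := hME Z (mem_insert_self _ _)
    have hZk := H.card_of_mem_edges Z hZE
    rw [card_insert_of_notMem hZM, Nat.cast_add, Nat.cast_one] at hW
    have hc : (#(W ∪ Z) : ℝ) ≤ #W + k := by
      rw [← hZk]; exact_mod_cast card_union_le W Z
    obtain ⟨L₀, L₁, X, t, hX, hXAB, hXW, ht, hs⟩ := ih
      (fun Z' hZ' => hME Z' (mem_insert_of_mem hZ'))
      (hMd.subset (by rw [coe_insert]; exact Set.subset_insert _ _)) (W ∪ Z)
      (fun Z' hZ' => disjoint_union_right.2 ⟨hMW Z' (mem_insert_of_mem hZ'),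
        hMd (mem_coe.2 (mem_insert_of_mem hZ')) (mem_coe.2 (mem_insert_self _ _))
          (by rintro rfl; exact hZM hZ')⟩) (by nlinarith)
    rw [disjoint_union_right] at hXW
    obtain ⟨K₀, K₁, hp, hK₀, hK₁⟩ := SetPath.exists_of_mem_edges hℓk hZE
    have hXc := hX.card_le hℓk
    have ht' : (t : ℝ) ≤ 2 + 7 * #M := by exact_mod_cast ht
    obtain ⟨L₁', X', t', hX', h1, h2, h3, h4⟩ := hX.exists_absorb h (W := W) hp
      (hK₀.trans hZB) (hK₁.trans hZB) hXW.2 (by rw [hZk]; nlinarith)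
    rw [sdiff_eq_empty_iff_subset.2 hZB, card_empty] at h4
    refine ⟨L₀, L₁', X', t', hX', fun x hx => ?_, disjoint_left.2 fun x hx hxW => ?_, ?_, ?_⟩
    · by_cases hxX : x ∈ X ∪ Z
      · exact (union_subset hXAB (hZB.trans subset_union_right)) hxX
      · exact (mem_sdiff.1 (h2 (mem_sdiff.2 ⟨hx, hxX⟩))).1
    · by_cases hxX : x ∈ X ∪ Z
      · obtain hxX | hxX := mem_union.1 hxX
        · exact disjoint_left.1 hXW.1 hxX hxW
        · exact disjoint_left.1 (hMW Z (mem_insert_self _ _)) hxX hxW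
      · exact (mem_sdiff.1 (h2 (mem_sdiff.2 ⟨hx, hxX⟩))).2 hxW
    · rw [card_insert_of_notMem hZM]; omega
    · rw [card_insert_of_notMem hZM]; omega

/-- A typical path through two given edges in `B` that share `ℓ` vertices. -/
lemma exists_of_card_inter_eq (h : IsReservoir H ℓ A B κ τ) {Z₁ Z₂ : Finset V}
    (h₁ : Z₁ ∈ H.edges) (h₂ : Z₂ ∈ H.edges) (h₁B : Z₁ ⊆ B) (h₂B : Z₂ ⊆ B) (hZ : #(Z₁ ∩ Z₂) = ℓ)
    (hn : 20 * k ≤ κ / 4 * Fintype.card V) :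
    ∃ L₀ L₁ X t, IsTypicalPath H ℓ A B τ L₀ L₁ X t ∧ X ⊆ A ∪ B ∧ t ≤ 16 ∧
      2 * #(X \ B) + 2 ≤ t := by
  have hk0 : (0 : ℝ) ≤ k := Nat.cast_nonneg k
  have hℓk := h.two_mul_lt
  obtain ⟨K₀, K₁, hp, hK₀, hK₁⟩ := SetPath.exists_of_card_inter_eq hℓk h₁ h₂ hZ
  have hB := union_subset h₁B h₂B
  have hc : (#(Z₁ ∪ Z₂) : ℝ) ≤ 2 * k := by
    have h3 := card_union_le Z₁ Z₂
    rw [H.card_of_mem_edges _ h₁, H.card_of_mem_edges _ h₂] at h3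
    have h4 : #(Z₁ ∪ Z₂) ≤ 2 * k := by omega
    exact_mod_cast h4
  obtain ⟨L₀, L₁, X, hX, hXAB, hXB, hXW⟩ := exists_two_edges h (W := Z₁ ∪ Z₂) (by linarith)
  have hXc := hX.card_le hℓk
  push_cast at hXc
  obtain ⟨L₁', X', t', hX', h1, h2, h3, h4⟩ := hX.exists_absorb h (W := ∅) hp
    (hK₀.trans (sdiff_subset.trans h₁B)) (hK₁.trans (sdiff_subset.trans h₂B)) hXW
    (by rw [card_empty, Nat.cast_zero]; linarith)
  rw [sdiff_eq_empty_iff_subset.2 hB, card_empty, hXB] at h4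
  refine ⟨L₀, L₁', X', t', hX', fun x hx => ?_, by omega, by omega⟩
  by_cases hxX : x ∈ X ∪ (Z₁ ∪ Z₂)
  · exact (union_subset hXAB (hB.trans subset_union_right)) hxX
  · exact (mem_sdiff.1 (h2 (mem_sdiff.2 ⟨hx, hxX⟩))).1

/-- Absorbing the vertices outside `A ∪ B` one by one. -/
lemma exists_absorb_vertices (h : IsReservoir H ℓ A B κ τ)
    (hX : IsTypicalPath H ℓ A B τ L₀ L₁ X t) (hXAB : X ⊆ A ∪ B) {γ : ℝ} (hγ : 0 < γ)
    (U : Finset V) (hU : ∀ v ∈ U, v ∉ A ∪ B)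
    (hdeg : ∀ v ∈ U, γ * (Fintype.card V : ℝ) ^ (k - 1) ≤
      #{Z ∈ H.edges | {v} ⊆ Z ∧ Z ⊆ {v} ∪ B})
    (hκ : (k : ℝ) * (t + 8 * #U + 20) ≤ κ / 4 * Fintype.card V)
    (hγn : (k : ℝ) * (t + 8 * #U + 20) ≤ γ / 16 * Fintype.card V) :
    ∃ L₁' X' t', IsTypicalPath H ℓ A B τ L₀ L₁' X' t' ∧ X' ⊆ A ∪ B ∪ U ∧ U ⊆ X' ∧
      t' ≤ t + 8 * #U ∧ 2 * #(X' \ B) + t ≤ t' + 2 * #(X \ B) := by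
  have hk0 : (0 : ℝ) ≤ k := Nat.cast_nonneg k
  have hℓk := h.two_mul_lt
  have hn := h.cast_card_pos
  induction U using Finset.induction_on with
  | empty => exact ⟨L₁, X, t, hX, by simpa using hXAB, empty_subset _, by simp, by omega⟩
  | insert v U hvU ih =>
    rw [card_insert_of_notMem hvU, Nat.cast_add, Nat.cast_one] at hκ hγn
    obtain ⟨L₁', X', t', hX', hX'U, hUX', ht', hs'⟩ := ih
      (fun w hw => hU w (mem_insert_of_mem hw)) (fun w hw => hdeg w (mem_insert_of_mem hw))
      (by nlinarith) (by nlinarith)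
    have hv := hU v (mem_insert_self _ _)
    have hX'c := hX'.card_le hℓk
    have ht'' : (t' : ℝ) ≤ t + 8 * #U := by exact_mod_cast ht'
    have hX'c' : (#X' : ℝ) ≤ k * (t + 8 * #U + 1) := hX'c.trans (by gcongr)
    have ht0 : (0 : ℝ) ≤ t := Nat.cast_nonneg t
    have hU0 : (0 : ℝ) ≤ #U := Nat.cast_nonneg _
    have hku : 0 ≤ (k : ℝ) * (t + 8 * #U) := by positivity
    have hvX' : v ∉ X' := fun hvX => by
      obtain h1 | h1 := mem_union.1 (hX'U hvX)
      · exact hv h1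
      · exact hvU h1
    have hγ0 : 0 < γ * Fintype.card V := by positivity
    obtain ⟨K₀, K₁, Y, hp, hK₀, hK₁, hvY, hYB, hYW⟩ := SetPath.exists_of_vertex h.one_le hℓk hγ
      h.card_pos (hdeg v (mem_insert_self _ _)) (W := X') (by linarith) (by linarith)
    have hYc : (#Y : ℝ) ≤ 3 * k := by
      have h1 := hp.card_eq hℓk.le
      have h2 : #Y ≤ 3 * k := by omega
      exact_mod_cast h2
    have hX'Y : Disjoint X' Y := by
      refine disjoint_left.2 fun x hx hxY => ?_
      have hxv : x ≠ v := by rintro rfl; exact hvX' hx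
      exact disjoint_left.1 hYW (mem_sdiff.2 ⟨hxY, by simpa using hxv⟩) hx
    obtain ⟨L₁'', X'', t'', hX'', h1, h2, h3, h4⟩ := hX'.exists_absorb h (W := ∅) hp hK₀ hK₁ hX'Y
      (by rw [card_empty, Nat.cast_zero]; linarith)
    have hYs : #(Y \ B) ≤ 1 := by
      rw [← card_singleton v]
      refine card_le_card fun x hx => ?_
      rw [mem_sdiff] at hx
      exact (mem_union.1 (hYB hx.1)).resolve_right hx.2
    refine ⟨L₁'', X'', t'', hX'', fun x hx => ?_, ?_, ?_, by omega⟩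
    · rw [mem_union, mem_insert]
      by_cases hxX : x ∈ X' ∪ Y
      · obtain hxX | hxX := mem_union.1 hxX
        · exact (mem_union.1 (hX'U hxX)).imp_right Or.inr
        · obtain hxY | hxY := mem_union.1 (hYB hxX)
          · exact Or.inr (Or.inl (mem_singleton.1 hxY))
          · exact Or.inl (mem_union_right _ hxY)
      · exact Or.inl (mem_sdiff.1 (h2 (mem_sdiff.2 ⟨hx, hxX⟩))).1
    · exact insert_subset (h1 (mem_union_right _ hvY)) (hUX'.trans (subset_union_left.trans h1))
    · rw [card_insert_of_notMem hvU]; omega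

/-- Prolonging a typical path by `j` edges, each with exactly one new vertex outside `B`. -/
lemma exists_prolong (h : IsReservoir H ℓ A B κ τ) (hX : IsTypicalPath H ℓ A B τ L₀ L₁ X t)
    (j : ℕ) (hκ : (k : ℝ) * (t + j + 2) ≤ κ / 4 * Fintype.card V) :
    ∃ L₁' X', IsTypicalPath H ℓ A B τ L₀ L₁' X' (t + j) ∧ X ⊆ X' ∧
      #(X' \ B) = #(X \ B) + j := by
  have hk0 : (0 : ℝ) ≤ k := Nat.cast_nonneg k
  have hℓk := h.two_mul_lt
  induction j with
  | zero => exact ⟨L₁, X, hX, Subset.rfl, rfl⟩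
  | succ j ih =>
    rw [Nat.cast_add, Nat.cast_one] at hκ
    obtain ⟨L', X', hX', hXX', hc⟩ := ih (by nlinarith)
    have hX'c := hX'.card_le hℓk
    rw [Nat.cast_add] at hX'c
    obtain ⟨L'', Y, hY, hLt, hLB, hd, -, hYB⟩ := h.exists_edge hX'.last_subset hX'.path.card_last
      hX'.last_typical (W := X') (by nlinarith)
    have hp := hX'.path.trans hY fun x hx => by
      rw [mem_inter] at hx
      by_contra hxL
      exact disjoint_left.1 hd (mem_sdiff.2 ⟨hx.2, hxL⟩) hx.1
    refine ⟨L'', X' ∪ Y, ⟨hp, hX'.first_subset, hLB, hX'.first_typical, hLt, by omega⟩,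
      hXX'.trans subset_union_left, ?_⟩
    rw [union_sdiff_distrib, card_union_of_disjoint, hc, hYB, add_assoc]
    refine disjoint_left.2 fun x hx hx' => ?_
    rw [mem_sdiff] at hx hx'
    exact disjoint_left.1 hd (mem_sdiff.2 ⟨hx'.1, fun hxL => hx.2 (hX'.last_subset hxL)⟩) hx.1

end IsTypicalPath

end LoosePath

/-! ### Matchings inside `B` and degrees into the remaining sets -/

namespace LoosePath

variable {V : Type*} [DecidableEq V] {k ℓ : ℕ}

/-- A set system in which no small set meets all members contains large matchings. -/
lemma exists_matching {F : Finset (Finset V)} (hF : ∀ e ∈ F, #e = k) (hk : 1 ≤ k) (J : ℕ)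
    (h : ∀ U : Finset V, #U < k * J → ∃ e ∈ F, Disjoint e U) :
    ∃ M ⊆ F, #M = J ∧ (M : Set (Finset V)).PairwiseDisjoint id := by
  induction J with
  | zero => exact ⟨∅, empty_subset _, rfl, by simp⟩
  | succ J ih =>
    obtain ⟨M, hMF, hMc, hMd⟩ := ih fun U hU => h U (hU.trans_le (Nat.mul_le_mul_left _ (by omega)))
    obtain ⟨e, he, hd⟩ := h (M.biUnion id) (by
      have h1 := card_biUnion_le_card_mul M id k fun e he => (hF e (hMF he)).le
      rw [hMc, mul_comm] at h1
      rw [mul_add]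
      omega)
    rw [disjoint_biUnion_right] at hd
    have heM : e ∉ M := fun heM => by
      have h1 := disjoint_self.1 (hd e heM)
      have h2 := hF e he
      rw [h1] at h2
      simp at h2
      omega
    refine ⟨insert e M, insert_subset he hMF, by rw [card_insert_of_notMem heM, hMc], ?_⟩
    rw [coe_insert, Set.pairwiseDisjoint_insert]
    exact ⟨hMd, fun f hf _ => hd f hf⟩

lemma mul_le_choose_two_add (x d : ℕ) : x.choose 2 + d * x ≤ (x + d).choose 2 := by
  induction d with
  | zero => simp
  | succ d ih =>
    have h : (x + d + 1).choose 2 = (x + d) + (x + d).choose 2 := by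
      rw [Nat.choose_succ_succ' (x + d) 1, Nat.choose_one_right]
    rw [← add_assoc, h]
    nlinarith

variable [Fintype V]

/-- A large part `B` with the degree condition for a part of `b < #B` vertices contains a matching
of four times `#B - b` edges, if no vertex has too large a degree in `B`. -/
lemma exists_matching_of_lt_card {H : UniformHypergraph V k} {B : Finset V} {b q J : ℕ} {D : ℝ}
    (hk : 3 ≤ k) (hB : #B = b + q) (hq : 1 ≤ q) (hJ : J ≤ 4 * q)
    (hδ : ∀ S : Finset V, #S = k - 2 → codegree (nonEdges H) S ≤ (b - (k - 2)).choose 2)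
    (hb : Fintype.card V ≤ 2 * b) (hn : 16 * k ^ 2 ≤ Fintype.card V)
    (hdeg : ∀ v ∈ B, (#{Z ∈ H.edges | {v} ⊆ Z ∧ Z ⊆ B} : ℝ) ≤
      D * (Fintype.card V : ℝ) ^ (k - 1))
    (hD0 : 0 ≤ D) (hD : 2 ^ k * (16 * k) * D < subsetDensity k) :
    ∃ M ⊆ ({Z ∈ H.edges | Z ⊆ B} : Finset (Finset V)), #M = J ∧
      (M : Set (Finset V)).PairwiseDisjoint id := by
  set n : ℝ := (Fintype.card V : ℝ) with hn_def
  have hk0 : (0 : ℝ) < k := by exact_mod_cast (by omega : 0 < k)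
  have hnpos : 0 < Fintype.card V := by
    have : 0 < 16 * k ^ 2 := by positivity
    omega
  have hn' : 0 < n := by rw [hn_def]; exact_mod_cast hnpos
  set F : Finset (Finset V) := {Z ∈ H.edges | Z ⊆ B} with hF
  have hFk : ∀ Z ∈ F, #Z = k := fun Z hZ => H.card_of_mem_edges Z (mem_filter.1 hZ).1
  have hk16 : 16 * k ≤ 16 * k ^ 2 := by nlinarith
  -- Every `(k - 2)`-subset of `B` lies in many edges inside `B`.
  have h1 : ∀ S ∈ powersetCard (k - 2) B, (q : ℝ) * (n / 4) ≤ codegree F (∅ ∪ S) := by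
    intro S hS
    rw [mem_powersetCard] at hS
    have h2 := card_edges_add_card_nonEdges H hS.1 (by omega)
    rw [hS.2, hB, show k - (k - 2) = 2 by omega,
      show b + q - (k - 2) = b - (k - 2) + q by omega] at h2
    have h3 := mul_le_choose_two_add (b - (k - 2)) q
    have h4 : #{Z ∈ nonEdges H | S ⊆ Z ∧ Z ⊆ B} ≤ codegree (nonEdges H) S :=
      card_le_card fun Z hZ => by
        rw [mem_filter] at hZ
        exact mem_filter.2 ⟨hZ.1, hZ.2.1⟩
    have h5 := hδ S hS.2
    have h6 : codegree F (∅ ∪ S) = #{Z ∈ H.edges | S ⊆ Z ∧ Z ⊆ B} := by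
      rw [empty_union, codegree, hF, filter_filter]
      congr 1
      ext Z
      simp only [mem_filter]
      tauto
    have h7 : q * (b - (k - 2)) ≤ codegree F (∅ ∪ S) := by omega
    have h8 : n / 4 ≤ ((b - (k - 2) : ℕ) : ℝ) := by
      have h9 : Fintype.card V ≤ 4 * (b - (k - 2)) := by omega
      have h10 : n ≤ 4 * ((b - (k - 2) : ℕ) : ℝ) := by rw [hn_def]; exact_mod_cast h9
      linarith
    calc (q : ℝ) * (n / 4) ≤ q * ((b - (k - 2) : ℕ) : ℝ) := by gcongr
      _ ≤ codegree F (∅ ∪ S) := by exact_mod_cast h7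
  have h2 : subsetDensity k * n ^ (k - 2) * (q * (n / 4)) ≤ 2 ^ k * #F := by
    have h3 := sum_codegree_le hFk (powersetCard (k - 2) B) ∅
    rw [codegree_empty] at h3
    have h4 : subsetDensity k * n ^ (k - 2) ≤ #(powersetCard (k - 2) B) := by
      rw [card_powersetCard]
      refine subsetDensity_mul_le_choose (by omega) (by omega) ?_ (by omega)
      calc Fintype.card V ≤ 2 * b := hb
        _ ≤ 4 * k * #B := by rw [hB]; nlinarith
    calc subsetDensity k * n ^ (k - 2) * (q * (n / 4))
        ≤ #(powersetCard (k - 2) B) * (q * (n / 4)) := by gcongr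
      _ ≤ ∑ S ∈ powersetCard (k - 2) B, (codegree F (∅ ∪ S) : ℝ) := by
        rw [← nsmul_eq_mul]; exact card_nsmul_le_sum _ _ _ h1
      _ ≤ 2 ^ k * #F := by exact_mod_cast h3
  refine exists_matching hFk (by omega) J fun U hU => ?_
  by_contra! hcon
  have h3 : F ⊆ (U ∩ B).biUnion fun v => {Z ∈ H.edges | {v} ⊆ Z ∧ Z ⊆ B} := by
    intro Z hZ
    obtain ⟨v, hvZ, hvU⟩ := not_disjoint_iff.1 (hcon Z hZ)
    have hZ' := mem_filter.1 hZ
    exact mem_biUnion.2 ⟨v, mem_inter.2 ⟨hvU, hZ'.2 hvZ⟩,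
      mem_filter.2 ⟨hZ'.1, singleton_subset_iff.2 hvZ, hZ'.2⟩⟩
  have h4 : (#F : ℝ) ≤ #(U ∩ B) * (D * n ^ (k - 1)) := by
    calc (#F : ℝ) ≤ ∑ v ∈ U ∩ B, (#{Z ∈ H.edges | {v} ⊆ Z ∧ Z ⊆ B} : ℝ) := by
          exact_mod_cast (card_le_card h3).trans card_biUnion_le
      _ ≤ #(U ∩ B) • (D * n ^ (k - 1)) :=
        sum_le_card_nsmul _ _ _ fun v hv => hdeg v (mem_inter.1 hv).2
      _ = _ := nsmul_eq_mul _ _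
  have h5 : (#(U ∩ B) : ℝ) ≤ k * (4 * q) := by
    have h6 : #(U ∩ B) ≤ k * (4 * q) := (card_le_card inter_subset_left).trans
      (hU.le.trans (Nat.mul_le_mul_left _ hJ))
    exact_mod_cast h6
  have h6 : n ^ (k - 1) = n ^ (k - 2) * n := by
    rw [← pow_succ]; congr 1; omega
  have h7 : (2 : ℝ) ^ k * #F ≤ 2 ^ k * (k * (4 * q) * (D * n ^ (k - 1))) := by
    gcongr
    exact h4.trans (by gcongr)
  have hq0 : (0 : ℝ) < q := by exact_mod_cast hq
  have h8 : 0 < n ^ (k - 2) * n * q := by positivity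
  have h9 := h2.trans h7
  rw [h6] at h9
  have h10 : subsetDensity k * (n ^ (k - 2) * n * q) ≤
      2 ^ k * (16 * k) * D * (n ^ (k - 2) * n * q) := by linarith
  have h11 := le_of_mul_le_mul_right h10 h8
  linarith

/-- Nearly all choices of one vertex in `A` and `j` vertices in `B` form an edge with a set `L`
that lies in few missing crossing sets. -/
lemma mul_choose_le_degreeInto {H : UniformHypergraph V k} {A B A' B' L : Finset V} {j : ℕ}
    (hAB : Disjoint A B) (hA' : A' ⊆ A) (hB' : B' ⊆ B) (hL : L ⊆ B) (hj : 1 ≤ j)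
    (hLj : #L + 1 + j = k) :
    (#A' : ℝ) * ((#B').choose j : ℕ) ≤ H.degreeInto L A' 1 B' j + codegree (missing H A B) L +
      #L * (Fintype.card V : ℝ) ^ j := by
  have hAB' : Disjoint A' (B' \ L) :=
    disjoint_of_subset_left hA' (disjoint_of_subset_right (sdiff_subset.trans hB') hAB)
  have h1 := mul_choose_le_card_crossing hAB' j
  have h2 : #(crossing A' (B' \ L) (j + 1)) ≤
      H.degreeInto L A' 1 B' j + codegree (missing H A B) L := by
    rw [UniformHypergraph.degreeInto, codegree]
    refine le_trans ?_ (card_union_le _ _)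
    have hd : ∀ R ∈ crossing A' (B' \ L) (j + 1), Disjoint L R := by
      intro R hR
      refine disjoint_left.2 fun x hx hxR => ?_
      obtain h3 | h3 := mem_union.1 ((mem_crossing.1 hR).2.2 hxR)
      · exact disjoint_left.1 hAB (hA' h3) (hL hx)
      · exact (mem_sdiff.1 h3).2 hx
    refine card_le_card_of_injOn (fun R => L ∪ R) (fun R hR => ?_) fun R hR R' hR' h => ?_
    · have hR' := mem_crossing.1 (mem_coe.1 hR)
      have hRd := hd R hR
      have hRA : R ∩ A = R ∩ A' := by
        ext x
        have h3 := @hR'.2.2 x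
        have h4 : x ∈ B' \ L → x ∉ A := fun h hA =>
          disjoint_left.1 hAB hA (hB' (mem_sdiff.1 h).1)
        have h5 := @hA' x
        simp only [mem_inter, mem_union] at h3 ⊢
        tauto
      rw [mem_coe, mem_union]
      by_cases hE : L ∪ R ∈ H.edges
      · refine Or.inl (mem_filter.2 ⟨hE, R ∩ A', mem_powersetCard.2 ⟨inter_subset_right, hR'.2.1⟩,
          R \ A', mem_powersetCard.2 ⟨fun x hx => ?_, ?_⟩, ?_⟩)
        · rw [mem_sdiff] at hx
          exact (mem_sdiff.1 ((mem_union.1 (hR'.2.2 hx.1)).resolve_left hx.2)).1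
        · have := card_inter_add_card_sdiff R A'
          omega
        · rw [union_assoc, union_comm (R ∩ A'), sdiff_union_inter]
      · refine Or.inr (mem_filter.2 ⟨mem_missing.2 ⟨?_, hE⟩, subset_union_left⟩)
        change L ∪ R ∈ _
        rw [union_comm]
        refine union_mem_crossing hAB (r := j + 1) ?_ hL rfl hRd.symm (by omega)
        rw [mem_crossing, hRA]
        exact ⟨hR'.1, hR'.2.1, hR'.2.2.trans (union_subset_union hA' (sdiff_subset.trans hB'))⟩
    · have h3 := hd R hR
      have h4 := hd R' hR'
      rw [← union_sdiff_cancel_left h3, ← union_sdiff_cancel_left h4]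
      exact congrArg (· \ L) h
  have h3 : (#B').choose j ≤ (#(B' \ L)).choose j + #L * Fintype.card V ^ (j - 1) := by
    rw [← card_powersetCard, ← card_powersetCard]
    have h4 := card_filter_not_disjoint_le (F := powersetCard j B')
      (fun e he => (mem_powersetCard.1 he).2) ∅ L
    refine le_trans ?_ (Nat.add_le_add_left h4 _)
    refine le_trans (card_le_card fun Z hZ => ?_) (card_union_le _ _)
    rw [mem_union, mem_filter, sdiff_empty, mem_powersetCard]
    by_cases hd : Disjoint Z L
    · exact Or.inl ⟨subset_sdiff.2 ⟨(mem_powersetCard.1 hZ).1, hd⟩, (mem_powersetCard.1 hZ).2⟩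
    · exact Or.inr ⟨hZ, empty_subset _, hd⟩
  have h4 : (#A' : ℝ) * (#(B' \ L)).choose j ≤
      H.degreeInto L A' 1 B' j + codegree (missing H A B) L := by exact_mod_cast h1.trans h2
  have h5 : ((#B').choose j : ℝ) ≤ (#(B' \ L)).choose j + #L * (Fintype.card V : ℝ) ^ (j - 1) := by
    exact_mod_cast h3
  have h6 : (#A' : ℝ) * (#L * (Fintype.card V : ℝ) ^ (j - 1)) ≤ #L * (Fintype.card V : ℝ) ^ j := by
    have h7 : (#A' : ℝ) ≤ Fintype.card V := by exact_mod_cast card_le_univ A'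
    calc (#A' : ℝ) * (#L * (Fintype.card V : ℝ) ^ (j - 1))
        ≤ Fintype.card V * (#L * (Fintype.card V : ℝ) ^ (j - 1)) := by gcongr
      _ = #L * (Fintype.card V : ℝ) ^ j := by
        rw [mul_left_comm, ← pow_succ', Nat.sub_add_cancel hj]
  have h7 : (#A' : ℝ) * ((#B').choose j : ℕ) ≤
      #A' * ((#(B' \ L)).choose j + #L * (Fintype.card V : ℝ) ^ (j - 1)) := by gcongr
  rw [mul_add] at h7
  linarith

/-- Nearly all `(k - 1)`-subsets of `B` form an edge with a vertex of `A` that lies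
in few missing crossing sets. -/
lemma choose_le_degreeInto {H : UniformHypergraph V k} {A B B' : Finset V} (hk : 1 ≤ k)
    (hAB : Disjoint A B) (hB' : B' ⊆ B) {v : V} (hv : v ∈ A) :
    (#B').choose (k - 1) ≤ H.degreeInto {v} B' (k - 1) ∅ 0 + codegree (missing H A B) {v} := by
  rw [← card_powersetCard, UniformHypergraph.degreeInto, codegree]
  refine le_trans ?_ (card_union_le _ _)
  have hd : ∀ R ∈ powersetCard (k - 1) B', Disjoint {v} R := by
    intro R hR
    rw [disjoint_singleton_left]
    exact fun h => disjoint_left.1 hAB hv (hB' ((mem_powersetCard.1 hR).1 h))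
  refine card_le_card_of_injOn (fun R => {v} ∪ R) (fun R hR => ?_) fun R hR R' hR' h => ?_
  · have hR' := mem_powersetCard.1 (mem_coe.1 hR)
    rw [mem_coe, mem_union]
    by_cases hE : {v} ∪ R ∈ H.edges
    · exact Or.inl (mem_filter.2 ⟨hE, R, hR, ∅, by simp, by rw [union_empty]⟩)
    · refine Or.inr (mem_filter.2 ⟨mem_missing.2 ⟨?_, hE⟩, subset_union_left⟩)
      have h1 : {v} ∈ crossing A B 1 := by
        rw [mem_crossing, card_singleton, singleton_inter_of_mem hv, card_singleton]
        exact ⟨rfl, rfl, singleton_subset_iff.2 (mem_union_left _ hv)⟩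
      exact union_mem_crossing hAB h1 (hR'.1.trans hB') hR'.2 (hd R hR) (by omega)
  · have h3 := hd R hR
    have h4 := hd R' hR'
    rw [← union_sdiff_cancel_left h3, ← union_sdiff_cancel_left h4]
    exact congrArg (· \ {v}) h

end LoosePath

/-! ### Paths with a surplus of edges inside `B` -/

namespace LoosePath

variable {V : Type*} [DecidableEq V] [Fintype V] {k ℓ : ℕ}

lemma one_sub_mul_le_degreeInto {H : UniformHypergraph V k} {A B A' B' L : Finset V} {j : ℕ}
    {ρ ε : ℝ} (hk : 1 ≤ k) (hAB : Disjoint A B) (hA' : A' ⊆ A) (hB' : B' ⊆ B) (hL : L ⊆ B)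
    (hj : 1 ≤ j) (hLj : #L + 1 + j = k) (hA'n : Fintype.card V ≤ 4 * k * #A')
    (hB'n : Fintype.card V ≤ 4 * k * #B') (hn : 8 * k ^ 2 ≤ Fintype.card V)
    (hmiss : (codegree (missing H A B) L : ℝ) ≤ ε * (Fintype.card V : ℝ) ^ (j + 1))
    (hρ : 0 ≤ ρ) (hε : ε ≤ ρ * subsetDensity k / 2)
    (hkn : (k : ℝ) ≤ ρ * subsetDensity k / 2 * Fintype.card V) :
    (1 - ρ) * (#A' : ℝ) * ((#B').choose j : ℝ) ≤ H.degreeInto L A' 1 B' j := by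
  have h1 := mul_choose_le_degreeInto (H := H) hAB hA' hB' hL hj hLj
  have h2 := subsetDensity_mul_le_mul_choose hk (r := j) (by omega) hB'n hA'n hn
  have h3 : (#L : ℝ) * (Fintype.card V : ℝ) ^ j ≤
      ρ * subsetDensity k / 2 * (Fintype.card V : ℝ) ^ (j + 1) := by
    have h4 : (#L : ℝ) ≤ k := by exact_mod_cast (by omega : #L ≤ k)
    calc (#L : ℝ) * (Fintype.card V : ℝ) ^ j
        ≤ ρ * subsetDensity k / 2 * Fintype.card V * (Fintype.card V : ℝ) ^ j := by
          gcongr; linarith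
      _ = _ := by ring
  have h4 : ε * (Fintype.card V : ℝ) ^ (j + 1) ≤
      ρ * subsetDensity k / 2 * (Fintype.card V : ℝ) ^ (j + 1) := by gcongr
  have h5 := mul_le_mul_of_nonneg_left h2 hρ
  linarith

/-- A typical path that contains all vertices outside `A ∪ B`, and as many vertices outside `B`
as its number of edges requires, has all properties asked for. -/
lemma exists_list_of_isTypicalPath {H : UniformHypergraph V k} {A B : Finset V} {κ τ ε ρ : ℝ}
    {m t : ℕ} (h : IsReservoir H ℓ A B κ τ) {L₀ L₁ X : Finset V}
    (hX : IsTypicalPath H ℓ A B τ L₀ L₁ X t) (hVX : ∀ v ∉ A ∪ B, v ∈ X)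
    (hm : Fintype.card V = m * (k - ℓ))
    (hbal : 2 * #(X \ B) + m = t + 2 * #(univ \ B))
    (hA : Fintype.card V ≤ 4 * k * #(A \ X)) (hB : Fintype.card V ≤ 4 * k * #(B \ X))
    (hn : 8 * k ^ 2 ≤ Fintype.card V)
    (hmiss : ∀ v ∈ A ∪ B, (codegree (missing H A B) {v} : ℝ) ≤
      ε * (Fintype.card V : ℝ) ^ (k - 1))
    (hρ : 0 ≤ ρ) (hε : ε ≤ ρ * subsetDensity k / 2) (hτ : τ ≤ ρ * subsetDensity k / 2)
    (hkn : (k : ℝ) ≤ ρ * subsetDensity k / 2 * Fintype.card V) :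
    ∃ (Q : List V) (L₀ L₁ A B : Finset V),
      H.IsNonemptyPath ℓ Q ∧ L₀ = firstEnd ℓ Q ∧ L₁ = lastEnd ℓ Q ∧
      Disjoint A B ∧ A ∪ B = (Finset.univ \ Q.toFinset) ∪ L₀ ∪ L₁ ∧
      L₀ ⊆ B ∧ L₁ ⊆ B ∧
      B.card = (2 * k - 2 * ℓ - 1) * A.card + ℓ ∧
      (∀ v ∈ A, (1 - ρ) * (B.card.choose (k - 1) : ℝ) ≤
        (H.degreeInto {v} B (k - 1) ∅ 0 : ℝ)) ∧
      (∀ v ∈ B, (1 - ρ) * (A.card : ℝ) * (B.card.choose (k - 2) : ℝ) ≤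
        (H.degreeInto {v} A 1 B (k - 2) : ℝ)) ∧
      (1 - ρ) * (A.card : ℝ) * (B.card.choose (k - ℓ - 1) : ℝ) ≤
        (H.degreeInto L₀ A 1 B (k - ℓ - 1) : ℝ) ∧
      (1 - ρ) * (A.card : ℝ) * (B.card.choose (k - ℓ - 1) : ℝ) ≤
        (H.degreeInto L₁ A 1 B (k - ℓ - 1) : ℝ) := by
  have hℓ := h.one_le
  have hℓk := h.two_mul_lt
  have hAB := h.disjoint
  obtain ⟨Q, hQ, hQ₀, hQ₁, hQX⟩ := hX.path.exists_list hℓk.le hX.one_le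
  have hL₀X := hX.path.first_subset
  have hL₁X := hX.path.last_subset
  have hL₀c := hX.path.card_first
  have hL₁c := hX.path.card_last
  have hd := hX.path.disjoint_ends hX.one_le
  have hXc := hX.path.card_eq hℓk.le
  set A' := A \ X with hA'
  set B' := (B \ X) ∪ (L₀ ∪ L₁) with hB'
  have hA'A : A' ⊆ A := sdiff_subset
  have hB'B : B' ⊆ B := union_subset sdiff_subset (union_subset hX.first_subset hX.last_subset)
  have hB'n : Fintype.card V ≤ 4 * k * #B' :=
    hB.trans (Nat.mul_le_mul_left _ (card_le_card subset_union_left))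
  have hk0 : (0 : ℝ) < k := by exact_mod_cast (by omega : 0 < k)
  have hcard : #B' = #(B \ X) + 2 * ℓ := by
    rw [hB', card_union_of_disjoint, card_union_of_disjoint hd, hL₀c, hL₁c, two_mul]
    exact disjoint_of_subset_right (union_subset hL₀X hL₁X) sdiff_disjoint
  have hcompl : #(univ \ B) = #A' + #(X \ B) := by
    rw [← card_union_of_disjoint]
    · congr 1
      ext x
      have h1 := hVX x
      have h2 : x ∈ A → x ∉ B := fun h => disjoint_left.1 hAB h
      simp only [hA', mem_sdiff, mem_union, mem_univ, true_and] at h1 ⊢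
      tauto
    · exact disjoint_of_subset_right sdiff_subset sdiff_disjoint
  have htotal : Fintype.card V = #X + #A' + #(B \ X) := by
    rw [← card_univ, ← card_union_of_disjoint, ← card_union_of_disjoint]
    · congr 1
      ext x
      have h1 := hVX x
      simp only [hA', mem_sdiff, mem_union, mem_univ, true_iff] at h1 ⊢
      tauto
    · refine disjoint_union_left.2 ⟨disjoint_sdiff, ?_⟩
      exact disjoint_of_subset_left hA'A (disjoint_of_subset_right sdiff_subset hAB)
    · exact disjoint_sdiff
  refine ⟨Q, L₀, L₁, A', B', hQ, hQ₀.symm, hQ₁.symm, disjoint_of_subset_left hA'A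
    (disjoint_of_subset_right hB'B hAB), ?_, subset_union_left.trans subset_union_right,
    subset_union_right.trans subset_union_right, ?_, fun v hv => ?_, fun v hv => ?_, ?_, ?_⟩
  · rw [hQX]
    ext x
    have h1 := hVX x
    simp only [hA', hB', mem_sdiff, mem_union, mem_univ, true_and] at h1 ⊢
    tauto
  · have hmt : m = t + 2 * #A' := by omega
    obtain ⟨d, hd'⟩ : ∃ d, k - ℓ = d + 1 := ⟨k - ℓ - 1, by omega⟩
    rw [show 2 * k - 2 * ℓ - 1 = 2 * d + 1 by omega, hcard]
    rw [hd'] at hm hXc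
    rw [hm, hmt, hXc] at htotal
    have h2 : (t + 2 * #A') * (d + 1) = t * (d + 1) + (2 * d + 1) * #A' + #A' := by ring
    omega
  · have h1 := choose_le_degreeInto (H := H) (by omega) hAB hB'B (hA'A hv)
    have h2 : (((#B').choose (k - 1) : ℕ) : ℝ) ≤ H.degreeInto {v} B' (k - 1) ∅ 0 +
        codegree (missing H A B) {v} := by exact_mod_cast h1
    have h3 := hmiss v (mem_union_left _ (hA'A hv))
    have h4 := subsetDensity_mul_le_choose (k := k) (by omega) (Nat.sub_le k 1) hB'n hn
    have h5 : ε * (Fintype.card V : ℝ) ^ (k - 1) ≤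
        ρ * subsetDensity k / 2 * (Fintype.card V : ℝ) ^ (k - 1) := by gcongr
    have h6 := mul_le_mul_of_nonneg_left h4 hρ
    have h7 : 0 ≤ ρ * ((#B').choose (k - 1) : ℕ) := by positivity
    linarith
  · refine one_sub_mul_le_degreeInto (by omega) hAB hA'A hB'B
      (singleton_subset_iff.2 (hB'B hv)) (by omega) (by rw [card_singleton]; omega) hA hB'n hn ?_
      hρ hε hkn
    rw [show k - 2 + 1 = k - 1 by omega]
    exact hmiss v (mem_union_right _ (hB'B hv))
  · refine one_sub_mul_le_degreeInto (by omega) hAB hA'A hB'B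
      hX.first_subset (by omega) (by omega) hA hB'n hn ?_ hρ hτ hkn
    rw [show k - ℓ - 1 + 1 = k - ℓ by omega]
    exact hX.first_typical
  · refine one_sub_mul_le_degreeInto (by omega) hAB hA'A hB'B
      hX.last_subset (by omega) (by omega) hA hB'n hn ?_ hρ hτ hkn
    rw [show k - ℓ - 1 + 1 = k - ℓ by omega]
    exact hX.last_typical

/-- If `B` has at least `b` vertices, where `n - b` is the size of the smaller part of the extremal
example, then the degree condition yields a typical path with as many surplus edges inside `B` as
are needed: they replace the edges that the missing vertices outside `B` would have covered. -/
lemma exists_isTypicalPath_of_le_card {H : UniformHypergraph V k} {A B : Finset V} {κ τ D : ℝ}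
    {b q e : ℕ} (h : IsReservoir H ℓ A B κ τ) (hB : #B = b + q) (he : e ≤ 1)
    (hδ : ∀ S : Finset V, #S = k - 2 → codegree (nonEdges H) S + 1 +
      (if e = 1 ∧ ℓ = 1 then 1 else 0) ≤ (b - (k - 2)).choose 2)
    (hb : Fintype.card V ≤ 2 * b) (hn : 16 * k ^ 2 ≤ Fintype.card V)
    (hdeg : ∀ v ∈ B, (#{Z ∈ H.edges | {v} ⊆ Z ∧ Z ⊆ B} : ℝ) ≤
      D * (Fintype.card V : ℝ) ^ (k - 1))
    (hD0 : 0 ≤ D) (hD : 2 ^ k * (16 * k) * D < subsetDensity k)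
    (hnb : 2 * (blockingBound k 2 + 5 * k) ≤ Fintype.card V)
    (hκ : (8 * k * (2 * q + 2) + 20 * k : ℝ) ≤ κ / 4 * Fintype.card V) :
    ∃ L₀ L₁ X t, IsTypicalPath H ℓ A B τ L₀ L₁ X t ∧ X ⊆ A ∪ B ∧
      t ≤ 16 + 14 * q ∧ 2 * #(X \ B) + (2 * q + 1 + e) ≤ t := by
  have hℓ := h.one_le
  have hℓk := h.two_mul_lt
  have hk0 : (0 : ℝ) ≤ k := Nat.cast_nonneg k
  -- It suffices to find a matching of `2q + 1 + e` edges.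
  have hmatch : ∀ M ⊆ ({Z ∈ H.edges | Z ⊆ B} : Finset (Finset V)), #M = 2 * q + 1 + e →
      (M : Set (Finset V)).PairwiseDisjoint id → ∃ L₀ L₁ X t,
        IsTypicalPath H ℓ A B τ L₀ L₁ X t ∧ X ⊆ A ∪ B ∧ t ≤ 16 + 14 * q ∧
          2 * #(X \ B) + (2 * q + 1 + e) ≤ t := by
    intro M hM hMc hMd
    obtain ⟨L₀, L₁, X, t, hX, hXAB, -, ht, hs⟩ := IsTypicalPath.exists_matching_subset h M
      (fun Z hZ => mem_filter.1 (hM hZ)) hMd ∅ (fun Z _ => disjoint_empty_right Z) (by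
        rw [hMc, card_empty]
        have he' : (e : ℝ) ≤ 1 := by exact_mod_cast he
        push_cast
        nlinarith)
    exact ⟨L₀, L₁, X, t, hX, hXAB, by omega, by omega⟩
  have hδ' : ∀ S : Finset V, #S = k - 2 →
      codegree (nonEdges H) S ≤ (b - (k - 2)).choose 2 := fun S hS =>
    le_trans (by omega) (hδ S hS)
  obtain hq | rfl : 1 ≤ q ∨ q = 0 := by omega
  · obtain ⟨M, hM, hMc, hMd⟩ := exists_matching_of_lt_card (J := 2 * q + 1 + e) (by omega) hB hq
      (by omega) hδ' hb hn hdeg hD0 hD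
    exact hmatch M hM hMc hMd
  set F : Finset (Finset V) := {Z ∈ H.edges | Z ⊆ B} with hF
  have hFk : ∀ Z ∈ F, #Z = k := fun Z hZ => H.card_of_mem_edges Z (mem_filter.1 hZ).1
  have hcov : ∀ S ⊆ B, #S = k - 2 →
      1 + (if e = 1 ∧ ℓ = 1 then 1 else 0) ≤ codegree F S := by
    intro S hS hSc
    have h1 := card_edges_add_card_nonEdges H hS (by omega)
    rw [hSc, hB, add_zero, show k - (k - 2) = 2 by omega] at h1
    have h2 : #{Z ∈ nonEdges H | S ⊆ Z ∧ Z ⊆ B} ≤ codegree (nonEdges H) S :=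
      card_le_card fun Z hZ => by
        rw [mem_filter] at hZ
        exact mem_filter.2 ⟨hZ.1, hZ.2.1⟩
    have h3 := hδ S hSc
    have h4 : codegree F S = #{Z ∈ H.edges | S ⊆ Z ∧ Z ⊆ B} := by
      rw [codegree, hF, filter_filter]
      congr 1
      ext Z
      simp only [mem_filter]
      tauto
    omega
  have hcov' : ∀ S ⊆ B, #S = k - 2 → ∃ Z ∈ F, S ⊆ Z := by
    intro S hS hSc
    obtain ⟨Z, hZ⟩ := card_pos.1 (show 0 < #{Z ∈ F | S ⊆ Z} from by
      have := hcov S hS hSc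
      rw [codegree] at this
      omega)
    exact ⟨Z, mem_filter.1 hZ⟩
  have hBc : blockingBound k 2 + 5 * k ≤ #B := by omega
  obtain rfl | rfl : e = 0 ∨ e = 1 := by omega
  · obtain ⟨S, hS, hSc⟩ := exists_subset_card_eq (show k - 2 ≤ #B by omega)
    obtain ⟨Z, hZ, -⟩ := hcov' S hS hSc
    exact hmatch {Z} (singleton_subset_iff.2 hZ) (by simp) (by simp)
  · have hpair : ∃ Z₁ ∈ F, ∃ Z₂ ∈ F, Disjoint Z₁ Z₂ ∨ #(Z₁ ∩ Z₂) = ℓ := by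
      obtain rfl | hℓ2 : ℓ = 1 ∨ 2 ≤ ℓ := by omega
      · exact exists_disjoint_or_card_inter_eq_one hFk (by omega) (by simpa using hcov) (by omega)
      · exact exists_disjoint_or_card_inter_eq_of_two_le hFk hℓ2 hℓk hcov' hBc
    obtain ⟨Z₁, hZ₁, Z₂, hZ₂, hd | hc⟩ := hpair
    · have hne : Z₁ ≠ Z₂ := by
        rintro rfl
        have h1 := hFk Z₁ hZ₁
        rw [disjoint_self.1 hd, bot_eq_empty, card_empty] at h1
        omega
      refine hmatch {Z₁, Z₂} (insert_subset hZ₁ (singleton_subset_iff.2 hZ₂))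
        (by rw [card_pair hne]) ?_
      rw [coe_pair, Set.pairwiseDisjoint_insert]
      refine ⟨by simp, fun Z hZ _ => ?_⟩
      rw [Set.mem_singleton_iff] at hZ
      rw [hZ]
      exact hd
    · obtain ⟨hZ₁E, hZ₁B⟩ := mem_filter.1 hZ₁
      obtain ⟨hZ₂E, hZ₂B⟩ := mem_filter.1 hZ₂
      obtain ⟨L₀, L₁, X, t, hX, hXAB, ht, hs⟩ := IsTypicalPath.exists_of_card_inter_eq h hZ₁E hZ₂E
        hZ₁B hZ₂B hc (by push_cast at hκ; linarith)
      exact ⟨L₀, L₁, X, t, hX, hXAB, by omega, by omega⟩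

end LoosePath

/-! ### The theorem -/

namespace LoosePath

variable {V : Type*} [DecidableEq V] [Fintype V] {k ℓ : ℕ}

set_option maxHeartbeats 1000000 in
/-- The theorem for explicit parameters: `τ` bounds the missing sets at a typical `ℓ`-set, `ε` those
at a classified vertex, and `η` the proportion of vertices on the wrong side. -/
lemma exists_list_of_isExtremal {H : UniformHypergraph V k} {ρ τ ε η : ℝ} {m : ℕ} (hℓ : 1 ≤ ℓ)
    (hℓk : 2 * ℓ < k) (hm : Fintype.card V = m * (k - ℓ)) (hρ : 0 ≤ ρ) (hτ : 0 < τ)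
    (hτκ : 2 ^ (k + 4) * τ ≤ reservoirDensity k ^ 2) (hτρ : τ ≤ ρ * subsetDensity k / 2)
    (hε : 0 < ε) (hε1 : ε ≤ 1) (hετ : 2 ^ k * (2 ^ k * ε + 2 * η) ≤ reservoirDensity k / 8 * τ)
    (hερ : 2 ^ k * ε + 2 * η ≤ ρ * subsetDensity k / 2)
    (hεc : 2 ^ k * (16 * k) * (ε + η) < subsetDensity k) (hη : 0 < η)
    (hηε : 10000 * k * η ≤ ε * reservoirDensity k) (hn1 : 1 ≤ η * Fintype.card V)
    (hn2 : 16 * k ^ 2 ≤ Fintype.card V)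
    (hn3 : (k : ℝ) ≤ ρ * subsetDensity k / 2 * Fintype.card V)
    (hn4 : 2 * (blockingBound k 2 + 5 * k) ≤ Fintype.card V)
    (hH : H.IsExtremal ℓ (ε * η / 4 ^ k))
    (hδ : (extremalExample k ℓ (Fintype.card V)).minDegree (k - 2) < H.minDegree (k - 2)) :
    ∃ (Q : List V) (L₀ L₁ A B : Finset V),
      H.IsNonemptyPath ℓ Q ∧ L₀ = firstEnd ℓ Q ∧ L₁ = lastEnd ℓ Q ∧
      Disjoint A B ∧ A ∪ B = (Finset.univ \ Q.toFinset) ∪ L₀ ∪ L₁ ∧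
      L₀ ⊆ B ∧ L₁ ⊆ B ∧
      B.card = (2 * k - 2 * ℓ - 1) * A.card + ℓ ∧
      (∀ v ∈ A, (1 - ρ) * (B.card.choose (k - 1) : ℝ) ≤
        (H.degreeInto {v} B (k - 1) ∅ 0 : ℝ)) ∧
      (∀ v ∈ B, (1 - ρ) * (A.card : ℝ) * (B.card.choose (k - 2) : ℝ) ≤
        (H.degreeInto {v} A 1 B (k - 2) : ℝ)) ∧
      (1 - ρ) * (A.card : ℝ) * (B.card.choose (k - ℓ - 1) : ℝ) ≤
        (H.degreeInto L₀ A 1 B (k - ℓ - 1) : ℝ) ∧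
      (1 - ρ) * (A.card : ℝ) * (B.card.choose (k - ℓ - 1) : ℝ) ≤
        (H.degreeInto L₁ A 1 B (k - ℓ - 1) : ℝ) := by
  obtain ⟨A₀, B₀, hAB₀, hABu, hA₀, -, hB₀⟩ := hH
  have hk3 : 3 ≤ k := by omega
  have hk0 : (1 : ℝ) ≤ k := by exact_mod_cast (by omega : 1 ≤ k)
  have hκ0 := reservoirDensity_pos (k := k) (by omega)
  have hc1 := subsetDensity_le (k := k) (by omega)
  have hκc := reservoirDensity_le (k := k) (by omega)
  have hκk : reservoirDensity k * (32 * k) ≤ 1 := by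
    have h1 := reservoirDensity_mul (k := k) (by omega)
    have h2 : (1 : ℝ) ≤ 2 ^ k := one_le_pow₀ (by norm_num)
    have h3 : reservoirDensity k * (32 * k) ≤ 2 ^ k * (reservoirDensity k * (32 * k)) :=
      le_mul_of_one_le_left (by positivity) h2
    linarith
  have hk2 : 16 * k ≤ 16 * k ^ 2 := Nat.mul_le_mul_left _ (Nat.le_self_pow two_ne_zero k)
  have hm2 : 2 ≤ m := by
    by_contra hcon
    have h1 : m * (k - ℓ) ≤ 1 * (k - ℓ) := Nat.mul_le_mul_right _ (by omega)
    omega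
  have hab : #A₀ + #B₀ = Fintype.card V := by
    rw [← card_union_of_disjoint hAB₀, hABu, card_univ]
  obtain ⟨ha, hdiv, hma⟩ := eq_extremalExampleSize (by omega) hm hm2 hA₀
  set n := Fintype.card V with hn_def
  set N : ℝ := (n : ℝ) with hN
  set a := #A₀ with ha_def
  set b := #B₀ with hb_def
  set e : ℕ := if Even m then 1 else 0 with he
  have hem : e = 1 ↔ Even m := by
    rw [he]
    split_ifs with h <;> simp [h]
  have he1 : e ≤ 1 := by rw [he]; split_ifs <;> omega
  have hnpos : 0 < n := by omega
  have hN0 : 0 < N := by rw [hN]; exact_mod_cast hnpos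
  have hN16 : 16 * (k : ℝ) ^ 2 ≤ N := by rw [hN]; exact_mod_cast hn2
  -- The sizes of the two parts.
  have h2a : 2 * a * (k - ℓ) ≤ n ∧ n ≤ 2 * a * (k - ℓ) + 2 * (k - ℓ) := by
    constructor
    · rw [hm]; exact Nat.mul_le_mul_right _ (by omega)
    · rw [hm, ← add_mul]; exact Nat.mul_le_mul_right _ (by omega)
  have ha4 : 4 * a ≤ n := by
    have : 2 * a * 2 ≤ 2 * a * (k - ℓ) := Nat.mul_le_mul_left _ (by omega)
    omega
  have ha2 : n ≤ 2 * k * a + 2 * k := by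
    have h1 : 2 * a * (k - ℓ) ≤ 2 * a * k := Nat.mul_le_mul_left _ (Nat.sub_le _ _)
    have h2 : 2 * a * k = 2 * k * a := by ring
    omega
  have hδ₀ : ∀ S : Finset V, #S = k - 2 → codegree (nonEdges H) S + 1 +
      (if e = 1 ∧ ℓ = 1 then 1 else 0) ≤ (b - (k - 2)).choose 2 := by
    intro S hS
    have h1 := codegree_nonEdges_add_le (ℓ := ℓ) hk3 (by rw [← ha]; omega) hδ hS
    rw [← ha, hdiv, show n - a = b by omega] at h1
    simpa only [hem] using h1
  have hδ' : ∀ S : Finset V, #S = k - 2 →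
      codegree (nonEdges H) S ≤ (b - (k - 2)).choose 2 := fun S hS =>
    le_trans (by omega) (hδ₀ S hS)
  -- The classification of the vertices.
  obtain ⟨A, B, hAB, hAη, hBη, hmiss, hout, hmax⟩ := exists_classification hk3 hδ' hε hnpos (η := η)
    (by
      have h1 : ((n.choose k : ℕ) : ℝ) ≤ N ^ k := by
        rw [hN]; exact_mod_cast Nat.choose_le_pow n k
      have h2 : (0 : ℝ) < 4 ^ k := by positivity
      calc (H.edgesWithin B₀ : ℝ) * 4 ^ k
          ≤ ε * η / 4 ^ k * (n.choose k : ℕ) * 4 ^ k := by gcongr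
        _ ≤ ε * η / 4 ^ k * N ^ k * 4 ^ k := by gcongr
        _ = ε * η * N ^ k := by field_simp)
    (by
      have h1 := subsetDensity_mul_le_choose (k := k) (r := k - 1) (u := b - 1) (n := n) (by omega)
        (by omega) (by
          have h1 : n ≤ 4 * (b - 1) := by omega
          exact h1.trans (Nat.mul_le_mul_right _ (by omega))) (by omega)
      refine lt_of_lt_of_le ?_ h1
      refine mul_lt_mul_of_pos_right ?_ (by positivity)
      have h2 : (1 : ℝ) ≤ 2 ^ k := one_le_pow₀ (by norm_num)
      have h3 : (16 : ℝ) * k ≤ 2 ^ k * (16 * k) := le_mul_of_one_le_left (by positivity) h2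
      have h4 : 2 * (ε + η) ≤ 2 ^ k * (16 * k) * (ε + η) :=
        mul_le_mul_of_nonneg_right (by linarith) (by positivity)
      linarith)
  have hBB : b ≤ #B + #(B₀ \ B) := by
    have h1 := card_inter_add_card_sdiff B₀ B
    have h2 := card_le_card (inter_subset_right : B₀ ∩ B ⊆ B)
    omega
  have hBB' : #B ≤ b + #((univ \ B₀) \ A) := by
    have h1 := card_inter_add_card_sdiff B B₀
    have h2 := card_le_card (inter_subset_right : B ∩ B₀ ⊆ B₀)
    have h3 : #(B \ B₀) ≤ #((univ \ B₀) \ A) := card_le_card fun x hx => by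
      rw [mem_sdiff] at hx
      exact mem_sdiff.2 ⟨mem_sdiff.2 ⟨mem_univ _, hx.2⟩, disjoint_right.1 hAB hx.1⟩
    omega
  have hAA : a ≤ #A + #((univ \ B₀) \ A) := by
    have h1 : univ \ B₀ = A₀ := by
      rw [← hABu, union_sdiff_right, sdiff_eq_self_of_disjoint hAB₀]
    rw [h1]
    have h2 := card_inter_add_card_sdiff A₀ A
    have h3 := card_le_card (inter_subset_right : A₀ ∩ A ⊆ A)
    omega
  have hcast1 : (b : ℝ) ≤ #B + η * N := by
    have : (b : ℝ) ≤ #B + #(B₀ \ B) := by exact_mod_cast hBB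
    linarith
  have hcast2 : (#B : ℝ) ≤ b + η * N := by
    have : (#B : ℝ) ≤ b + #((univ \ B₀) \ A) := by exact_mod_cast hBB'
    linarith
  have hcast3 : (a : ℝ) ≤ #A + η * N := by
    have : (a : ℝ) ≤ #A + #((univ \ B₀) \ A) := by exact_mod_cast hAA
    linarith
  have hηN : 0 < η * N := by positivity
  -- All error terms below are multiples of `k * η * n`.
  have hκN : 10000 * (k * (η * N)) ≤ reservoirDensity k * N := by
    have h1 : ε * reservoirDensity k ≤ reservoirDensity k := mul_le_of_le_one_left hκ0.le hε1
    have h2 : 10000 * k * η * N ≤ reservoirDensity k * N := by gcongr; linarith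
    linarith
  have hεN : 10000 * (k * (η * N)) ≤ ε * N := by
    have h1 : ε * reservoirDensity k ≤ ε := mul_le_of_le_one_right hε.le (hκc.trans hc1)
    have h2 : 10000 * k * η * N ≤ ε * N := by gcongr; linarith
    linarith
  have hkkN : 10000 * (k * (k * (η * N))) * 32 ≤ N := by
    have h1 := mul_le_mul_of_nonneg_left hκN (by positivity : (0 : ℝ) ≤ 32 * k)
    have h2 := mul_le_mul_of_nonneg_right hκk hN0.le
    linarith
  have hkη : η * N ≤ k * (η * N) := le_mul_of_one_le_left hηN.le hk0
  have hkkη : k * (η * N) ≤ k * (k * (η * N)) := le_mul_of_one_le_left (by positivity) hk0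
  have hk1η : (k : ℝ) ≤ k * (η * N) := le_mul_of_one_le_right (by positivity) hn1
  have ha2' : N ≤ 2 * k * a + 2 * k := by rw [hN]; exact_mod_cast ha2
  have hbn : b ≤ n := by omega
  have hab' : (a : ℝ) + b = N := by rw [hN]; exact_mod_cast hab
  have ha4' : 4 * (a : ℝ) ≤ N := by rw [hN]; exact_mod_cast ha4
  have hcast3k := mul_le_mul_of_nonneg_left hcast3 (by positivity : (0 : ℝ) ≤ 2 * k)
  have hres : IsReservoir H ℓ A B (reservoirDensity k) τ := by
    refine isReservoir_of_codegree_le hℓ hℓk hAB hδ' hbn ?_ ?_ ?_ hn2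
      (fun v hv => hmiss v (mem_union_left _ hv)) hτ hτκ hετ
    · have h1 : η * N ≤ N / (32 * k) := by
        rw [le_div_iff₀ (by positivity)]
        linarith
      linarith
    · have h1 : N ≤ 4 * k * #A := by linarith
      rw [hN] at h1
      exact_mod_cast h1
    · have h1 : N ≤ 2 * #B := by linarith
      rw [hN] at h1
      exact_mod_cast h1
  have hBc : #(univ \ B) + #B = n := by
    rw [card_sdiff_of_subset (subset_univ _), card_univ]
    have : #B ≤ n := card_le_univ B
    omega
  -- A path with a sufficient surplus of edges inside `B`.
  obtain ⟨L₀, L₁, X, t, hX, hXAB, ht, hs⟩ : ∃ L₀ L₁ X t, IsTypicalPath H ℓ A B τ L₀ L₁ X t ∧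
      X ⊆ A ∪ B ∧ (t : ℝ) ≤ 16 + 14 * (η * N) ∧ 2 * #(X \ B) + m ≤ t + 2 * #(univ \ B) := by
    rcases le_or_gt b #B with hle | hlt
    · obtain ⟨q, hq⟩ := Nat.exists_eq_add_of_le hle
      have hqη : (q : ℝ) ≤ η * N := by
        rw [hq] at hcast2
        push_cast at hcast2
        linarith
      have hkq : (k : ℝ) * q ≤ k * (η * N) := by gcongr
      obtain ⟨L₀, L₁, X, t, hX, hXAB, ht, hs⟩ := exists_isTypicalPath_of_le_card hres hq he1 hδ₀
        (by omega) hn2 hmax (by positivity) hεc hn4 (by linarith)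
      refine ⟨L₀, L₁, X, t, hX, hXAB, ?_, by omega⟩
      have ht' : (t : ℝ) ≤ 16 + 14 * q := by exact_mod_cast ht
      linarith
    · obtain ⟨L₀, L₁, X, hX, hXAB, hXB, -⟩ := IsTypicalPath.exists_two_edges hres (W := ∅) (by
        rw [card_empty, Nat.cast_zero]; linarith)
      exact ⟨L₀, L₁, X, 2, hX, hXAB, by push_cast; linarith, by omega⟩
  -- The remaining vertices are added to the path.
  have hU : (#(univ \ (A ∪ B)) : ℝ) ≤ 2 * (η * N) := by
    have h1 : univ \ (A ∪ B) ⊆ ((univ \ B₀) \ A) ∪ (B₀ \ B) := by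
      intro x
      simp only [mem_sdiff, mem_union, mem_univ, true_and]
      tauto
    have h2 : (#(univ \ (A ∪ B)) : ℝ) ≤ #((univ \ B₀) \ A) + #(B₀ \ B) := by
      exact_mod_cast (card_le_card h1).trans (card_union_le _ _)
    linarith
  have htU : (k : ℝ) * (t + 8 * #(univ \ (A ∪ B)) + 20) ≤ 100 * (k * (η * N)) := by
    have h1 : (t : ℝ) + 8 * #(univ \ (A ∪ B)) + 20 ≤ 100 * (η * N) := by linarith
    calc (k : ℝ) * (t + 8 * #(univ \ (A ∪ B)) + 20) ≤ k * (100 * (η * N)) := by gcongr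
      _ = _ := by ring
  obtain ⟨L₁', X', t', hX', -, hUX', ht', hs'⟩ := hX.exists_absorb_vertices hres hXAB (γ := ε / 2)
    (by positivity) (univ \ (A ∪ B)) (fun v hv => (mem_sdiff.1 hv).2)
    (fun v hv => le_trans (by
      gcongr
      have : η ≤ k * η := le_mul_of_one_le_left hη.le hk0
      have h1 : ε * reservoirDensity k ≤ ε := mul_le_of_le_one_right hε.le (hκc.trans hc1)
      linarith) (hout v (mem_sdiff.1 hv).2)) (by linarith) (by linarith)
  have ht'' : (t' : ℝ) ≤ t + 8 * #(univ \ (A ∪ B)) := by exact_mod_cast ht'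
  -- The balance is reached by edges with a private vertex outside `B`.
  obtain ⟨j, hj⟩ : ∃ j, t' + 2 * #(univ \ B) = 2 * #(X' \ B) + m + j :=
    Nat.exists_eq_add_of_le (by omega)
  have hjle : (j : ℝ) ≤ t' + 2 * (η * N) := by
    have h1 : j + m ≤ t' + 2 * #(univ \ B) := by omega
    have h2 : (j : ℝ) + m ≤ t' + 2 * #(univ \ B) := by exact_mod_cast h1
    have h3 : (#(univ \ B) : ℝ) + #B = N := by rw [hN]; exact_mod_cast hBc
    have h4 : 2 * a ≤ m := by omega
    have h5 : (2 : ℝ) * a ≤ m := by exact_mod_cast h4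
    linarith
  have htj : (k : ℝ) * (t' + j + 2) ≤ 200 * (k * (η * N)) := by
    have h1 : (t' : ℝ) + j + 2 ≤ 200 * (η * N) := by linarith
    calc (k : ℝ) * (t' + j + 2) ≤ k * (200 * (η * N)) := by gcongr
      _ = _ := by ring
  obtain ⟨L₁'', X'', hX'', hXX, hs''⟩ := hX'.exists_prolong hres j (by linarith)
  have hX''c := hX''.card_le hℓk
  push_cast at hX''c
  have hX''c' : (#X'' : ℝ) ≤ 200 * (k * (η * N)) := by linarith
  have hX''k : (k : ℝ) * #X'' ≤ 200 * (k * (k * (η * N))) := by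
    calc (k : ℝ) * #X'' ≤ k * (200 * (k * (η * N))) := by gcongr
      _ = _ := by ring
  refine exists_list_of_isTypicalPath hres hX'' (fun v hv => hXX (hUX' (mem_sdiff.2
    ⟨mem_univ _, hv⟩))) hm (by omega) ?_ ?_ (by omega) hmiss hρ hερ hτρ hn3
  · have h1 : (#A : ℝ) ≤ #(A \ X'') + #X'' := by
      have h2 := le_card_sdiff X'' A
      have h3 : #A ≤ #(A \ X'') + #X'' := by omega
      exact_mod_cast h3
    have h2 := mul_le_mul_of_nonneg_left h1 (by positivity : (0 : ℝ) ≤ 2 * k)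
    have h3 : N ≤ 4 * k * #(A \ X'') := by linarith
    rw [hN] at h3
    exact_mod_cast h3
  · have h1 : (#B : ℝ) ≤ #(B \ X'') + #X'' := by
      have h2 := le_card_sdiff X'' B
      have h3 : #B ≤ #(B \ X'') + #X'' := by omega
      exact_mod_cast h3
    have h2 : N ≤ 4 * #(B \ X'') := by linarith
    have h3 : (#(B \ X'') : ℝ) ≤ k * #(B \ X'') :=
      le_mul_of_one_le_left (Nat.cast_nonneg _) hk0
    have h4 : N ≤ 4 * k * #(B \ X'') := by linarith
    rw [hN] at h4
    exact_mod_cast h4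

end LoosePath

theorem lemma2p1 (ρ : ℝ) (hρ : 0 < ρ) (k ℓ : ℕ) (hk : 3 ≤ k) (hℓ : 1 ≤ ℓ) (hℓk : 2 * ℓ < k) :
    ∃ ξ : ℝ, 0 < ξ ∧ ∃ n₀ : ℕ, ∀ n : ℕ, n₀ ≤ n → (k - ℓ) ∣ n →
      ∀ (V : Type*) [Fintype V] [DecidableEq V], Fintype.card V = n →
        ∀ H : UniformHypergraph V k, H.IsExtremal ℓ ξ →
          (extremalExample k ℓ n).minDegree (k - 2) < H.minDegree (k - 2) →
          ∃ (Q : List V) (L₀ L₁ A B : Finset V),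
            H.IsNonemptyPath ℓ Q ∧ L₀ = firstEnd ℓ Q ∧ L₁ = lastEnd ℓ Q ∧
            Disjoint A B ∧ A ∪ B = (Finset.univ \ Q.toFinset) ∪ L₀ ∪ L₁ ∧
            L₀ ⊆ B ∧ L₁ ⊆ B ∧
            B.card = (2 * k - 2 * ℓ - 1) * A.card + ℓ ∧
            (∀ v ∈ A, (1 - ρ) * (B.card.choose (k - 1) : ℝ) ≤
              (H.degreeInto {v} B (k - 1) ∅ 0 : ℝ)) ∧
            (∀ v ∈ B, (1 - ρ) * (A.card : ℝ) * (B.card.choose (k - 2) : ℝ) ≤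
              (H.degreeInto {v} A 1 B (k - 2) : ℝ)) ∧
            (1 - ρ) * (A.card : ℝ) * (B.card.choose (k - ℓ - 1) : ℝ) ≤
              (H.degreeInto L₀ A 1 B (k - ℓ - 1) : ℝ) ∧
            (1 - ρ) * (A.card : ℝ) * (B.card.choose (k - ℓ - 1) : ℝ) ≤
              (H.degreeInto L₁ A 1 B (k - ℓ - 1) : ℝ) := by
  have hk1 : 1 ≤ k := by omega
  have hk0 : (1 : ℝ) ≤ k := by exact_mod_cast hk1
  have hκ0 := LoosePath.reservoirDensity_pos hk1
  have hκc := LoosePath.reservoirDensity_le hk1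
  have hc1 := LoosePath.subsetDensity_le hk1
  have hc0 := LoosePath.subsetDensity_pos hk1
  have hκm := LoosePath.reservoirDensity_mul hk1
  set κ := LoosePath.reservoirDensity k with hκ
  set c := LoosePath.subsetDensity k with hc
  have h2k : (1 : ℝ) ≤ 2 ^ k := one_le_pow₀ (by norm_num)
  have hκ1 : κ ≤ 1 := hκc.trans hc1
  have hr0 : 0 < min ρ 1 := lt_min hρ one_pos
  have hr1 : min ρ 1 ≤ 1 := min_le_right _ _
  -- The constants satisfy `η ≪ ε ≪ τ ≪ κ ≪ c` and `τ ≪ ρ c`.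
  obtain ⟨τ, hτ⟩ : ∃ τ, τ = min ρ 1 * κ ^ 2 / 2 ^ (k + 5) := ⟨_, rfl⟩
  have hτ0 : 0 < τ := by rw [hτ]; positivity
  have hτm : 2 ^ (k + 4) * τ = min ρ 1 * κ ^ 2 / 2 := by
    rw [hτ, pow_succ 2 (k + 4)]; field_simp
  have hκ2 : κ ^ 2 ≤ κ := by nlinarith
  have h16 : 16 * 2 ^ k * τ = min ρ 1 * κ ^ 2 / 2 := by rw [← hτm]; ring
  have hτρ : 16 * τ ≤ ρ * c / 2 := by
    have h1 : 16 * τ ≤ 16 * 2 ^ k * τ := by nlinarith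
    have h2 : min ρ 1 * κ ^ 2 ≤ ρ * c := by
      gcongr
      · exact min_le_left _ _
      · exact hκ2.trans hκc
    linarith
  have hτκ : τ ≤ κ := by
    have h1 : τ ≤ 16 * 2 ^ k * τ := by nlinarith
    have h2 : min ρ 1 * κ ^ 2 ≤ 1 * κ := by gcongr
    linarith
  obtain ⟨ε, hε⟩ : ∃ ε, ε = κ * τ / (16 * (2 ^ k * 2 ^ k)) := ⟨_, rfl⟩
  have hε0 : 0 < ε := by rw [hε]; positivity
  have hεm : 16 * (2 ^ k * 2 ^ k) * ε = κ * τ := by rw [hε]; field_simp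
  have hεk : 16 * 2 ^ k * ε ≤ κ * τ := by
    have : 16 * 2 ^ k * ε ≤ 16 * (2 ^ k * 2 ^ k) * ε := by
      gcongr
      exact le_mul_of_one_le_left (by positivity) h2k
    linarith
  have hκτ : κ * τ ≤ τ := mul_le_of_le_one_left hτ0.le hκ1
  have hε16 : 16 * ε ≤ 16 * 2 ^ k * ε := by nlinarith
  obtain ⟨η, hη⟩ : ∃ η, η = ε * κ / (10000 * k) := ⟨_, rfl⟩
  have hη0 : 0 < η := by rw [hη]; positivity
  have hηm : 10000 * k * η = ε * κ := by rw [hη]; field_simp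
  have hηε : 10000 * η ≤ ε := by
    have h1 : 10000 * η ≤ 10000 * k * η := by nlinarith
    have h2 : ε * κ ≤ ε := mul_le_of_le_one_right hε0.le hκ1
    linarith
  have hη2 : 2 * η ≤ 2 ^ k * ε := by
    have h1 : ε ≤ 2 ^ k * ε := le_mul_of_one_le_left hε0.le h2k
    linarith
  obtain ⟨n₁, hn₁⟩ := exists_nat_ge (1 / η)
  obtain ⟨n₂, hn₂⟩ := exists_nat_ge (k / (ρ * c / 2))
  refine ⟨ε * η / 4 ^ k, by positivity,
    n₁ + n₂ + 16 * k ^ 2 + 2 * (LoosePath.blockingBound k 2 + 5 * k), ?_⟩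
  rintro n hn ⟨m, hm⟩ V _ _ rfl H hH hδ
  have hnR₁ : (n₁ : ℝ) ≤ Fintype.card V := by
    exact_mod_cast (by omega : n₁ ≤ Fintype.card V)
  have hnR₂ : (n₂ : ℝ) ≤ Fintype.card V := by
    exact_mod_cast (by omega : n₂ ≤ Fintype.card V)
  refine LoosePath.exists_list_of_isExtremal (τ := τ) (ε := ε) (η := η) (m := m) hℓ hℓk
    (by rw [hm, mul_comm]) hρ.le hτ0 ?_ (by linarith) hε0 (by linarith) ?_ ?_ ?_ hη0 hηm.le ?_
    (by omega) ?_ (by omega) hH hδ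
  · have h1 : min ρ 1 * κ ^ 2 ≤ κ ^ 2 := mul_le_of_le_one_left (by positivity) hr1
    have h2 : 0 ≤ κ ^ 2 := by positivity
    linarith
  · have h1 : 2 ^ k * (2 * η) ≤ 2 ^ k * (2 ^ k * ε) :=
      mul_le_mul_of_nonneg_left hη2 (by positivity)
    linarith
  · linarith
  · have h1 : 2 ^ k * (16 * k) * (ε + η) ≤ 2 ^ k * (16 * k) * (κ / 2) := by
      gcongr
      linarith
    have h2 : 0 < κ * (2 ^ k * (32 * k)) := by positivity
    linarith
  · have h1 := hn₁.trans hnR₁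
    rw [div_le_iff₀ hη0] at h1
    linarith
  · have h1 := hn₂.trans hnR₂
    rw [div_le_iff₀ (by positivity)] at h1
    linarith
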